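/- Let $\kappa>0$ and $h\in(0,1]$, and let $\xi=(\xi(x))_{x\in\mathbb Z}\in(-\infty,0]^{\mathbb Z}$ be a non-constant random potential with law $\mathrm{Prob}$, expectation $\langle\cdot\rangle$ and $\operatorname{ess\,sup}\xi(0)=0$. Assume that either $\mathrm{Prob}$ is ergodic under the left shift and concentrated on $[b,0]^{\mathbb Z}$ for some $b<0$, or the $\xi(x)$, $x\in\mathbb Z$, are i.i.d. For $g\in[-1,1]$ let $\Delta_g f(x)=\frac{1+g}{2}(f(x+1)-f(x))+\frac{1-g}{2}(f(x-1)-f(x))$. Let $X$ be the continuous-time random walk on $\mathbb Z$ with generator $\kappa\Delta_h$ and $Y$ the one with generator $\kappa\Delta_{-h}$; write $\mathbb E_x$ for the expectation when the walk starts at $x$, and let $T_0$ be the first hitting time of $0$ by $Y$. For $\beta\in\mathbb R$ put $$L^{\pm}(\beta)=\Big\langle\Big(\log\mathbb E_1\exp\Big\{\int_0^{T_0}(\xi(Y_s)+\beta)\,ds\Big\}\Big)^{\pm}\Big\rangle\in[0,\infty],\qquad L(\beta)=L^+(\beta)-L^-(\beta),$$ the latter whenever $L^+(\beta)$ or $L^-(\beta)$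 is finite, and $\beta_{cr}=\sup\{\beta\in\mathbb R:L^+(\beta)<\infty\}$. Let $u$ be the unique bounded non-negative solution of $\partial_t u(t,x)=\kappa\Delta_h u(t,x)+\xi(x)u(t,x)$ on $[0,\infty)\times\mathbb Z$ with $u(0,\cdot)\equiv1$. For $A\subseteq\mathbb R$ and $t>0$ put $$R_t(A)=\frac1t\log\mathbb E_0\exp\Big\{\int_0^t\xi(X_s)\,ds\Big\}\mathbf 1_{X_t\in tA}\in[-\infty,0].$$ Then the quenched Lyapunov exponent $\lambda_0=\lim_{t\to\infty}\frac1t\log u(t,0)$ exists almost surely and is a non-random real number, the limit $L_{cr}:=\lim_{\beta\uparrow\beta_{cr}}L(\beta)\in[-\infty,\infty]$ exists, and the following holds. (a) If $L_{cr}>0$, then $L$ is finite in a neighbourhood of $-\lambda_0$ and differentiable at $-\lambda_0$, and $$\alpha^*:=(L'(-\lambda_0))^{-1}=\Big\langle\frac{\mathbb E_1T_0\exp\{\int_0^{T_0}(\xi(Y_s)-\lambda_0)\,ds\}}{\mathbb E_1\exp\{\int_0^{T_0}(\xi(Y_s)-\lambda_0)\,ds\}}\Big\rangle^{-1}\in(0,\infty);$$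 moreover, almost surely, for all $\varepsilon>0$, $$\limsup_{t\to\infty}R_t\big(\mathbb R\setminus(\alpha^*-\varepsilon,\alpha^*+\varepsilon)\big)<\lambda_0.$$ (b) If $L_{cr}=0$, then $L$ is finite and differentiable on $(-\infty,\beta_{cr})$ and the limit $\lim_{\beta\uparrow\beta_{cr}}L'(\beta)\in(0,\infty]$ exists; with $M:=(\lim_{\beta\uparrow\beta_{cr}}L'(\beta))^{-1}\in[0,\infty)$ (where $\infty^{-1}=0$), almost surely, for all $m\in[0,M]$ and all $\varepsilon>0$, $$\lambda_0=\liminf_{t\to\infty}R_t\big((m-\varepsilon,m+\varepsilon)\big),\qquad\text{while}\qquad \limsup_{t\to\infty}R_t\big(\mathbb R\setminus[-\varepsilon,M+\varepsilon]\big)<\lambda_0.$$ (c) If $L_{cr}<0$, then almost surely, for all $\varepsilon>0$, $$\limsup_{t\to\infty}R_t\big(\mathbb R\setminus(-\varepsilon,\varepsilon)\big)<\lambda_0.$$ -/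

import Mathlib

open MeasureTheory ProbabilityTheory Filter Topology
open scoped ENNReal

namespace PAM

noncomputable section

/-! ### The random walk -/

/-- The discrete Laplacian with drift `h` on `ℤ`. -/
def driftLaplacian (h : ℝ) (f : ℤ → ℝ) (x : ℤ) : ℝ :=
  (1 + h) / 2 * (f (x + 1) - f x) + (1 - h) / 2 * (f (x - 1) - f x)

/-- Law of a single jump: `+1` with probability `(1 + h) / 2`, `-1` with probability
`(1 - h) / 2`. -/
def stepLaw (h : ℝ) : Measure ℤ :=
  ENNReal.ofReal ((1 + h) / 2) • Measure.dirac 1 + ENNReal.ofReal ((1 - h) / 2) • Measure.dirac (-1)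

/-- The underlying space of the walk: the sequence of (holding time, jump). -/
abbrev Path : Type := ℕ → ℝ × ℤ

/-- The law of the walk with generator `κ Δ_h`: independent exponential holding times of
rate `κ` and independent jumps with law `stepLaw h`. -/
def walkLaw (κ h : ℝ) : Measure Path :=
  Measure.infinitePi fun _ : ℕ => (expMeasure κ).prod (stepLaw h)

/-- The time of the `n`-th jump (with `jumpTime ω 0 = 0`). -/
def jumpTime (ω : Path) (n : ℕ) : ℝ := ∑ i ∈ Finset.range n, (ω i).1

/-- The number of jumps up to time `t`. -/
def jumpCount (ω : Path) (t : ℝ) : ℕ := sInf {n : ℕ | t < jumpTime ω (n + 1)}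

/-- The position at time `t` of the walk started at `x`. -/
def position (x : ℤ) (ω : Path) (t : ℝ) : ℤ := x + ∑ i ∈ Finset.range (jumpCount ω t), (ω i).2

/-- The first hitting time of `n` by the walk started at `x`. It is used only for a walk with drift
towards `n`, where it is almost surely finite. -/
def hittingTime (x n : ℤ) (ω : Path) : ℝ := sInf {s : ℝ | 0 ≤ s ∧ position x ω s = n}

/-! ### The potential and the parabolic Anderson model -/

/-- The left shift on potentials. -/
def shift (ζ : ℤ → ℝ) : ℤ → ℝ := fun x => ζ (x + 1)

/-- `u` is a bounded non-negative solution on `[0, ∞) × ℤ` of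
`∂u/∂t = κ Δ_h u + ξ u`, `u(0, ·) = 1`. -/
structure IsSolution (κ h : ℝ) (ξ : ℤ → ℝ) (u : ℝ → ℤ → ℝ) : Prop where
  init : ∀ x, u 0 x = 1
  eqn : ∀ t, 0 ≤ t → ∀ x, HasDerivWithinAt (fun s => u s x)
    (κ * driftLaplacian h (u t) x + ξ x * u t x) (Set.Ici 0) t
  nonneg : ∀ t, 0 ≤ t → ∀ x, 0 ≤ u t x
  bounded : ∃ C, ∀ t, 0 ≤ t → ∀ x, u t x ≤ C

/-- `l` is the quenched Lyapunov exponent: for almost every potential the solution `u` exists and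
`t⁻¹ log u(t, 0) → l`. -/
def IsQuenchedLyapunovExponent (Q : Measure (ℤ → ℝ)) (κ h l : ℝ) : Prop :=
  ∀ᵐ ξ ∂Q, (∃ u, IsSolution κ h ξ u) ∧
    ∀ u, IsSolution κ h ξ u → Tendsto (fun t : ℝ => t⁻¹ * Real.log (u t 0)) atTop (𝓝 l)

/-! ### The function `L`

The walk `Y` has generator `κ Δ_{-h}` and starts in `1`; `T₀` is its first hitting time of `0`. -/

/-- `exp (∫₀^{T₀} (ξ(Y_s) + β) ds)`. -/
def hittingWeight (ξ : ℤ → ℝ) (β : ℝ) (ω : Path) : ℝ≥0∞ :=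
  ENNReal.ofReal (Real.exp (∫ s in (0 : ℝ)..hittingTime 1 0 ω, (ξ (position 1 ω s) + β)))

/-- `E₁ exp (∫₀^{T₀} (ξ(Y_s) + β) ds)`. -/
def hittingMGF (κ h : ℝ) (ξ : ℤ → ℝ) (β : ℝ) : ℝ≥0∞ :=
  ∫⁻ ω, hittingWeight ξ β ω ∂(walkLaw κ (-h))

/-- `E₁ T₀ exp (∫₀^{T₀} (ξ(Y_s) + β) ds)`. -/
def hittingMean (κ h : ℝ) (ξ : ℤ → ℝ) (β : ℝ) : ℝ≥0∞ :=
  ∫⁻ ω, ENNReal.ofReal (hittingTime 1 0 ω) * hittingWeight ξ β ω ∂(walkLaw κ (-h))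

/-- `L⁺(β)`, the mean of the positive part of `log E₁ exp (∫₀^{T₀} (ξ(Y_s) + β) ds)`
(`EReal.toENNReal` is the positive part). -/
def Lplus (Q : Measure (ℤ → ℝ)) (κ h β : ℝ) : ℝ≥0∞ :=
  ∫⁻ ξ, (ENNReal.log (hittingMGF κ h ξ β)).toENNReal ∂Q

/-- `L⁻(β)`, the mean of the negative part of the same logarithm. -/
def Lminus (Q : Measure (ℤ → ℝ)) (κ h β : ℝ) : ℝ≥0∞ :=
  ∫⁻ ξ, (-ENNReal.log (hittingMGF κ h ξ β)).toENNReal ∂Q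

/-- `L(β) = L⁺(β) - L⁻(β)`, an extended real, meaningful when `L⁺(β)` or `L⁻(β)` is finite. -/
def L (Q : Measure (ℤ → ℝ)) (κ h β : ℝ) : EReal :=
  (Lplus Q κ h β : EReal) - (Lminus Q κ h β : EReal)

/-- The critical value: `L⁺ < ∞` below it and `L⁺ = ∞` above it. -/
def betaCr (Q : Measure (ℤ → ℝ)) (κ h : ℝ) : ℝ := sSup {β : ℝ | Lplus Q κ h β < ∞}

/-- `L` is finite near `β` and differentiable at `β` with derivative `D`. -/
def HasDerivL (Q : Measure (ℤ → ℝ)) (κ h D β : ℝ) : Prop :=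
  (∀ᶠ b in 𝓝 β, L Q κ h b ≠ ⊥ ∧ L Q κ h b ≠ ⊤) ∧
    HasDerivAt (fun b => (L Q κ h b).toReal) D β

/-! ### The walk `X` in the potential

`X` has generator `κ Δ_h` and starts in `0`. -/

/-- `E₀ exp (∫₀^t ξ(X_s) ds) 1{X_t ∈ t A}`, for `t > 0`. -/
def speedMass (κ h : ℝ) (ξ : ℤ → ℝ) (t : ℝ) (A : Set ℝ) : ℝ≥0∞ :=
  ∫⁻ ω in {ω | (position 0 ω t : ℝ) / t ∈ A},
    ENNReal.ofReal (Real.exp (∫ s in (0 : ℝ)..t, ξ (position 0 ω s))) ∂(walkLaw κ h)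

/-- `t⁻¹ log E₀ exp (∫₀^t ξ(X_s) ds) 1{X_t ∈ t A}`, with `log 0 = -∞`. -/
def speedRate (κ h : ℝ) (ξ : ℤ → ℝ) (A : Set ℝ) (t : ℝ) : EReal :=
  ((t⁻¹ : ℝ) : EReal) * ENNReal.log (speedMass κ h ξ t A)

end

end PAM

/-! ### Jump expansion of Feynman-Kac kernels: comparison, reversal, concatenation, Laplace
transform. -/

namespace PAM

noncomputable section

/-! ### Convolutions of functions on the line -/

/-! Let `q = κ(1+h)/2` and `p = κ(1-h)/2` be the rates of `X` to the right and to the left, and let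
`H_k(β)` be the hitting functional of the potential shifted by `k`, i.e. the weight with which `Y`
passes from `k+1` to `k`. Everything rests on comparing the weighted kernel of `X` at time `t` and
site `n` with `exp(-βt) ∏_{k<n} H_k(β)`, which the ergodic theorem turns into `exp(-βt + n L(β))`.

Upper bound. A first-step analysis gives the Riccati recursion `(κ - ξ(k+1) - β) H_k = q + p H_{k+1}
H_k` (`isRiccati_hittingMGF`), which says that the two-sided product of the `H_k` is harmonic for
`κΔ_{-h} + ξ + β`. A supersolution argument (`kernel_le_exp_mul`) and time reversal
(`kernel_reverse`) then give `IsRiccati.kernel_right_le`. Multiplying by `(p/q)^x` exchanges the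
drifts and gives `IsRiccati.kernel_left_le`, where each step to the left costs an additional
`exp(-h)`. So the mass with speed near `m ≥ 0` has rate at most `-β + m L(β)` for every `β < β_cr`.

Lower bounds. Above `β_cr` some hitting functional is infinite almost surely; the return kernel at a
suitable site then has a divergent Laplace transform, and iterating a good loop there yields rate
`-β_cr` at speed `0` (`ae_exists_le_rightKernel`). Below `β_cr`, the Laplace transform in time of
the kernel from `0` to `n` is at least of order `exp(n L(β))`. The upper bounds at `β ± θ` make all
times outside `n(L'(β) ± δ)` negligible in it, so the kernel is large at some time in that window
(`ae_exists_le_rightKernel_speed`).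

The function `L`. The recursion bounds `H_k(β)` above, and the increments of `log H_k` in `β`, by
non-random constants (`ae_le_div`, `exists_logMGF_sub_le`). Hence below `β_cr` either `L` is
identically `-∞`, or it is finite, convex, differentiable and strictly increasing.

Regimes. If `L_cr > 0`, then `L` has a root `β = -λ₀`, and tilting to `β ± θ` shows that speeds away
from `1/L'(β)` are exponentially more expensive. If `L_cr ≤ 0`, then `λ₀ = -β_cr`. When `L_cr < 0`,
any linear displacement has a strictly positive cost. When `L_cr = 0`, the tangent line of `L` makes
speeds above `M` costly, while a speed `m < M` is reached at no exponential cost by looping at a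
good site and travelling for the remaining fraction, about `m L'(β) < 1`, of the time, with `β`
close to `β_cr`. -/

lemma lconvolution_mono {f f' g g' : ℝ → ℝ≥0∞} (hf : f ≤ f') (hg : g ≤ g') :
    f ⋆ₗ g ≤ f' ⋆ₗ g' := fun _ => lintegral_mono fun y => mul_le_mul' (hf y) (hg _)

lemma lconvolution_add_right {f g k : ℝ → ℝ≥0∞} (hf : Measurable f) (hg : Measurable g) :
    f ⋆ₗ (fun t => g t + k t) = fun t => (f ⋆ₗ g) t + (f ⋆ₗ k) t := by
  ext t
  simp only [lconvolution_def, mul_add]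
  exact lintegral_add_left (by fun_prop) _

lemma lconvolution_add_left {f g k : ℝ → ℝ≥0∞} (hf : Measurable f) (hk : Measurable k) :
    (fun t => f t + g t) ⋆ₗ k = fun t => (f ⋆ₗ k) t + (g ⋆ₗ k) t := by
  ext t
  simp only [lconvolution_def, add_mul]
  exact lintegral_add_left (by fun_prop) _

lemma lconvolution_const_mul_right {f g : ℝ → ℝ≥0∞} (hf : Measurable f) (hg : Measurable g)
    (c : ℝ≥0∞) : f ⋆ₗ (fun t => c * g t) = fun t => c * (f ⋆ₗ g) t := by
  ext t
  simp only [lconvolution_def, mul_left_comm _ c]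
  exact lintegral_const_mul _ (by fun_prop)

lemma lconvolution_const_mul_left {f g : ℝ → ℝ≥0∞} (hf : Measurable f) (hg : Measurable g)
    (c : ℝ≥0∞) : (fun t => c * f t) ⋆ₗ g = fun t => c * (f ⋆ₗ g) t := by
  ext t
  simp only [lconvolution_def, mul_assoc]
  exact lintegral_const_mul _ (by fun_prop)

lemma lconvolution_linear_left {f g k : ℝ → ℝ≥0∞} (hf : Measurable f) (hg : Measurable g)
    (hk : Measurable k) (c d : ℝ≥0∞) :
    (fun t => c * f t + d * g t) ⋆ₗ k = fun t => c * (f ⋆ₗ k) t + d * (g ⋆ₗ k) t := by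
  rw [lconvolution_add_left (by fun_prop) hk, lconvolution_const_mul_left hf hk,
    lconvolution_const_mul_left hg hk]

lemma lconvolution_linear_right {f g k : ℝ → ℝ≥0∞} (hf : Measurable f) (hg : Measurable g)
    (hk : Measurable k) (c d : ℝ≥0∞) :
    k ⋆ₗ (fun t => c * f t + d * g t) = fun t => c * (k ⋆ₗ f) t + d * (k ⋆ₗ g) t := by
  rw [lconvolution_add_right hk (by fun_prop), lconvolution_const_mul_right hk hf,
    lconvolution_const_mul_right hk hg]

lemma lintegral_exp_mul_lconvolution {f g : ℝ → ℝ≥0∞} (hf : Measurable f) (hg : Measurable g)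
    (β : ℝ) : ∫⁻ t, ENNReal.ofReal (Real.exp (β * t)) * (f ⋆ₗ g) t =
      (∫⁻ t, ENNReal.ofReal (Real.exp (β * t)) * f t) *
        ∫⁻ t, ENNReal.ofReal (Real.exp (β * t)) * g t := by
  simp only [lconvolution_def]
  have h1 : ∀ t : ℝ, ENNReal.ofReal (Real.exp (β * t)) * ∫⁻ y, f y * g (-y + t) =
      ∫⁻ y, ENNReal.ofReal (Real.exp (β * t)) * (f y * g (-y + t)) := fun t =>
    (lintegral_const_mul _ (by fun_prop)).symm
  simp only [h1]
  rw [lintegral_lintegral_swap (by fun_prop), ← lintegral_mul_const _ (by fun_prop)]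
  refine lintegral_congr fun y => ?_
  rw [← lintegral_const_mul _ (by fun_prop),
    ← lintegral_add_left_eq_self (μ := volume)
      (fun t => ENNReal.ofReal (Real.exp (β * t)) * (f y * g (-y + t))) y]
  refine lintegral_congr fun t => ?_
  rw [mul_add, Real.exp_add, ENNReal.ofReal_mul (Real.exp_pos _).le, neg_add_cancel_left]
  ring

/-! ### The Feynman-Kac kernel, expanded in the number of jumps -/

/-- `exp (v t)` for `t ≥ 0`, and `0` for `t < 0`. -/
def expKernel (v : ℝ) : ℝ → ℝ≥0∞ :=
  (Set.Ici 0).indicator fun t => ENNReal.ofReal (Real.exp (v * t))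

@[fun_prop]
lemma measurable_expKernel (v : ℝ) : Measurable (expKernel v) :=
  Measurable.indicator (by fun_prop) measurableSet_Ici

lemma expKernel_of_nonneg (v : ℝ) {t : ℝ} (ht : 0 ≤ t) :
    expKernel v t = ENNReal.ofReal (Real.exp (v * t)) := Set.indicator_of_mem ht _

lemma expKernel_of_neg (v : ℝ) {t : ℝ} (ht : t < 0) : expKernel v t = 0 :=
  Set.indicator_of_notMem (by simpa using ht) _

/-- The contribution of the trajectories with exactly `n` jumps to
`E_x exp (∫₀ᵗ v) f`, for the walk with rate `r` to the right and rate `l` to the left, killed at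
rate `-v`. -/
def jumpKernel (r l : ℝ≥0∞) (v : ℤ → ℝ) (f : ℤ → ℝ≥0∞) : ℕ → ℤ → ℝ → ℝ≥0∞
  | 0, x => fun t => f x * expKernel (v x) t
  | n + 1, x => expKernel (v x) ⋆ₗ
      fun t => r * jumpKernel r l v f n (x + 1) t + l * jumpKernel r l v f n (x - 1) t

/-- `E_x exp (∫₀ᵗ v) f` for the walk with jump rates `r` and `l`. -/
def kernel (r l : ℝ≥0∞) (v : ℤ → ℝ) (f : ℤ → ℝ≥0∞) (x : ℤ) (t : ℝ) : ℝ≥0∞ :=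
  ∑' n, jumpKernel r l v f n x t

/-- The indicator of a point. -/
def point (y : ℤ) : ℤ → ℝ≥0∞ := fun z => if z = y then 1 else 0

section Kernel

variable {r l : ℝ≥0∞} {v : ℤ → ℝ} {f g : ℤ → ℝ≥0∞}

@[fun_prop]
lemma measurable_jumpKernel (r l : ℝ≥0∞) (v : ℤ → ℝ) (f : ℤ → ℝ≥0∞) (n : ℕ) (x : ℤ) :
    Measurable (jumpKernel r l v f n x) := by
  induction n generalizing x with
  | zero => unfold jumpKernel; fun_prop
  | succ n ih =>
    unfold jumpKernel
    exact measurable_lconvolution _ (by fun_prop)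
      (((ih _).const_mul _).add ((ih _).const_mul _))

@[fun_prop]
lemma measurable_kernel (r l : ℝ≥0∞) (v : ℤ → ℝ) (f : ℤ → ℝ≥0∞) (x : ℤ) :
    Measurable (kernel r l v f x) := by
  unfold kernel
  exact Measurable.tsum fun n => by fun_prop

lemma jumpKernel_mono (hfg : f ≤ g) (n : ℕ) (x : ℤ) :
    jumpKernel r l v f n x ≤ jumpKernel r l v g n x := by
  induction n generalizing x with
  | zero => intro t; exact mul_le_mul_left (hfg x) _
  | succ n ih =>
    exact lconvolution_mono le_rfl fun t => by
      dsimp only; gcongr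
      · exact ih _ t
      · exact ih _ t

lemma kernel_mono (hfg : f ≤ g) (x : ℤ) (t : ℝ) : kernel r l v f x t ≤ kernel r l v g x t :=
  ENNReal.tsum_le_tsum fun n => jumpKernel_mono hfg n x t

lemma jumpKernel_const_mul (c : ℝ≥0∞) (n : ℕ) (x : ℤ) :
    jumpKernel r l v (fun z => c * f z) n x = fun t => c * jumpKernel r l v f n x t := by
  induction n generalizing x with
  | zero => ext t; simp [jumpKernel, mul_assoc]
  | succ n ih =>
    simp only [jumpKernel, ih]
    rw [← lconvolution_const_mul_right (by fun_prop) (by fun_prop)]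
    congr 1; ext t; ring

lemma kernel_const_mul (c : ℝ≥0∞) (x : ℤ) (t : ℝ) :
    kernel r l v (fun z => c * f z) x t = c * kernel r l v f x t := by
  simp only [kernel, jumpKernel_const_mul, ENNReal.tsum_mul_left]

lemma jumpKernel_eq_tsum_point (n : ℕ) (x : ℤ) (t : ℝ) :
    jumpKernel r l v f n x t = ∑' y, f y * jumpKernel r l v (point y) n x t := by
  induction n generalizing x t with
  | zero =>
    rw [tsum_eq_single x]
    · simp [jumpKernel, point]
    · intro y hy
      simp [jumpKernel, point, hy.symm]
  | succ n ih =>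
    simp only [jumpKernel, lconvolution_def]
    have h1 : ∀ y : ℤ, f y * ∫⁻ s, expKernel (v x) s *
        (r * jumpKernel r l v (point y) n (x + 1) (-s + t) +
          l * jumpKernel r l v (point y) n (x - 1) (-s + t)) = ∫⁻ s, f y * (expKernel (v x) s *
        (r * jumpKernel r l v (point y) n (x + 1) (-s + t) +
          l * jumpKernel r l v (point y) n (x - 1) (-s + t))) := fun y =>
      (lintegral_const_mul _ (by fun_prop)).symm
    simp only [h1]
    rw [← lintegral_tsum (fun y => by fun_prop)]
    refine lintegral_congr fun s => ?_
    rw [ih, ih, ← ENNReal.tsum_mul_left, ← ENNReal.tsum_mul_left, ← ENNReal.tsum_add,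
      ← ENNReal.tsum_mul_left]
    refine tsum_congr fun y => ?_
    ring

lemma kernel_eq_tsum_point (x : ℤ) (t : ℝ) :
    kernel r l v f x t = ∑' y, f y * kernel r l v (point y) x t := by
  simp only [kernel, ← ENNReal.tsum_mul_left]
  rw [ENNReal.tsum_comm]
  exact tsum_congr fun n => jumpKernel_eq_tsum_point n x t

lemma jumpKernel_of_neg {t : ℝ} (ht : t < 0) (n : ℕ) (x : ℤ) : jumpKernel r l v f n x t = 0 := by
  induction n generalizing x t with
  | zero => simp [jumpKernel, expKernel_of_neg _ ht]
  | succ n ih =>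
    simp only [jumpKernel, lconvolution_def]
    refine (lintegral_congr fun s => ?_).trans lintegral_zero
    rcases lt_or_ge s 0 with hs | hs
    · simp [expKernel_of_neg _ hs]
    · rw [ih (by linarith), ih (by linarith)]; simp

lemma kernel_of_neg {t : ℝ} (ht : t < 0) (x : ℤ) : kernel r l v f x t = 0 := by
  simp [kernel, jumpKernel_of_neg ht]

/-- The integral equation satisfied by the kernel. -/
lemma kernel_eq (x : ℤ) (t : ℝ) : kernel r l v f x t = f x * expKernel (v x) t +
    (expKernel (v x) ⋆ₗ fun t => r * kernel r l v f (x + 1) t + l * kernel r l v f (x - 1) t) t := by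
  rw [kernel, tsum_eq_zero_add' ENNReal.summable]
  congr 1
  simp only [jumpKernel, lconvolution_def, kernel]
  rw [← lintegral_tsum (fun y => by fun_prop)]
  refine lintegral_congr fun s => ?_
  rw [ENNReal.tsum_mul_left, ENNReal.tsum_add, ENNReal.tsum_mul_left, ENNReal.tsum_mul_left]

/-- The kernel is the least supersolution of its integral equation. -/
lemma kernel_le_of_supersolution {V : ℤ → ℝ → ℝ≥0∞}
    (hV : ∀ x t, f x * expKernel (v x) t +
      (expKernel (v x) ⋆ₗ fun t => r * V (x + 1) t + l * V (x - 1) t) t ≤ V x t) (x : ℤ) (t : ℝ) :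
    kernel r l v f x t ≤ V x t := by
  refine ENNReal.tsum_le_of_sum_range_le fun n => ?_
  induction n generalizing x t with
  | zero => simp
  | succ n ih =>
    rw [Finset.sum_range_succ']
    refine le_trans ?_ (hV x t)
    rw [add_comm]
    refine add_le_add le_rfl ?_
    simp only [jumpKernel, lconvolution_def]
    rw [← lintegral_finsetSum _ (fun i _ => by fun_prop)]
    refine lintegral_mono fun s => ?_
    rw [← Finset.mul_sum, Finset.sum_add_distrib, ← Finset.mul_sum, ← Finset.mul_sum]
    gcongr
    · exact ih _ _
    · exact ih _ _

/-- Comparison of the kernel with a positive supersolution of the stationary equation. -/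
lemma kernel_le_exp_mul {ψ : ℤ → ℝ≥0∞} {β : ℝ} (hfψ : f ≤ ψ) (ha : ∀ x, 0 ≤ -v x - β)
    (hψ : ∀ x, r * ψ (x + 1) + l * ψ (x - 1) ≤ ENNReal.ofReal (-v x - β) * ψ x) (x : ℤ) (t : ℝ) :
    kernel r l v f x t ≤ expKernel (-β) t * ψ x := by
  refine kernel_le_of_supersolution (V := fun x t => expKernel (-β) t * ψ x) (fun x t => ?_) x t
  have h1 : (expKernel (v x) ⋆ₗ fun t => r * (expKernel (-β) t * ψ (x + 1)) +
      l * (expKernel (-β) t * ψ (x - 1))) t ≤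
      (∫⁻ s, expKernel (v x) s * expKernel (-β) (-s + t) * ENNReal.ofReal (-v x - β)) * ψ x := by
    rw [lconvolution_def, ← lintegral_mul_const _ (by fun_prop)]
    refine lintegral_mono fun s => ?_
    calc expKernel (v x) s * (r * (expKernel (-β) (-s + t) * ψ (x + 1)) +
          l * (expKernel (-β) (-s + t) * ψ (x - 1)))
        = expKernel (v x) s * expKernel (-β) (-s + t) * (r * ψ (x + 1) + l * ψ (x - 1)) := by ring
      _ ≤ expKernel (v x) s * expKernel (-β) (-s + t) * (ENNReal.ofReal (-v x - β) * ψ x) := by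
          gcongr; exact hψ x
      _ = _ := by ring
  rcases lt_or_ge t 0 with ht | ht
  · have h2 : ∀ s, expKernel (v x) s * expKernel (-β) (-s + t) = 0 := fun s => by
      rcases lt_or_ge s 0 with hs | hs
      · simp [expKernel_of_neg _ hs]
      · rw [expKernel_of_neg (-β) (by linarith : -s + t < 0), mul_zero]
    simp only [h2, zero_mul, lintegral_zero] at h1
    simp only [expKernel_of_neg _ ht, mul_zero, zero_mul, zero_add]
    exact h1
  set a := -v x - β with ha'
  -- The jump term contributes `exp(-βt)(1 - exp(-at))` and the term without jumps `exp(-βt)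
  -- exp(-at)`, so together they give `exp(-βt)` exactly.
  have h3 : ∫⁻ s, expKernel (v x) s * expKernel (-β) (-s + t) * ENNReal.ofReal a =
      ENNReal.ofReal (Real.exp (-β * t) * (1 - Real.exp (-a * t))) := by
    have h4 : ∀ s, expKernel (v x) s * expKernel (-β) (-s + t) * ENNReal.ofReal a =
        (Set.Icc 0 t).indicator (fun s => ENNReal.ofReal (Real.exp (-β * t) *
          (a * Real.exp (-a * s)))) s := fun s => by
      by_cases hs : s ∈ Set.Icc 0 t
      · rw [Set.indicator_of_mem hs, expKernel_of_nonneg _ hs.1,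
          expKernel_of_nonneg _ (by linarith [hs.2]), ← ENNReal.ofReal_mul (by positivity),
          ← ENNReal.ofReal_mul (by positivity)]
        congr 1
        have : Real.exp (v x * s) * Real.exp (-β * (-s + t)) =
            Real.exp (-β * t) * Real.exp (-a * s) := by
          rw [← Real.exp_add, ← Real.exp_add]; congr 1; rw [ha']; ring
        rw [this]; ring
      · rw [Set.indicator_of_notMem hs]
        rcases lt_or_ge s 0 with h | h
        · simp [expKernel_of_neg _ h]
        · have : t < s := by by_contra hh; exact hs ⟨h, not_lt.1 hh⟩
          rw [expKernel_of_neg (-β) (by linarith)]; simp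
    simp only [h4]
    rw [lintegral_indicator measurableSet_Icc, setLIntegral_congr Ioc_ae_eq_Icc.symm,
      ← ofReal_integral_eq_lintegral_ofReal, ← intervalIntegral.integral_of_le ht]
    · congr 1
      rw [intervalIntegral.integral_const_mul]
      congr 1
      have hd : ∀ s ∈ Set.uIcc 0 t,
          HasDerivAt (fun s => -Real.exp (-a * s)) (a * Real.exp (-a * s)) s := fun s _ => by
        exact (((hasDerivAt_id' s).const_mul (-a)).exp.neg).congr_deriv (by ring)
      rw [intervalIntegral.integral_eq_sub_of_hasDerivAt hd
        (by apply Continuous.intervalIntegrable; fun_prop)]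
      simp; ring
    · exact (Continuous.integrableOn_Icc (by fun_prop)).mono_set Set.Ioc_subset_Icc_self
    · exact ae_of_all _ fun s => mul_nonneg (by positivity)
        (mul_nonneg (ha x) (by positivity))
  rw [h3] at h1
  calc _ ≤ ψ x * expKernel (v x) t +
        ENNReal.ofReal (Real.exp (-β * t) * (1 - Real.exp (-a * t))) * ψ x := by
        gcongr; exact hfψ x
    _ = expKernel (-β) t * ψ x := by
        rw [mul_comm (ψ x), ← add_mul, expKernel_of_nonneg _ ht, expKernel_of_nonneg _ ht,
          ← ENNReal.ofReal_add (by positivity)]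
        · congr 2
          have : Real.exp (v x * t) = Real.exp (-β * t) * Real.exp (-a * t) := by
            rw [← Real.exp_add]; congr 1; rw [ha']; ring
          rw [this]; ring
        · refine mul_nonneg (by positivity) (sub_nonneg.2 (Real.exp_le_one_iff.2 ?_))
          nlinarith [ha x]

/-! ### Time reversal -/

/-- The decomposition of the kernel with respect to the last jump. -/
lemma jumpKernel_point_succ (y : ℤ) (n : ℕ) (x : ℤ) :
    jumpKernel r l v (point y) (n + 1) x =
      (fun t => r * jumpKernel r l v (point (y - 1)) n x t +
        l * jumpKernel r l v (point (y + 1)) n x t) ⋆ₗ expKernel (v y) := by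
  induction n generalizing x with
  | zero =>
    simp only [jumpKernel]
    rw [lconvolution_add_right (by fun_prop) (by fun_prop),
      lconvolution_add_left (by fun_prop) (by fun_prop)]
    ext t
    congr 1
    · by_cases h : x + 1 = y
      · subst h; simp only [point, add_sub_cancel_right, if_true, one_mul]
        rw [lconvolution_const_mul_right (by fun_prop) (by fun_prop),
          lconvolution_const_mul_left (by fun_prop) (by fun_prop)]
      · have h' : x ≠ y - 1 := fun hh => h (by omega)
        simp [point, h, h', lconvolution_def]
    · by_cases h : x - 1 = y
      · subst h; simp only [point, sub_add_cancel, if_true, one_mul]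
        rw [lconvolution_const_mul_right (by fun_prop) (by fun_prop),
          lconvolution_const_mul_left (by fun_prop) (by fun_prop)]
      · have h' : x ≠ y + 1 := fun hh => h (by omega)
        simp [point, h, h', lconvolution_def]
  | succ n ih =>
    have e1 : ∀ z, jumpKernel r l v (point z) (n + 1) x = expKernel (v x) ⋆ₗ
      fun t => r * jumpKernel r l v (point z) n (x + 1) t +
        l * jumpKernel r l v (point z) n (x - 1) t := fun z => rfl
    rw [jumpKernel, ih, ih, ← lconvolution_linear_left (by fun_prop) (by fun_prop) (by fun_prop),
      lconvolution_assoc (by fun_prop) (by fun_prop) (by fun_prop)]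
    congr 1
    rw [e1, e1, ← lconvolution_linear_right (by fun_prop) (by fun_prop) (by fun_prop)]
    congr 1
    ext t; ring

/-- Reading a trajectory backwards exchanges the two rates and keeps the holding weights. The
induction matches the last jump of one walk with the first jump of the other. -/
lemma jumpKernel_reverse (x y : ℤ) (n : ℕ) :
    jumpKernel r l v (point y) n x = jumpKernel l r v (point x) n y := by
  induction n generalizing x y with
  | zero =>
    by_cases h : x = y
    · subst h; rfl
    · ext t; simp [jumpKernel, point, h, Ne.symm h]
  | succ n ih =>
    rw [jumpKernel_point_succ, ih, ih, lconvolution_comm, jumpKernel]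
    congr 1
    ext t; exact add_comm _ _

lemma kernel_reverse (x y : ℤ) (t : ℝ) :
    kernel r l v (point y) x t = kernel l r v (point x) y t := by
  simp only [kernel, jumpKernel_reverse x y]

/-! ### Translations -/

lemma jumpKernel_translate (z : ℤ) (n : ℕ) (x : ℤ) :
    jumpKernel r l (fun y => v (y + z)) (fun y => f (y + z)) n x =
      jumpKernel r l v f n (x + z) := by
  induction n generalizing x with
  | zero => rfl
  | succ n ih =>
    simp only [jumpKernel, ih]
    congr 1; ext t
    rw [add_right_comm, sub_add_eq_add_sub]

lemma kernel_point_translate (z x y : ℤ) (t : ℝ) :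
    kernel r l (fun w => v (w + z)) (point y) x t = kernel r l v (point (y + z)) (x + z) t := by
  have : point y = fun w => point (y + z) (w + z) := by ext w; simp [point]
  simp only [kernel, this, jumpKernel_translate]

/-! ### The Chapman-Kolmogorov inequality -/

lemma expKernel_add (w : ℝ) {s t : ℝ} (hs : 0 ≤ s) (ht : 0 ≤ t) :
    expKernel w (s + t) = expKernel w s * expKernel w t := by
  rw [expKernel_of_nonneg _ hs, expKernel_of_nonneg _ ht, expKernel_of_nonneg _ (by linarith),
    ← ENNReal.ofReal_mul (by positivity), ← Real.exp_add, mul_add]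

/-- By minimality of the kernel it is enough that the kernel delayed by `s` is a supersolution with
datum the kernel at time `s`. Lower bounds are obtained by concatenating trajectories, for which
this inequality suffices. -/
lemma kernel_kernel_le {s t : ℝ} (hs : 0 ≤ s) (ht : 0 ≤ t) (x : ℤ) :
    kernel r l v (fun z => kernel r l v f z s) x t ≤ kernel r l v f x (t + s) := by
  have key := kernel_le_of_supersolution (r := r) (l := l) (v := v)
    (f := fun z => kernel r l v f z s)
    -- The truncation at time `0` prevents double counting: first jumps between `t` and `t + s` are
    -- already contained in the datum.
    (V := fun x t => (Set.Ici 0).indicator (fun t => kernel r l v f x (t + s)) t)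
    (fun x t => ?_) x t
  · rwa [Set.indicator_of_mem (show t ∈ Set.Ici 0 from ht)] at key
  rcases lt_or_ge t 0 with ht | ht
  · rw [expKernel_of_neg _ ht, mul_zero, zero_add, lconvolution_def]
    refine le_trans (le_of_eq ?_) zero_le
    refine (lintegral_congr fun u => ?_).trans lintegral_zero
    rcases lt_or_ge u 0 with hu | hu
    · simp [expKernel_of_neg _ hu]
    · have : -u + t ∉ Set.Ici (0 : ℝ) := by simp; linarith
      simp [Set.indicator_of_notMem this]
  rw [Set.indicator_of_mem (show t ∈ Set.Ici 0 from ht), kernel_eq x (t + s), kernel_eq x s]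
  set G : ℝ → ℝ≥0∞ := fun t => r * kernel r l v f (x + 1) t + l * kernel r l v f (x - 1) t with hG
  have hGm : Measurable G := by fun_prop
  rw [mul_comm, mul_add, ← mul_assoc, mul_comm _ (f x), mul_assoc, ← expKernel_add _ ht hs,
    add_assoc]
  gcongr
  -- Split at time `t` according to the first jump. If it comes later, the factor for waiting until
  -- `t` splits off; if earlier, the convolution appears.
  rw [lconvolution_def (x := t + s), ← lintegral_add_compl _ (measurableSet_Ici (a := t)), lconvolution_def,
    lconvolution_def, ← lintegral_const_mul _ (by fun_prop)]
  refine add_le_add ?_ ?_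
  · rw [← lintegral_add_right_eq_self (μ := volume) _ (-t),
      ← lintegral_indicator measurableSet_Ici]
    refine lintegral_mono fun u => ?_
    rcases lt_or_ge u t with hu | hu
    · rw [expKernel_of_neg (v x) (by linarith : u + -t < 0)]; simp
    · rw [Set.indicator_of_mem (show u ∈ Set.Ici t from hu), ← mul_assoc,
        ← expKernel_add _ ht (by linarith : 0 ≤ u + -t)]
      refine le_of_eq ?_
      congr 2 <;> ring
  · rw [Set.compl_Ici, setLIntegral_congr Iio_ae_eq_Iic, ← lintegral_indicator measurableSet_Iic]
    refine lintegral_mono fun u => ?_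
    rcases le_or_gt u t with hu | hu
    · rw [Set.indicator_of_mem (show u ∈ Set.Iic t from hu),
        Set.indicator_of_mem (show -u + t ∈ Set.Ici 0 by simp; linarith),
        Set.indicator_of_mem (show -u + t ∈ Set.Ici 0 by simp; linarith)]
      refine le_of_eq ?_
      rw [hG, add_assoc]
    · rw [Set.indicator_of_notMem (show -u + t ∉ Set.Ici 0 by simp; linarith),
        Set.indicator_of_notMem (show -u + t ∉ Set.Ici 0 by simp; linarith)]
      simp

lemma kernel_mul_kernel_le {s t : ℝ} (hs : 0 ≤ s) (ht : 0 ≤ t) (x y : ℤ) :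
    kernel r l v (point y) x t * kernel r l v f y s ≤ kernel r l v f x (t + s) := by
  refine le_trans ?_ (kernel_kernel_le hs ht x)
  rw [mul_comm, ← kernel_const_mul]
  refine kernel_mono (fun z => ?_) x t
  by_cases h : z = y
  · simp [point, h]
  · simp [point, h]

lemma expKernel_le_kernel_point (x : ℤ) (t : ℝ) :
    expKernel (v x) t ≤ kernel r l v (point x) x t := by
  rw [kernel_eq]
  simp [point]

/-! ### Laplace transforms -/

/-- The Laplace transform of `jumpKernel`. -/
def greenSum (r l : ℝ≥0∞) (a : ℤ → ℝ≥0∞) (f : ℤ → ℝ≥0∞) : ℕ → ℤ → ℝ≥0∞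
  | 0, x => f x * (a x)⁻¹
  | n + 1, x => (a x)⁻¹ * (r * greenSum r l a f n (x + 1) + l * greenSum r l a f n (x - 1))

/-- For `a ≤ 0` both sides are infinite, by `0⁻¹ = ⊤`. Hence the Laplace transforms below hold for
every `β`, divergent or not. -/
lemma lintegral_exp_neg_mul_Ici (a : ℝ) :
    ∫⁻ t in Set.Ici (0 : ℝ), ENNReal.ofReal (Real.exp (-a * t)) = (ENNReal.ofReal a)⁻¹ := by
  rw [setLIntegral_congr Ioi_ae_eq_Ici.symm]
  rcases le_or_gt a 0 with ha | ha
  · rw [ENNReal.ofReal_of_nonpos ha, ENNReal.inv_zero, eq_top_iff]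
    calc (⊤ : ℝ≥0∞) = ∫⁻ t in Set.Ioi (0 : ℝ), 1 := by simp
      _ ≤ _ := by
        refine setLIntegral_mono (by fun_prop) fun t ht => ?_
        rw [ENNReal.one_le_ofReal, Real.one_le_exp_iff]
        have : (0 : ℝ) < t := ht
        nlinarith
  · rw [← ofReal_integral_eq_lintegral_ofReal]
    · rw [integral_exp_mul_Ioi (by linarith) 0]
      simp [ENNReal.ofReal_inv_of_pos ha]
    · exact integrableOn_exp_mul_Ioi (by linarith) 0
    · exact ae_of_all _ fun t => (Real.exp_pos _).le

lemma laplace_expKernel (w β : ℝ) :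
    ∫⁻ t, ENNReal.ofReal (Real.exp (β * t)) * expKernel w t = (ENNReal.ofReal (-w - β))⁻¹ := by
  rw [← lintegral_exp_neg_mul_Ici, ← lintegral_indicator measurableSet_Ici]
  refine lintegral_congr fun t => ?_
  rcases lt_or_ge t 0 with h | h
  · rw [expKernel_of_neg _ h, Set.indicator_of_notMem (by simpa using h), mul_zero]
  · rw [expKernel_of_nonneg _ h, Set.indicator_of_mem (show t ∈ Set.Ici 0 from h),
      ← ENNReal.ofReal_mul (by positivity), ← Real.exp_add]
    congr 2; ring

lemma laplace_jumpKernel (β : ℝ) (n : ℕ) (x : ℤ) :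
    ∫⁻ t, ENNReal.ofReal (Real.exp (β * t)) * jumpKernel r l v f n x t =
      greenSum r l (fun z => ENNReal.ofReal (-v z - β)) f n x := by
  induction n generalizing x with
  | zero =>
    simp only [jumpKernel, greenSum, mul_left_comm _ (f x)]
    rw [lintegral_const_mul _ (by fun_prop), laplace_expKernel]
  | succ n ih =>
    simp only [jumpKernel, greenSum]
    rw [lintegral_exp_mul_lconvolution (by fun_prop) (by fun_prop), laplace_expKernel]
    simp only [mul_add, mul_left_comm _ r, mul_left_comm _ l]
    rw [lintegral_add_left (by fun_prop), lintegral_const_mul _ (by fun_prop),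
      lintegral_const_mul _ (by fun_prop), ih, ih]
    ring

lemma laplace_kernel (β : ℝ) (x : ℤ) :
    ∫⁻ t, ENNReal.ofReal (Real.exp (β * t)) * kernel r l v f x t =
      ∑' n, greenSum r l (fun z => ENNReal.ofReal (-v z - β)) f n x := by
  simp only [kernel, ← ENNReal.tsum_mul_left]
  rw [lintegral_tsum (fun n => by fun_prop)]
  exact tsum_congr fun n => laplace_jumpKernel β n x

end Kernel

end

end PAM

/-! ### Hitting functionals, their Riccati recursion and the harmonic functions built from them. -/

namespace PAM

noncomputable section

/-! ### Hitting sums -/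

/-- The contribution of the trajectories with exactly `n` jumps to `E_x exp (∫₀^{T₀} v)`, for the
walk with rate `q` to the left and rate `p` to the right, where `a x` is the total rate at `x`
minus `v x`. -/
def hitSum (q p : ℝ≥0∞) (a : ℤ → ℝ≥0∞) : ℕ → ℤ → ℝ≥0∞
  | 0, x => if x = 0 then 1 else 0
  | n + 1, x => if x = 0 then 0 else
      (a x)⁻¹ * (q * hitSum q p a n (x - 1) + p * hitSum q p a n (x + 1))

/-- `E_x exp (∫₀^{T₀} v)` as the sum over the number of jumps. -/
def hitTotal (q p : ℝ≥0∞) (a : ℤ → ℝ≥0∞) (x : ℤ) : ℝ≥0∞ := ∑' n, hitSum q p a n x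

section HitTotal

variable {q p : ℝ≥0∞} {a : ℤ → ℝ≥0∞}

@[simp]
lemma hitTotal_zero : hitTotal q p a 0 = 1 := by
  rw [hitTotal, tsum_eq_single 0]
  · simp [hitSum]
  · intro n hn
    obtain ⟨m, rfl⟩ := Nat.exists_eq_succ_of_ne_zero hn
    simp [hitSum]

lemma hitTotal_eq {x : ℤ} (hx : x ≠ 0) : hitTotal q p a x =
    (a x)⁻¹ * (q * hitTotal q p a (x - 1) + p * hitTotal q p a (x + 1)) := by
  rw [hitTotal, tsum_eq_zero_add' ENNReal.summable]
  simp only [hitSum, hx, if_false, zero_add]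
  rw [ENNReal.tsum_mul_left, ENNReal.tsum_add, ENNReal.tsum_mul_left, ENNReal.tsum_mul_left]
  rfl

/-- Minimality: the sum over jumps is the least non-negative solution of the hitting equation on the
half-line, because each partial sum stays below any supersolution. -/
lemma hitTotal_mul_le {V : ℤ → ℝ≥0∞} {c : ℝ≥0∞} (h0 : c ≤ V 0)
    (hV : ∀ x, 0 < x → (a x)⁻¹ * (q * V (x - 1) + p * V (x + 1)) ≤ V x) {x : ℤ} (hx : 0 ≤ x) :
    hitTotal q p a x * c ≤ V x := by
  rw [hitTotal, ← ENNReal.tsum_mul_right]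
  refine ENNReal.tsum_le_of_sum_range_le fun n => ?_
  rw [← Finset.sum_mul]
  induction n generalizing x with
  | zero => simp
  | succ n ih =>
    rw [Finset.sum_range_succ']
    rcases hx.eq_or_lt with rfl | hx'
    · simpa [hitSum] using h0
    · have hx0 : x ≠ 0 := hx'.ne'
      simp only [hitSum, hx0, if_false, add_zero]
      refine le_trans ?_ (hV x hx')
      rw [← Finset.mul_sum, Finset.sum_add_distrib, ← Finset.mul_sum, ← Finset.mul_sum, mul_assoc,
        add_mul, mul_assoc, mul_assoc]
      gcongr
      · exact ih (by omega)
      · exact ih (by omega)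

/-- The strong Markov property at the hitting time of `1`. -/
lemma hitTotal_add_one {x : ℤ} (hx : 0 ≤ x) : hitTotal q p a (x + 1) =
    hitTotal q p (fun y => a (y + 1)) x * hitTotal q p a 1 := by
  refine le_antisymm ?_ ?_
  · rw [hitTotal]
    refine ENNReal.tsum_le_of_sum_range_le fun n => ?_
    suffices H : ∑ i ∈ Finset.range n, hitSum q p a i (x + 1) ≤
        hitTotal q p (fun y => a (y + 1)) x * ∑ i ∈ Finset.range n, hitSum q p a i 1 from
      H.trans (mul_le_mul_right (ENNReal.sum_le_tsum _) _)
    induction n generalizing x with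
    | zero => simp
    | succ n ih =>
      rcases hx.eq_or_lt with rfl | hx'
      · simp
      · refine le_trans ?_ (mul_le_mul_right (Finset.sum_le_sum_of_subset
          (Finset.range_mono n.le_succ)) _)
        rw [Finset.sum_range_succ', hitTotal_eq hx'.ne']
        have h1 : x + 1 ≠ 0 := by omega
        simp only [hitSum, h1, if_false, add_zero]
        rw [← Finset.mul_sum, Finset.sum_add_distrib, ← Finset.mul_sum, ← Finset.mul_sum,
          mul_assoc, add_mul, mul_assoc, mul_assoc]
        rw [add_sub_cancel_right]
        gcongr
        · have := ih (x := x - 1) (by omega)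
          rwa [sub_add_cancel] at this
        · exact ih (x := x + 1) (by omega)
  · refine hitTotal_mul_le (V := fun x => hitTotal q p a (x + 1)) (by simp) (fun y hy => ?_) hx
    rw [hitTotal_eq (show y + 1 ≠ 0 by omega)]
    simp

/-- Nearest-neighbour jumps force a passage from `n` to `0` through every intermediate site, so the
strong Markov property factorizes the functional. -/
lemma hitTotal_natCast (n : ℕ) : hitTotal q p a n =
    ∏ k ∈ Finset.range n, hitTotal q p (fun y => a (y + k)) 1 := by
  induction n generalizing a with
  | zero => simp
  | succ n ih =>
    rw [Finset.prod_range_succ', Nat.cast_succ, hitTotal_add_one (by positivity), ih]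
    simp only [Nat.cast_zero, add_zero, Nat.cast_succ]
    congr 1
    refine Finset.prod_congr rfl fun k _ => ?_
    congr 1; ext y; congr 1; ring

/-- The first jump from `1` leads to `0` or to `2`, and from `2` the walk must come back through
`1`. This is the source of the Riccati recursion. -/
lemma hitTotal_one_eq : hitTotal q p a 1 =
    (a 1)⁻¹ * (q + p * (hitTotal q p (fun y => a (y + 1)) 1 * hitTotal q p a 1)) := by
  conv_lhs => rw [hitTotal_eq one_ne_zero, hitTotal_add_one zero_le_one]
  simp

lemma hitSum_anti {b : ℤ → ℝ≥0∞} (hab : a ≤ b) (n : ℕ) (x : ℤ) :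
    hitSum q p b n x ≤ hitSum q p a n x := by
  induction n generalizing x with
  | zero => rfl
  | succ n ih =>
    simp only [hitSum]
    split_ifs
    · rfl
    · have h1 := ih (x - 1)
      have h2 := ih (x + 1)
      have h3 := ENNReal.inv_le_inv.2 (hab x)
      gcongr

lemma hitTotal_anti {b : ℤ → ℝ≥0∞} (hab : a ≤ b) (x : ℤ) :
    hitTotal q p b x ≤ hitTotal q p a x := ENNReal.tsum_le_tsum fun n => hitSum_anti hab n x

/-- The factor `(a 0)⁻¹` is the weight of resting at `0` after the hit; later excursions from `0`
are discarded. Hitting functionals thus bound Green functions from below. -/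
lemma hitSum_mul_inv_le_greenSum (n : ℕ) (x : ℤ) :
    hitSum q p a n x * (a 0)⁻¹ ≤ greenSum p q a (point 0) n x := by
  induction n generalizing x with
  | zero =>
    by_cases h : x = 0
    · subst h; simp [hitSum, greenSum, point]
    · simp [hitSum, h]
  | succ n ih =>
    simp only [hitSum, greenSum]
    split_ifs
    · simp
    · rw [mul_assoc, add_mul, mul_assoc, mul_assoc, add_comm]
      gcongr
      · exact ih _
      · exact ih _

lemma hitTotal_mul_inv_le (x : ℤ) :
    hitTotal q p a x * (a 0)⁻¹ ≤ ∑' n, greenSum p q a (point 0) n x := by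
  rw [hitTotal, ← ENNReal.tsum_mul_right]
  exact ENNReal.tsum_le_tsum fun n => hitSum_mul_inv_le_greenSum n x

/-- The hitting jump starts in `1` and has rate `q`; dropping it, together with the constraint of
avoiding `0` before, leaves a trajectory ending in `1`. So an infinite hitting functional forces a
divergent return Green function at `1`. -/
lemma hitSum_succ_le_greenSum (n : ℕ) {x : ℤ} (hx : 0 ≤ x) :
    hitSum q p a (n + 1) x ≤ q * greenSum p q a (point 1) n x := by
  induction n generalizing x with
  | zero =>
    rcases hx.eq_or_lt with rfl | hx'
    · simp [hitSum]
    · have h0 : x ≠ 0 := hx'.ne'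
      have h1 : x + 1 ≠ 0 := by omega
      by_cases hx1 : x = 1
      · subst hx1; simp [hitSum, greenSum, point, mul_comm]
      · have h2 : x - 1 ≠ 0 := by omega
        simp [hitSum, h0, h1, h2]
  | succ n ih =>
    rw [hitSum, greenSum]
    rcases hx.eq_or_lt with rfl | hx'
    · simp
    · rw [if_neg hx'.ne']
      calc _ ≤ (a x)⁻¹ * (q * (q * greenSum p q a (point 1) n (x - 1)) +
            p * (q * greenSum p q a (point 1) n (x + 1))) := by
            gcongr
            · exact ih (by omega)
            · exact ih (by omega)
        _ = _ := by ring

lemma hitTotal_one_le_greenSum :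
    hitTotal q p a 1 ≤ q * ∑' n, greenSum p q a (point 1) n 1 := by
  rw [hitTotal, tsum_eq_zero_add' ENNReal.summable, ← ENNReal.tsum_mul_left]
  simp only [hitSum, one_ne_zero, if_false, zero_add]
  refine ENNReal.tsum_le_tsum fun n => ?_
  have := hitSum_succ_le_greenSum (q := q) (p := p) (a := a) n (zero_le_one (α := ℤ))
  simpa [hitSum] using this

lemma hitTotal_one_pos (hq : q ≠ 0) (ha : a 1 ≠ ⊤) : 0 < hitTotal q p a 1 := by
  rw [hitTotal_one_eq]
  exact ENNReal.mul_pos (ENNReal.inv_ne_zero.2 ha) (by simp [hq])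

end HitTotal

/-! ### The two-sided multiplicative extension -/

/-- The function on `ℤ` with value `1` at `0` and multiplicative increments `c`. -/
def cocycle (c : ℤ → ℝ) (x : ℤ) : ℝ := (∏ k ∈ Finset.Ico 0 x, c k) / ∏ k ∈ Finset.Ico x 0, c k

section Cocycle

variable {c : ℤ → ℝ}

@[simp]
lemma cocycle_zero : cocycle c 0 = 1 := by simp [cocycle]

lemma cocycle_pos (hc : ∀ k, 0 < c k) (x : ℤ) : 0 < cocycle c x :=
  div_pos (Finset.prod_pos fun k _ => hc k) (Finset.prod_pos fun k _ => hc k)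

lemma cocycle_natCast (n : ℕ) : cocycle c n = ∏ k ∈ Finset.range n, c k := by
  rw [cocycle, Finset.Ico_eq_empty (a := (n : ℤ)) (by simp), Finset.prod_empty, div_one]
  induction n with
  | zero => simp
  | succ n ih =>
    rw [Finset.prod_range_succ, ← ih, Nat.cast_succ,
      ← Finset.insert_Ico_right_eq_Ico_add_one (by positivity), Finset.prod_insert (by simp),
      mul_comm]

lemma cocycle_neg (n : ℕ) : cocycle c (-n) = (∏ k ∈ Finset.range n, c (-(k + 1)))⁻¹ := by
  rw [cocycle, Finset.Ico_eq_empty (b := -(n : ℤ)) (by simp), Finset.prod_empty, one_div]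
  congr 1
  induction n with
  | zero => simp
  | succ n ih =>
    rw [Finset.prod_range_succ, ← ih, Nat.cast_succ]
    have : Finset.Ico (-((n : ℤ) + 1)) 0 = insert (-((n : ℤ) + 1)) (Finset.Ico (-(n : ℤ)) 0) := by
      ext x; simp only [Finset.mem_Ico, Finset.mem_insert]; omega
    rw [this, Finset.prod_insert (by simp), mul_comm]

lemma cocycle_add_one (hc : ∀ k, 0 < c k) (x : ℤ) : cocycle c (x + 1) = c x * cocycle c x := by
  obtain ⟨n, rfl | rfl⟩ := x.eq_nat_or_neg
  · have := cocycle_natCast (c := c) (n + 1)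
    rw [Finset.prod_range_succ, ← cocycle_natCast] at this
    rw [← Nat.cast_succ, this, mul_comm]
  · rcases n with _ | n
    · have := cocycle_natCast (c := c) 1
      simp at this ⊢
      exact this
    · rw [cocycle_neg, Finset.prod_range_succ, show -((n + 1 : ℕ) : ℤ) + 1 = -(n : ℤ) by
        push_cast; ring, cocycle_neg, mul_inv, mul_left_comm, Nat.cast_succ,
        mul_inv_cancel₀ (hc _).ne', mul_one]

end Cocycle

/-! ### The recursion for the hitting functions -/

section Recursion

variable {q p : ℝ} {A H : ℤ → ℝ}

/-- `H` is a positive solution of the Riccati recursion with coefficients `A`. -/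
structure IsRiccati (q p : ℝ) (A H : ℤ → ℝ) : Prop where
  pos : ∀ k, 0 < H k
  eqn : ∀ k, A (k + 1) * H k = q + p * (H (k + 1) * H k)

/-- In this form the coefficient is a sum of non-negative terms, from which its sign and both a
priori bounds below can be read off. -/
lemma IsRiccati.div_add (hH : IsRiccati q p A H) (k : ℤ) : q / H k + p * H (k + 1) = A (k + 1) := by
  have := (hH.pos k).ne'
  field_simp
  linarith [hH.eqn k]

lemma IsRiccati.coeff_pos (hH : IsRiccati q p A H) (hq : 0 < q) (hp : 0 ≤ p) (k : ℤ) :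
    0 < A k := by
  have := hH.div_add (k - 1)
  rw [sub_add_cancel] at this
  rw [← this]
  have h1 := hH.pos k
  have h2 := hH.pos (k - 1)
  positivity

/-- Subtracting the divided recursions and using `H' ≤ H` leaves `q / H' k ≥ δ`: a shift of the
coefficients by `δ` alone gives an upper bound independent of `A`. -/
lemma IsRiccati.le_div {δ : ℝ} {H' : ℤ → ℝ} (hH : IsRiccati q p A H)
    (hH' : IsRiccati q p (fun k => A k + δ) H') (hq : 0 < q) (hp : 0 ≤ p) (hδ : 0 < δ)
    (hle : ∀ k, H' k ≤ H k) (k : ℤ) : H' k ≤ q / δ := by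
  have h1 := hH.div_add k
  have h2 := hH'.div_add k
  have h3 : δ ≤ q / H' k := by
    have : 0 < q / H k := div_pos hq (hH.pos k)
    nlinarith [mul_le_mul_of_nonneg_left (hle (k + 1)) hp]
  rw [le_div_iff₀ (hH'.pos k)] at h3
  rw [le_div_iff₀ hδ]
  linarith

/-- The same subtraction in the other direction: lowering the parameter increases `q / H` by at most
`p C + δ`. This will control logarithmic increments even where `H` is close to `0`. -/
lemma IsRiccati.inv_le {δ C : ℝ} {H' : ℤ → ℝ} (hH : IsRiccati q p A H)
    (hH' : IsRiccati q p (fun k => A k + δ) H') (hq : 0 < q) (hp : 0 ≤ p)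
    (hC : ∀ k, H k ≤ C) (k : ℤ) : (H' k)⁻¹ ≤ (H k)⁻¹ + (p * C + δ) / q := by
  have h1 := hH.div_add k
  have h2 := hH'.div_add k
  have h3 : q / H' k ≤ q / H k + (p * C + δ) := by
    nlinarith [mul_le_mul_of_nonneg_left (hC (k + 1)) hp,
      mul_nonneg hp (hH'.pos (k + 1)).le]
  rw [div_eq_mul_inv, div_eq_mul_inv] at h3
  have h4 : q * (H' k)⁻¹ ≤ q * ((H k)⁻¹ + (p * C + δ) / q) := by
    rw [mul_add, mul_div_cancel₀ _ hq.ne']; exact h3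
  exact le_of_mul_le_mul_left h4 hq

variable {v : ℤ → ℝ} {β : ℝ}

/-- Upper bound for the kernel of the walk with drift to the left, started anywhere. -/
lemma IsRiccati.kernel_le (hH : IsRiccati q p (fun x => -v x - β) H) (hq : 0 < q) (hp : 0 ≤ p)
    (y x : ℤ) (t : ℝ) :
    kernel (ENNReal.ofReal p) (ENNReal.ofReal q) v (point y) x t ≤
      expKernel (-β) t * ENNReal.ofReal (cocycle H x / cocycle H y) := by
  have hpos := cocycle_pos hH.pos
  -- The recursion states that the cocycle is harmonic, `p c(x+1) + q c(x-1) = A(x) c(x)`; it is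
  -- normalized to be `1` at the target.
  refine kernel_le_exp_mul (ψ := fun x => ENNReal.ofReal (cocycle H x / cocycle H y))
    (fun z => ?_) (fun x => (hH.coeff_pos hq hp x).le) (fun x => ?_) x t
  · by_cases h : z = y
    · subst h; simp [point, div_self (hpos z).ne']
    · simp [point, h]
  · have h0 : ∀ z, 0 ≤ cocycle H z / cocycle H y := fun z => (div_pos (hpos z) (hpos y)).le
    rw [← ENNReal.ofReal_mul hp, ← ENNReal.ofReal_mul hq.le,
      ← ENNReal.ofReal_mul (hH.coeff_pos hq hp x).le,
      ← ENNReal.ofReal_add (mul_nonneg hp (h0 _)) (mul_nonneg hq.le (h0 _))]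
    refine ENNReal.ofReal_le_ofReal (le_of_eq ?_)
    have h1 := cocycle_add_one hH.pos x
    have h2 := cocycle_add_one hH.pos (x - 1)
    have h3 := hH.div_add (x - 1)
    have h4 := (hH.pos (x - 1)).ne'
    rw [sub_add_cancel] at h2 h3
    rw [← h3, h1, h2]
    field_simp
    ring

/-- Upper bound for the kernel of the walk with drift to the right, moving to the right. -/
lemma IsRiccati.kernel_right_le (hH : IsRiccati q p (fun x => -v x - β) H) (hq : 0 < q)
    (hp : 0 ≤ p) (n : ℕ) (t : ℝ) :
    kernel (ENNReal.ofReal q) (ENNReal.ofReal p) v (point n) 0 t ≤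
      expKernel (-β) t * ENNReal.ofReal (∏ k ∈ Finset.range n, H k) := by
  rw [kernel_reverse]
  simpa [cocycle_natCast] using hH.kernel_le hq hp 0 n t

/-- Upper bound for the kernel of the walk with drift to the right, moving to the left. -/
lemma IsRiccati.kernel_left_le (hH : IsRiccati q p (fun x => -v x - β) H) (hq : 0 < q)
    (hp : 0 ≤ p) (n : ℕ) (t : ℝ) :
    kernel (ENNReal.ofReal q) (ENNReal.ofReal p) v (point (-n)) 0 t ≤
      expKernel (-β) t *
        ENNReal.ofReal ((p / q) ^ n * ∏ k ∈ Finset.range n, H (-(k + 1))) := by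
  have hpos := cocycle_pos hH.pos
  rcases hp.eq_or_lt with rfl | hp'
  · rcases n with _ | n
    · simpa using hH.kernel_right_le hq hp 0 t
    -- Without jumps to the left the target is unreachable. The function that is infinite from the
    -- target leftwards and zero elsewhere is a supersolution vanishing at the starting point.
    · refine (kernel_le_exp_mul (ψ := fun x => if x ≤ -((n + 1 : ℕ) : ℤ) then ⊤ else 0)
        (β := β) (fun z => ?_) (fun x => (hH.coeff_pos hq hp x).le) (fun x => ?_) 0 t).trans ?_
      · by_cases h : z = -((n + 1 : ℕ) : ℤ)
        · simp [h]
        · simp only [point, h, if_false]; exact zero_le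
      · have h1 := hH.coeff_pos hq hp x
        by_cases hx : x ≤ -((n + 1 : ℕ) : ℤ)
        · simp only [hx, if_true]
          rw [ENNReal.mul_top (by simpa using h1)]
          exact le_top
        · have : ¬ x + 1 ≤ -((n + 1 : ℕ) : ℤ) := by omega
          simp only [if_neg this, if_neg hx, mul_zero, ENNReal.ofReal_zero, zero_mul, add_zero, le_refl]
      · have : ¬ (0 : ℤ) ≤ -((n + 1 : ℕ) : ℤ) := by push_cast; omega
        simp only [if_neg this, mul_zero]; exact zero_le
  · have hr : 0 < p / q := div_pos hp' hq
    -- The factor `(p / q) ^ x` exchanges the two drifts: it turns the harmonic function of the walk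
    -- drifting to the left into one for the walk drifting to the right.
    have hψ : ∀ x : ℤ, 0 < (p / q) ^ (x + n) * cocycle H x * (cocycle H (-n))⁻¹ := fun x =>
      mul_pos (mul_pos (zpow_pos hr _) (hpos x)) (inv_pos.2 (hpos _))
    refine (kernel_le_exp_mul (ψ := fun x : ℤ => ENNReal.ofReal
      ((p / q) ^ (x + n) * cocycle H x * (cocycle H (-n))⁻¹))
      (β := β) (fun z => ?_) (fun x => (hH.coeff_pos hq hp x).le) (fun x => ?_) 0 t).trans ?_
    · by_cases h : z = -(n : ℤ)
      · subst h; simp [point, mul_inv_cancel₀ (hpos _).ne']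
      · simp [point, h]
    · rw [← ENNReal.ofReal_mul hp, ← ENNReal.ofReal_mul hq.le,
        ← ENNReal.ofReal_mul (hH.coeff_pos hq hp x).le,
        ← ENNReal.ofReal_add (mul_nonneg hq.le (hψ _).le) (mul_nonneg hp (hψ _).le)]
      refine ENNReal.ofReal_le_ofReal (le_of_eq ?_)
      have h1 := cocycle_add_one hH.pos x
      have h2 := cocycle_add_one hH.pos (x - 1)
      have h3 := hH.div_add (x - 1)
      have h4 := (hH.pos (x - 1)).ne'
      rw [sub_add_cancel] at h2 h3
      rw [← h3, h1, h2, show x + 1 + (n : ℤ) = (x - 1 + n) + 1 + 1 by ring,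
        show x + (n : ℤ) = (x - 1 + n) + 1 by ring, zpow_add_one₀ hr.ne', zpow_add_one₀ hr.ne']
      field_simp
      ring
    · rw [cocycle_neg]
      simp

end Recursion

end

end PAM

/-! ### Path space of the walk: renewal at the first jump and non-explosion. -/

namespace PAM

noncomputable section

/-! ### First-step decomposition of the law of the walk -/

/-- The path with first (holding time, jump) `a` and then `ω`. -/
def consPath (a : ℝ × ℤ) (ω : Path) : Path := fun n => Nat.casesOn n a ω

/-- The path after the first jump. -/
def tailPath (ω : Path) : Path := fun n => ω (n + 1)

@[simp] lemma consPath_zero (a : ℝ × ℤ) (ω : Path) : consPath a ω 0 = a := rfl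

@[simp] lemma consPath_succ (a : ℝ × ℤ) (ω : Path) (n : ℕ) : consPath a ω (n + 1) = ω n := rfl

@[simp] lemma tailPath_consPath (a : ℝ × ℤ) (ω : Path) : tailPath (consPath a ω) = ω := rfl

@[fun_prop]
lemma measurable_tailPath : Measurable tailPath :=
  measurable_pi_lambda _ fun n => measurable_pi_apply (n + 1)

lemma measurable_consPath : Measurable fun y : (ℝ × ℤ) × Path => consPath y.1 y.2 := by
  refine measurable_pi_lambda _ fun n => ?_
  cases n with
  | zero => exact measurable_fst
  | succ n => exact (measurable_pi_apply n).comp measurable_snd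

lemma isProbabilityMeasure_stepLaw {h : ℝ} (h1 : -1 ≤ h) (h2 : h ≤ 1) :
    IsProbabilityMeasure (stepLaw h) := by
  constructor
  simp only [stepLaw, Measure.add_apply, Measure.smul_apply, smul_eq_mul, measure_univ, mul_one]
  rw [← ENNReal.ofReal_add (by linarith) (by linarith)]
  simp; ring

/-- Prepending an independent step to an i.i.d. sequence reproduces its law, as is checked on
cylinders. All one-step analyses of the walk rely on this. -/
lemma map_consPath_infinitePi (μ : Measure (ℝ × ℤ)) [IsProbabilityMeasure μ] :
    (μ.prod (Measure.infinitePi fun _ : ℕ => μ)).map (fun y => consPath y.1 y.2) =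
      Measure.infinitePi fun _ : ℕ => μ := by
  refine Measure.eq_infinitePi _ fun s t ht => ?_
  classical
  obtain ⟨N, hN⟩ := s.bddAbove
  -- Fill the index set up to an initial segment, so that coordinate `0` can be split off as a
  -- factor.
  set t' : ℕ → Set (ℝ × ℤ) := fun i => if i ∈ s then t i else Set.univ with ht'
  have htm : ∀ i, MeasurableSet (t' i) := fun i => by
    simp only [ht']; split_ifs
    · exact ht i
    · exact MeasurableSet.univ
  have hsub : s ⊆ Finset.range (N + 2) := fun i hi => by
    have := hN hi; simp; omega
  have h1 : Set.pi (s : Set ℕ) t = Set.pi (Finset.range (N + 2) : Set ℕ) t' := by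
    ext y
    simp only [Set.mem_pi, ht', Finset.mem_coe]
    constructor
    · intro hy i _
      split_ifs with hi
      · exact hy i hi
      · trivial
    · intro hy i hi
      have := hy i (hsub hi)
      rwa [if_pos hi] at this
  have h2 : ∏ i ∈ s, μ (t i) = ∏ i ∈ Finset.range (N + 2), μ (t' i) := by
    rw [← Finset.prod_subset hsub (f := fun i => μ (t' i))]
    · exact Finset.prod_congr rfl fun i hi => by simp [ht', hi]
    · intro i _ hi; simp [ht', hi]
  have h3 : (fun y : (ℝ × ℤ) × Path => consPath y.1 y.2) ⁻¹'
      (Set.pi (Finset.range (N + 2) : Set ℕ) t') =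
      t' 0 ×ˢ Set.pi (Finset.range (N + 1) : Set ℕ) (fun i => t' (i + 1)) := by
    ext ⟨a, ω⟩
    simp only [Set.mem_preimage, Set.mem_pi, Finset.coe_range, Set.mem_Iio, Set.mem_prod]
    constructor
    · intro hy
      exact ⟨hy 0 (by omega), fun i hi => hy (i + 1) (by omega)⟩
    · rintro ⟨h0, hy⟩ i hi
      cases i with
      | zero => exact h0
      | succ i => exact hy i (by omega)
  rw [h1, Measure.map_apply measurable_consPath
    (MeasurableSet.pi (Finset.countable_toSet _) fun i _ => htm i), h3, Measure.prod_prod,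
    Measure.infinitePi_pi _ (fun i _ => htm (i + 1)), h2, Finset.prod_range_succ' _ (N + 1), mul_comm]

section Walk

variable {κ h : ℝ}

lemma lintegral_expMeasure {F : ℝ → ℝ≥0∞} (hF : Measurable F) (hκ : 0 < κ) :
    ∫⁻ τ, F τ ∂(expMeasure κ) = ENNReal.ofReal κ * ∫⁻ τ, expKernel (-κ) τ * F τ := by
  have hm : Measurable (gammaPDF 1 κ) := (measurable_exponentialPDFReal κ).ennreal_ofReal
  rw [expMeasure, gammaMeasure, lintegral_withDensity_eq_lintegral_mul _ hm hF,
    ← lintegral_const_mul _ (by fun_prop)]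
  refine lintegral_congr fun τ => ?_
  change exponentialPDF κ τ * F τ = _
  rcases lt_or_ge τ 0 with h0 | h0
  · rw [exponentialPDF_of_neg h0, expKernel_of_neg _ h0]; simp
  · rw [exponentialPDF_of_nonneg h0, expKernel_of_nonneg _ h0, ENNReal.ofReal_mul hκ.le, neg_mul]
    ring

lemma lintegral_stepLaw (F : ℤ → ℝ≥0∞) : ∫⁻ s, F s ∂(stepLaw h) =
    ENNReal.ofReal ((1 + h) / 2) * F 1 + ENNReal.ofReal ((1 - h) / 2) * F (-1) := by
  rw [stepLaw, lintegral_add_measure, lintegral_smul_measure, lintegral_smul_measure,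
    lintegral_dirac, lintegral_dirac]
  rfl

lemma isProbabilityMeasure_step (hκ : 0 < κ) (h1 : -1 ≤ h) (h2 : h ≤ 1) :
    IsProbabilityMeasure ((expMeasure κ).prod (stepLaw h)) := by
  have := isProbabilityMeasure_expMeasure hκ
  have := isProbabilityMeasure_stepLaw h1 h2
  infer_instance

lemma isProbabilityMeasure_walkLaw (hκ : 0 < κ) (h1 : -1 ≤ h) (h2 : h ≤ 1) :
    IsProbabilityMeasure (walkLaw κ h) := by
  have := isProbabilityMeasure_step hκ h1 h2
  unfold walkLaw
  infer_instance

/-- The first-step decomposition. -/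
lemma lintegral_walkLaw (hκ : 0 < κ) (h1 : -1 ≤ h) (h2 : h ≤ 1) {F : Path → ℝ≥0∞}
    (hF : Measurable F) : ∫⁻ ω, F ω ∂(walkLaw κ h) =
      ∫⁻ τ, expKernel (-κ) τ *
        (ENNReal.ofReal (κ * (1 + h) / 2) * ∫⁻ ω, F (consPath (τ, 1) ω) ∂(walkLaw κ h) +
        ENNReal.ofReal (κ * (1 - h) / 2) * ∫⁻ ω, F (consPath (τ, -1) ω) ∂(walkLaw κ h)) := by
  have i1 := isProbabilityMeasure_expMeasure hκ
  have i2 := isProbabilityMeasure_stepLaw h1 h2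
  have i3 := isProbabilityMeasure_step hκ h1 h2
  have i4 := isProbabilityMeasure_walkLaw hκ h1 h2
  have hm : Measurable fun y : (ℝ × ℤ) × Path => F (consPath y.1 y.2) := hF.comp measurable_consPath
  have hm2 : Measurable fun a : ℝ × ℤ => ∫⁻ ω, F (consPath a ω) ∂(walkLaw κ h) :=
    hm.lintegral_prod_right'
  have hm3 : ∀ s : ℤ, Measurable fun τ : ℝ => ∫⁻ ω, F (consPath (τ, s) ω) ∂(walkLaw κ h) :=
    fun s => hm2.comp (by fun_prop)
  conv_lhs => rw [walkLaw, ← map_consPath_infinitePi, lintegral_map hF measurable_consPath,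
    lintegral_prod _ hm.aemeasurable]
  change ∫⁻ a, ∫⁻ ω, F (consPath a ω) ∂(walkLaw κ h) ∂((expMeasure κ).prod (stepLaw h)) = _
  rw [lintegral_prod _ hm2.aemeasurable]
  simp only [lintegral_stepLaw]
  have hm4 : Measurable fun τ : ℝ =>
      ENNReal.ofReal ((1 + h) / 2) * ∫⁻ ω, F (consPath (τ, 1) ω) ∂(walkLaw κ h) +
      ENNReal.ofReal ((1 - h) / 2) * ∫⁻ ω, F (consPath (τ, -1) ω) ∂(walkLaw κ h) :=
    ((hm3 1).const_mul _).add ((hm3 (-1)).const_mul _)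
  have hm5 : Measurable fun τ : ℝ => expKernel (-κ) τ *
      (ENNReal.ofReal ((1 + h) / 2) * ∫⁻ ω, F (consPath (τ, 1) ω) ∂(walkLaw κ h) +
      ENNReal.ofReal ((1 - h) / 2) * ∫⁻ ω, F (consPath (τ, -1) ω) ∂(walkLaw κ h)) :=
    (measurable_expKernel _).mul hm4
  rw [lintegral_expMeasure hm4 hκ, ← lintegral_const_mul _ hm5]
  refine lintegral_congr fun τ => ?_
  rw [mul_div_assoc, mul_div_assoc, ENNReal.ofReal_mul hκ.le, ENNReal.ofReal_mul hκ.le]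
  ring

/-! ### Regular paths -/

/-- All holding times are positive and the jump times are unbounded. -/
def IsRegular (ω : Path) : Prop := (∀ i, 0 < (ω i).1) ∧ ∀ t : ℝ, ∃ n, t < jumpTime ω n

lemma jumpTime_zero (ω : Path) : jumpTime ω 0 = 0 := by simp [jumpTime]

lemma jumpTime_succ (ω : Path) (n : ℕ) :
    jumpTime ω (n + 1) = (ω 0).1 + jumpTime (tailPath ω) n := by
  simp only [jumpTime, tailPath]
  rw [Finset.sum_range_succ', add_comm]

lemma IsRegular.jumpTime_mono {ω : Path} (hω : IsRegular ω) : StrictMono (jumpTime ω) :=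
  strictMono_nat_of_lt_succ fun n => by
    simp only [jumpTime]
    rw [Finset.sum_range_succ]
    linarith [hω.1 n]

lemma IsRegular.tail {ω : Path} (hω : IsRegular ω) : IsRegular (tailPath ω) := by
  refine ⟨fun i => hω.1 (i + 1), fun t => ?_⟩
  obtain ⟨n, hn⟩ := hω.2 (t + (ω 0).1)
  refine ⟨n, ?_⟩
  have h1 := hω.jumpTime_mono (Nat.lt_succ_self n)
  rw [jumpTime_succ] at h1
  linarith

lemma IsRegular.exists_jumpTime {ω : Path} (hω : IsRegular ω) {t : ℝ} (ht : 0 ≤ t) :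
    ∃ n, jumpTime ω n ≤ t ∧ t < jumpTime ω (n + 1) := by
  classical
  have hex := hω.2 t
  have h1 := Nat.find_spec hex
  have h2 : Nat.find hex ≠ 0 := fun h0 => by
    rw [h0, jumpTime_zero] at h1; linarith
  obtain ⟨m, hm⟩ := Nat.exists_eq_succ_of_ne_zero h2
  refine ⟨m, not_lt.1 (Nat.find_min hex (by omega)), ?_⟩
  rwa [hm] at h1

/-- The exponential law does not charge `(-∞, 0]`, and by the second Borel-Cantelli lemma infinitely
many holding times exceed `1`, so the jump times diverge. -/
lemma ae_isRegular (hκ : 0 < κ) (h1 : -1 ≤ h) (h2 : h ≤ 1) : ∀ᵐ ω ∂(walkLaw κ h), IsRegular ω := by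
  have i1 := isProbabilityMeasure_expMeasure hκ
  have i2 := isProbabilityMeasure_stepLaw h1 h2
  have i3 := isProbabilityMeasure_step hκ h1 h2
  have i4 := isProbabilityMeasure_walkLaw hκ h1 h2
  have hmp : ∀ i : ℕ, MeasurePreserving (Function.eval i) (walkLaw κ h)
      ((expMeasure κ).prod (stepLaw h)) := fun i =>
    measurePreserving_eval_infinitePi (fun _ : ℕ => (expMeasure κ).prod (stepLaw h)) i
  have hval : ∀ (s : Set ℝ), MeasurableSet s → ∀ i, walkLaw κ h {ω | (ω i).1 ∈ s} =
      expMeasure κ s := fun s hs i => by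
    have := (hmp i).measure_preimage (s := s ×ˢ Set.univ)
      (hs.prod MeasurableSet.univ).nullMeasurableSet
    rw [Measure.prod_prod, measure_univ, mul_one] at this
    rw [← this]
    congr 1
    ext ω; simp
  have hexp : ∀ (s : Set ℝ), MeasurableSet s → expMeasure κ s =
      ENNReal.ofReal κ * ∫⁻ τ, expKernel (-κ) τ * s.indicator 1 τ := fun s hs => by
    rw [← lintegral_expMeasure (measurable_one.indicator hs) hκ, lintegral_indicator_one hs]
  have hpos : ∀ᵐ ω ∂(walkLaw κ h), ∀ i, 0 < (ω i).1 := by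
    rw [ae_all_iff]
    intro i
    have h3 : walkLaw κ h {ω | (ω i).1 ∈ Set.Iic 0} = 0 := by
      rw [hval _ measurableSet_Iic, hexp _ measurableSet_Iic]
      have : ∀ᵐ τ : ℝ, expKernel (-κ) τ * (Set.Iic (0 : ℝ)).indicator 1 τ = 0 := by
        have h0 : ∀ᵐ τ : ℝ, τ ≠ 0 := by simp [ae_iff]
        filter_upwards [h0] with τ hτ
        rcases hτ.lt_or_gt with h | h
        · rw [expKernel_of_neg _ h, zero_mul]
        · simp [h]
      rw [lintegral_congr_ae this]; simp
    filter_upwards [measure_eq_zero_iff_ae_notMem.1 h3] with ω hω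
    simpa using hω
  have hms : ∀ i : ℕ, MeasurableSet {ω : Path | (ω i).1 ∈ Set.Ioi (1 : ℝ)} :=
    fun i => measurableSet_Ioi.preimage (by fun_prop : Measurable fun ω : Path => (ω i).1)
  have hind : iIndepSet (fun i : ℕ => {ω : Path | (ω i).1 ∈ Set.Ioi (1 : ℝ)}) (walkLaw κ h) := by
    rw [iIndepSet_iff_meas_biInter hms]
    intro S
    have := iIndepFun_infinitePi (P := fun _ : ℕ => (expMeasure κ).prod (stepLaw h))
      (X := fun _ y => y.1) (fun _ => measurable_fst)
    exact (iIndepFun_iff_measure_inter_preimage_eq_mul.1 this) S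
      (sets := fun _ => Set.Ioi 1) (fun _ _ => measurableSet_Ioi)
  have hsum : ∑' i : ℕ, walkLaw κ h {ω : Path | (ω i).1 ∈ Set.Ioi (1 : ℝ)} = ⊤ := by
    simp only [hval _ measurableSet_Ioi]
    refine ENNReal.tsum_const_eq_top_of_ne_zero ?_
    rw [hexp _ measurableSet_Ioi]
    refine mul_ne_zero (by simpa using hκ) fun h0 => ?_
    have hm0 : Measurable fun τ => expKernel (-κ) τ * (Set.Ioi (1 : ℝ)).indicator 1 τ :=
      (measurable_expKernel _).mul (measurable_one.indicator measurableSet_Ioi)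
    rw [lintegral_eq_zero_iff hm0] at h0
    have h4 : volume (Set.Ioi (1 : ℝ)) = 0 := by
      rw [measure_eq_zero_iff_ae_notMem]
      filter_upwards [h0] with τ hτ hτ1
      rw [expKernel_of_nonneg _ (by have : 1 < τ := hτ1; linarith),
        Set.indicator_of_mem hτ1] at hτ
      simp at hτ
      exact absurd hτ (not_le.2 (Real.exp_pos _))
    simp at h4
  have hlim := measure_limsup_eq_one hms hind hsum
  have hfreq : ∀ᵐ ω ∂(walkLaw κ h), ∃ᶠ i in atTop, 1 < (ω i).1 := by
    filter_upwards [(prob_compl_eq_zero_iff (MeasurableSet.measurableSet_limsup hms)).2 hlim |> measure_eq_zero_iff_ae_notMem.1]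
      with ω hω
    rw [Set.notMem_compl_iff, mem_limsup_iff_frequently_mem] at hω
    exact hω
  filter_upwards [hpos, hfreq] with ω hp hf
  refine ⟨hp, fun t => ?_⟩
  have hmono : Monotone (jumpTime ω) := monotone_nat_of_le_succ fun n => by
    simp only [jumpTime]
    rw [Finset.sum_range_succ]
    linarith [hp n]
  have key : ∀ K : ℕ, ∃ n, (K : ℝ) ≤ jumpTime ω n := fun K => by
    induction K with
    | zero => exact ⟨0, by simp [jumpTime]⟩
    | succ K ih =>
      obtain ⟨n, hn⟩ := ih
      obtain ⟨m, hm, hm1⟩ := frequently_atTop.1 hf n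
      refine ⟨m + 1, ?_⟩
      have h5 : jumpTime ω (m + 1) = jumpTime ω m + (ω m).1 := by
        simp only [jumpTime]; rw [Finset.sum_range_succ]
      have := hmono hm
      push_cast; linarith
  obtain ⟨K, hK⟩ := exists_nat_gt t
  obtain ⟨n, hn⟩ := key K
  exact ⟨n, hK.trans_le hn⟩

/-! ### Positions along regular paths -/

lemma position_of_lt (x : ℤ) {ω : Path} {t : ℝ} (ht : t < (ω 0).1) : position x ω t = x := by
  have : jumpCount ω t = 0 := by
    refine Nat.sInf_eq_zero.2 (Or.inl ?_)
    simpa [jumpTime] using ht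
  simp [position, this]

lemma IsRegular.position_of_ge {ω : Path} (hω : IsRegular ω) (x : ℤ) {t : ℝ} (ht : (ω 0).1 ≤ t) :
    position x ω t = position (x + (ω 0).2) (tailPath ω) (t - (ω 0).1) := by
  have h1 : jumpCount ω t = jumpCount (tailPath ω) (t - (ω 0).1) + 1 := by
    have hiff : ∀ n, t < jumpTime ω (n + 1 + 1) ↔ t - (ω 0).1 < jumpTime (tailPath ω) (n + 1) :=
      fun n => by rw [jumpTime_succ]; constructor <;> intro h <;> linarith
    have hne : {n : ℕ | t - (ω 0).1 < jumpTime (tailPath ω) (n + 1)}.Nonempty := by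
      obtain ⟨n, hn⟩ := hω.tail.exists_jumpTime (t := t - (ω 0).1) (by linarith)
      exact ⟨n, hn.2⟩
    have hmem := Nat.sInf_mem hne
    refine le_antisymm (Nat.sInf_le ((hiff _).2 hmem)) ?_
    have hne' : {n : ℕ | t < jumpTime ω (n + 1)}.Nonempty := ⟨_, (hiff _).2 hmem⟩
    have hmem' := Nat.sInf_mem hne'
    change sInf _ + 1 ≤ sInf _
    rcases hk : sInf {n : ℕ | t < jumpTime ω (n + 1)} with _ | k
    · rw [hk] at hmem'
      simp [jumpTime] at hmem'; linarith
    · rw [hk] at hmem'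
      exact Nat.succ_le_succ (Nat.sInf_le ((hiff _).1 hmem'))
  rw [position, position, h1, Finset.sum_range_succ']
  simp only [tailPath]
  ring

lemma IsRegular.integral_step {ω : Path} (hω : IsRegular ω) (g : ℤ → ℝ) (x : ℤ) {t : ℝ}
    (ht : (ω 0).1 ≤ t)
    (hi : IntervalIntegrable (fun s => g (position (x + (ω 0).2) (tailPath ω) s)) volume
      0 (t - (ω 0).1)) :
    IntervalIntegrable (fun s => g (position x ω s)) volume 0 t ∧
      ∫ s in (0 : ℝ)..t, g (position x ω s) = g x * (ω 0).1 +
        ∫ s in (0 : ℝ)..t - (ω 0).1, g (position (x + (ω 0).2) (tailPath ω) s) := by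
  have h0 := hω.1 0
  have e1 : Set.EqOn (fun s => g (position x ω s)) (fun _ => g x) (Set.uIoo 0 (ω 0).1) := by
    intro s hs
    rw [Set.uIoo_of_le h0.le] at hs
    simp only [position_of_lt x hs.2]
  have e2 : Set.EqOn (fun s => g (position (x + (ω 0).2) (tailPath ω) (s - (ω 0).1)))
      (fun s => g (position x ω s)) (Set.uIoc (ω 0).1 t) := by
    intro s hs
    rw [Set.uIoc_of_le ht] at hs
    simp only [hω.position_of_ge x hs.1.le]
  have i1 : IntervalIntegrable (fun s => g (position x ω s)) volume 0 (ω 0).1 :=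
    (intervalIntegrable_const (c := g x)).congr_uIoo e1.symm
  have i2 : IntervalIntegrable (fun s => g (position x ω s)) volume (ω 0).1 t := by
    have := hi.comp_sub_right (ω 0).1
    rw [zero_add, sub_add_cancel] at this
    exact this.congr e2
  refine ⟨i1.trans i2, ?_⟩
  rw [← intervalIntegral.integral_add_adjacent_intervals i1 i2,
    intervalIntegral.integral_congr_uIoo e1]
  congr 1
  · simp [mul_comm]
  · have e3 := intervalIntegral.integral_comp_sub_right (a := (ω 0).1) (b := t)
      (fun s => g (position (x + (ω 0).2) (tailPath ω) s)) (ω 0).1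
    rw [sub_self] at e3
    rw [← e3]
    refine intervalIntegral.integral_congr_uIoo fun s hs => (e2 ?_).symm
    rw [Set.uIoo_of_le ht] at hs
    rw [Set.uIoc_of_le ht]
    exact ⟨hs.1, hs.2.le⟩

lemma IsRegular.integral_of_lt {ω : Path} (g : ℤ → ℝ) (x : ℤ) {t : ℝ}
    (h0 : 0 ≤ t) (ht : t < (ω 0).1) :
    IntervalIntegrable (fun s => g (position x ω s)) volume 0 t ∧
      ∫ s in (0 : ℝ)..t, g (position x ω s) = g x * t := by
  have e1 : Set.EqOn (fun _ => g x) (fun s => g (position x ω s)) (Set.uIoc 0 t) := by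
    intro s hs
    rw [Set.uIoc_of_le h0] at hs
    simp only [position_of_lt x (hs.2.trans_lt ht)]
  refine ⟨(intervalIntegrable_const (c := g x)).congr e1, ?_⟩
  rw [intervalIntegral.integral_congr_uIoo (g := fun _ => g x)]
  · simp [mul_comm]
  · intro s hs
    rw [Set.uIoo_of_le h0] at hs
    simp only [position_of_lt x (hs.2.trans ht)]

lemma IsRegular.intervalIntegrable {ω : Path} (hω : IsRegular ω) (g : ℤ → ℝ) (x : ℤ) {t : ℝ}
    (h0 : 0 ≤ t) : IntervalIntegrable (fun s => g (position x ω s)) volume 0 t := by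
  obtain ⟨n, hn1, hn2⟩ := hω.exists_jumpTime h0
  induction n generalizing x t ω with
  | zero =>
    refine (integral_of_lt g x h0 ?_).1
    simpa [jumpTime] using hn2
  | succ n ih =>
    rw [jumpTime_succ] at hn1 hn2
    have h1 : 0 ≤ jumpTime (tailPath ω) n := by
      rw [← jumpTime_zero (tailPath ω)]; exact hω.tail.jumpTime_mono.monotone (Nat.zero_le n)
    exact (hω.integral_step g x (by linarith)
      (ih hω.tail (x + (ω 0).2) (by linarith) (by linarith) (by linarith))).1

end Walk

end

end PAM

/-! ### Expectations over paths identified with their jump expansions. -/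

namespace PAM

noncomputable section

/-! ### The Feynman-Kac functional as a kernel -/

/-- The contribution of the event of exactly `n` jumps before `t` to `exp (∫₀ᵗ ξ(X)) f(X_t)`. -/
def pathTerm (ξ : ℤ → ℝ) (f : ℤ → ℝ≥0∞) : ℕ → ℤ → ℝ → Path → ℝ≥0∞
  | 0, x, t, ω => if 0 ≤ t ∧ t < (ω 0).1 then f x * ENNReal.ofReal (Real.exp (ξ x * t)) else 0
  | n + 1, x, t, ω => if (ω 0).1 ≤ t then ENNReal.ofReal (Real.exp (ξ x * (ω 0).1)) *
      pathTerm ξ f n (x + (ω 0).2) (t - (ω 0).1) (tailPath ω) else 0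

/-- The contribution of the event that `0` is hit at the `n`-th jump to `exp (∫₀^{T₀} w(X))`. -/
def hitTerm (w : ℤ → ℝ) : ℕ → ℤ → Path → ℝ≥0∞
  | 0, x, _ => if x = 0 then 1 else 0
  | n + 1, x, ω => if x = 0 then 0 else ENNReal.ofReal (Real.exp (w x * (ω 0).1)) *
      hitTerm w n (x + (ω 0).2) (tailPath ω)

section PathTerm

variable {κ h : ℝ} {ξ w : ℤ → ℝ} {f : ℤ → ℝ≥0∞}

lemma measurable_pathTerm (n : ℕ) (x : ℤ) :
    Measurable fun y : ℝ × Path => pathTerm ξ f n x y.1 y.2 := by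
  induction n generalizing x with
  | zero =>
    simp only [pathTerm]
    refine Measurable.ite ?_ (by fun_prop) measurable_const
    exact (measurableSet_le measurable_const measurable_fst).inter
      (measurableSet_lt measurable_fst (by fun_prop : Measurable fun y : ℝ × Path => (y.2 0).1))
  | succ n ih =>
    simp only [pathTerm]
    refine Measurable.ite (measurableSet_le
      (by fun_prop : Measurable fun y : ℝ × Path => (y.2 0).1) measurable_fst) ?_ measurable_const
    refine Measurable.mul (by fun_prop) ?_
    -- The site after the first jump is random, so measurability jointly with the site is needed;
    -- `ℤ` being countable provides it.
    have h1 : Measurable fun y : ℤ × (ℝ × Path) => pathTerm ξ f n y.1 y.2.1 y.2.2 :=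
      measurable_from_prod_countable_right fun z => ih z
    exact h1.comp (f := fun y : ℝ × Path =>
      ((x + (y.2 0).2, (y.1 - (y.2 0).1, tailPath y.2)) : ℤ × (ℝ × Path))) (by fun_prop)

lemma measurable_hitTerm (n : ℕ) (x : ℤ) : Measurable (hitTerm w n x) := by
  induction n generalizing x with
  | zero =>
    have : hitTerm w 0 x = fun _ => if x = 0 then 1 else 0 := rfl
    rw [this]; exact measurable_const
  | succ n ih =>
    have : hitTerm w (n + 1) x = fun ω => if x = 0 then 0 else
      ENNReal.ofReal (Real.exp (w x * (ω 0).1)) * hitTerm w n (x + (ω 0).2) (tailPath ω) := rfl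
    rw [this]
    split_ifs
    · exact measurable_const
    · refine Measurable.mul (by fun_prop) ?_
      have h1 : Measurable fun y : ℤ × Path => hitTerm w n y.1 y.2 :=
        measurable_from_prod_countable_right fun z => ih z
      exact h1.comp (f := fun ω : Path => ((x + (ω 0).2, tailPath ω) : ℤ × Path)) (by fun_prop)

/-- Conditioning on the first step: the factor `exp(-κτ)` of the holding density is absorbed into
the potential `ξ - κ`, and `κ` times the jump probabilities gives the rates. -/
lemma lintegral_pathTerm (hκ : 0 < κ) (h1 : -1 ≤ h) (h2 : h ≤ 1) (n : ℕ) (x : ℤ) (t : ℝ) :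
    ∫⁻ ω, pathTerm ξ f n x t ω ∂(walkLaw κ h) =
      jumpKernel (ENNReal.ofReal (κ * (1 + h) / 2)) (ENNReal.ofReal (κ * (1 - h) / 2))
        (fun x => ξ x - κ) f n x t := by
  have i4 := isProbabilityMeasure_walkLaw hκ h1 h2
  have hr : ENNReal.ofReal (κ * (1 + h) / 2) + ENNReal.ofReal (κ * (1 - h) / 2) =
      ENNReal.ofReal κ := by
    rw [← ENNReal.ofReal_add (by nlinarith) (by nlinarith)]; congr 1; ring
  have hm : ∀ n x t, Measurable (pathTerm ξ f n x t) := fun n x t =>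
    (measurable_pathTerm n x).comp (by fun_prop : Measurable fun ω : Path => (t, ω))
  induction n generalizing x t with
  | zero =>
    rw [lintegral_walkLaw hκ h1 h2 (hm 0 x t)]
    have e0 : ∀ τ s ω, pathTerm ξ f 0 x t (consPath (τ, s) ω) =
        if 0 ≤ t ∧ t < τ then f x * ENNReal.ofReal (Real.exp (ξ x * t)) else 0 := fun _ _ _ => rfl
    simp only [e0, lintegral_const, measure_univ, mul_one]
    simp only [← add_mul, hr]
    rcases lt_or_ge t 0 with ht | ht
    · have : ¬ 0 ≤ t := not_le.2 ht
      simp [jumpKernel, expKernel_of_neg _ ht, this]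
    · have e1 : ∀ τ, expKernel (-κ) τ * (ENNReal.ofReal κ *
          if 0 ≤ t ∧ t < τ then f x * ENNReal.ofReal (Real.exp (ξ x * t)) else 0) =
          f x * ENNReal.ofReal (Real.exp (ξ x * t)) * ENNReal.ofReal κ *
            (Set.Ioi t).indicator (fun τ => expKernel (-κ) τ) τ := fun τ => by
        by_cases h : t < τ
        · rw [if_pos ⟨ht, h⟩, Set.indicator_of_mem (show τ ∈ Set.Ioi t from h)]; ring
        · rw [if_neg (fun hh => h hh.2), Set.indicator_of_notMem (show τ ∉ Set.Ioi t from h)]; simp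
      simp only [e1]
      rw [lintegral_const_mul _ ((measurable_expKernel _).indicator measurableSet_Ioi),
        lintegral_indicator measurableSet_Ioi]
      have e2 : ∫⁻ τ in Set.Ioi t, expKernel (-κ) τ =
          ENNReal.ofReal (Real.exp (-κ * t) / κ) := by
        rw [setLIntegral_congr_fun measurableSet_Ioi (g := fun τ => ENNReal.ofReal
          (Real.exp (-κ * τ))) fun τ hτ => expKernel_of_nonneg _ (ht.trans (le_of_lt hτ)),
          ← ofReal_integral_eq_lintegral_ofReal (integrableOn_exp_mul_Ioi (by linarith) t)
            (ae_of_all _ fun t => (Real.exp_pos _).le), integral_exp_mul_Ioi (by linarith) t]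
        congr 1; field_simp
      simp only [jumpKernel]
      rw [e2, expKernel_of_nonneg _ ht, mul_assoc, mul_assoc,
        ← ENNReal.ofReal_mul hκ.le, ← ENNReal.ofReal_mul (Real.exp_pos _).le]
      congr 2
      rw [mul_div_cancel₀ _ hκ.ne', ← Real.exp_add]
      congr 1; ring
  | succ n ih =>
    rw [lintegral_walkLaw hκ h1 h2 (hm (n + 1) x t), jumpKernel, lconvolution_def]
    refine lintegral_congr fun τ => ?_
    simp only [pathTerm, consPath_zero, tailPath_consPath]
    rcases lt_or_ge t τ with hτ | hτ
    · rw [jumpKernel_of_neg (by linarith), jumpKernel_of_neg (by linarith)]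
      simp [not_le.2 hτ]
    · simp only [hτ, if_true]
      rw [lintegral_const_mul _ (hm _ _ _), lintegral_const_mul _ (hm _ _ _), ih, ih]
      rcases lt_or_ge τ 0 with h0 | h0
      · simp [expKernel_of_neg _ h0]
      · have e3 : expKernel (ξ x - κ) τ = expKernel (-κ) τ *
            ENNReal.ofReal (Real.exp (ξ x * τ)) := by
          rw [expKernel_of_nonneg _ h0, expKernel_of_nonneg _ h0,
            ← ENNReal.ofReal_mul (Real.exp_pos _).le, ← Real.exp_add]
          congr 2; ring
        rw [e3, show t - τ = -τ + t by ring, ← sub_eq_add_neg]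
        ring

lemma lintegral_hitTerm (hκ : 0 < κ) (h1 : -1 ≤ h) (h2 : h ≤ 1) (n : ℕ) (x : ℤ) :
    ∫⁻ ω, hitTerm w n x ω ∂(walkLaw κ h) =
      hitSum (ENNReal.ofReal (κ * (1 - h) / 2)) (ENNReal.ofReal (κ * (1 + h) / 2))
        (fun x => ENNReal.ofReal (κ - w x)) n x := by
  have i4 := isProbabilityMeasure_walkLaw hκ h1 h2
  induction n generalizing x with
  | zero => simp [hitTerm, hitSum]
  | succ n ih =>
    rw [lintegral_walkLaw hκ h1 h2 (measurable_hitTerm (n + 1) x), hitSum]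
    simp only [hitTerm, consPath_zero, tailPath_consPath]
    by_cases hx : x = 0
    · simp [hx]
    · simp only [hx, if_false]
      simp only [lintegral_const_mul _ (measurable_hitTerm _ _), ih]
      rw [show κ - w x = -(-κ) - w x by ring, ← laplace_expKernel,
        ← lintegral_mul_const _ (by fun_prop)]
      refine lintegral_congr fun τ => ?_
      rw [← sub_eq_add_neg]
      ring

/-- Along a regular path, only one of the terms is non-zero. -/
lemma IsRegular.pathTerm_eq {ω : Path} (hω : IsRegular ω) (n k : ℕ) (x : ℤ) {t : ℝ} (h0 : 0 ≤ t)
    (hn : jumpTime ω n ≤ t ∧ t < jumpTime ω (n + 1)) :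
    pathTerm ξ f k x t ω = if k = n then f (position x ω t) *
      ENNReal.ofReal (Real.exp (∫ s in (0 : ℝ)..t, ξ (position x ω s))) else 0 := by
  induction n generalizing x t ω k with
  | zero =>
    have h1 : t < (ω 0).1 := by simpa [jumpTime] using hn.2
    rcases k with _ | k
    · rw [pathTerm, if_pos ⟨h0, h1⟩, if_pos rfl, position_of_lt x h1,
        (integral_of_lt ξ x h0 h1).2]
    · rw [pathTerm, if_neg (not_le.2 h1), if_neg (by omega)]
  | succ n ih =>
    rw [jumpTime_succ, jumpTime_succ] at hn
    have h1 : 0 ≤ jumpTime (tailPath ω) n := by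
      rw [← jumpTime_zero (tailPath ω)]; exact hω.tail.jumpTime_mono.monotone (Nat.zero_le n)
    have h2 : (ω 0).1 ≤ t := by linarith [hn.1]
    rcases k with _ | k
    · rw [pathTerm, if_neg (fun hh => by linarith [hh.2]), if_neg (by omega)]
    · rw [pathTerm, if_pos h2, ih hω.tail k _ (by linarith)
        ⟨by linarith [hn.1], by linarith [hn.2]⟩]
      by_cases hk : k = n
      · rw [if_pos hk, if_pos (by omega), hω.position_of_ge x h2, (hω.integral_step ξ x h2
          (hω.tail.intervalIntegrable ξ _ (by linarith))).2, Real.exp_add,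
          ENNReal.ofReal_mul (Real.exp_pos _).le]
        ring
      · rw [if_neg hk, if_neg (by omega), mul_zero]

lemma IsRegular.tsum_pathTerm {ω : Path} (hω : IsRegular ω) (x : ℤ) {t : ℝ} (h0 : 0 ≤ t) :
    ∑' n, pathTerm ξ f n x t ω = f (position x ω t) *
      ENNReal.ofReal (Real.exp (∫ s in (0 : ℝ)..t, ξ (position x ω s))) := by
  obtain ⟨n, hn⟩ := hω.exists_jumpTime h0
  simp only [hω.pathTerm_eq n _ x h0 hn]
  exact tsum_ite_eq n _

/-- The Feynman-Kac formula. -/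
lemma lintegral_feynmanKac (hκ : 0 < κ) (h1 : -1 ≤ h) (h2 : h ≤ 1) (x : ℤ) {t : ℝ} (h0 : 0 ≤ t) :
    ∫⁻ ω, f (position x ω t) *
      ENNReal.ofReal (Real.exp (∫ s in (0 : ℝ)..t, ξ (position x ω s))) ∂(walkLaw κ h) =
      kernel (ENNReal.ofReal (κ * (1 + h) / 2)) (ENNReal.ofReal (κ * (1 - h) / 2))
        (fun x => ξ x - κ) f x t := by
  simp only [kernel, ← lintegral_pathTerm hκ h1 h2]
  have hm : ∀ n, Measurable (pathTerm ξ f n x t) := fun n =>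
    (measurable_pathTerm n x).comp (by fun_prop : Measurable fun ω : Path => (t, ω))
  rw [← lintegral_tsum (fun n => (hm n).aemeasurable)]
  refine lintegral_congr_ae ?_
  filter_upwards [ae_isRegular hκ h1 h2] with ω hω
  rw [hω.tsum_pathTerm x h0]

lemma aemeasurable_position (hκ : 0 < κ) (h1 : -1 ≤ h) (h2 : h ≤ 1) (f : ℤ → ℝ≥0∞) (x : ℤ)
    {t : ℝ} (h0 : 0 ≤ t) : AEMeasurable (fun ω => f (position x ω t)) (walkLaw κ h) := by
  refine ⟨fun ω => ∑' n, pathTerm 0 f n x t ω, Measurable.tsum fun n =>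
    (measurable_pathTerm n x).comp (by fun_prop : Measurable fun ω : Path => (t, ω)), ?_⟩
  filter_upwards [ae_isRegular hκ h1 h2] with ω hω
  rw [hω.tsum_pathTerm x h0]
  simp

open Classical in
lemma speedMass_eq_kernel (hκ : 0 < κ) (h1 : -1 ≤ h) (h2 : h ≤ 1) (ξ : ℤ → ℝ) {t : ℝ} (h0 : 0 ≤ t)
    (A : Set ℝ) : speedMass κ h ξ t A =
      kernel (ENNReal.ofReal (κ * (1 + h) / 2)) (ENNReal.ofReal (κ * (1 - h) / 2))
        (fun x => ξ x - κ) (fun y => if (y : ℝ) / t ∈ A then 1 else 0) 0 t := by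
  rw [← lintegral_feynmanKac hκ h1 h2 0 h0, speedMass]
  -- The position is identified with a measurable function only on regular paths, hence null
  -- measurability.
  have hns : NullMeasurableSet {ω | (position 0 ω t : ℝ) / t ∈ A} (walkLaw κ h) := by
    have := aemeasurable_position hκ h1 h2 (fun y => if (y : ℝ) / t ∈ A then 1 else 0) 0 h0
    have h3 := this.nullMeasurable (measurableSet_singleton 1)
    convert h3 using 1
    ext ω
    by_cases h : (position 0 ω t : ℝ) / t ∈ A <;> simp [h]
  rw [← lintegral_indicator₀ hns]
  refine lintegral_congr fun ω => ?_
  by_cases h : (position 0 ω t : ℝ) / t ∈ A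
  · rw [Set.indicator_of_mem (show ω ∈ {ω | (position 0 ω t : ℝ) / t ∈ A} from h), if_pos h,
      one_mul]
  · rw [Set.indicator_of_notMem (show ω ∉ {ω | (position 0 ω t : ℝ) / t ∈ A} from h), if_neg h,
      zero_mul]

/-! ### Hitting times -/

/-- `0` is hit for the first time at the `n`-th jump. -/
def HitsAt : ℕ → ℤ → Path → Prop
  | 0, x, _ => x = 0
  | n + 1, x, ω => x ≠ 0 ∧ HitsAt n (x + (ω 0).2) (tailPath ω)

lemma IsRegular.isLeast_of_hitsAt {ω : Path} (hω : IsRegular ω) (n : ℕ) (x : ℤ)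
    (hn : HitsAt n x ω) : IsLeast {s : ℝ | 0 ≤ s ∧ position x ω s = 0} (jumpTime ω n) := by
  induction n generalizing x ω with
  | zero =>
    have hx : x = 0 := hn
    subst hx
    rw [jumpTime_zero]
    exact ⟨⟨le_rfl, position_of_lt 0 (hω.1 0)⟩, fun s hs => hs.1⟩
  | succ n ih =>
    obtain ⟨hx, hn⟩ := hn
    have h3 := ih hω.tail _ hn
    rw [jumpTime_succ]
    have h0 := hω.1 0
    refine ⟨⟨by linarith [h3.1.1], ?_⟩, fun s hs => ?_⟩
    · rw [hω.position_of_ge x (by linarith [h3.1.1]), add_sub_cancel_left]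
      exact h3.1.2
    · rcases lt_or_ge s (ω 0).1 with h | h
      · exact absurd ((position_of_lt x h).symm.trans hs.2) hx
      · have h4 := h3.2 ⟨(by linarith : 0 ≤ s - (ω 0).1), by rw [← hω.position_of_ge x h]; exact hs.2⟩
        linarith

lemma IsRegular.hittingTime_eq {ω : Path} (hω : IsRegular ω) {n : ℕ} {x : ℤ}
    (hn : HitsAt n x ω) : hittingTime x 0 ω = jumpTime ω n :=
  (hω.isLeast_of_hitsAt n x hn).csInf_eq

lemma IsRegular.hitTerm_eq {ω : Path} (hω : IsRegular ω) (n k : ℕ) (x : ℤ) (hn : HitsAt n x ω) :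
    hitTerm w k x ω = if k = n then
      ENNReal.ofReal (Real.exp (∫ s in (0 : ℝ)..jumpTime ω n, w (position x ω s))) else 0 := by
  induction n generalizing x ω k with
  | zero =>
    have hx : x = 0 := hn
    subst hx
    rcases k with _ | k
    · simp [hitTerm, jumpTime_zero]
    · simp [hitTerm]
  | succ n ih =>
    obtain ⟨hx, hn⟩ := hn
    rcases k with _ | k
    · simp [hitTerm, hx]
    · have h1 : 0 ≤ jumpTime (tailPath ω) n := by
        rw [← jumpTime_zero (tailPath ω)]; exact hω.tail.jumpTime_mono.monotone (Nat.zero_le n)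
      rw [hitTerm, if_neg hx, ih hω.tail k _ hn]
      by_cases hk : k = n
      · rw [if_pos hk, if_pos (by omega), jumpTime_succ, (hω.integral_step w x (by linarith)
          (hω.tail.intervalIntegrable w _ (by linarith))).2, Real.exp_add,
          ENNReal.ofReal_mul (Real.exp_pos _).le, add_sub_cancel_left]
      · rw [if_neg hk, if_neg (by omega), mul_zero]

lemma IsRegular.tsum_hitTerm {ω : Path} (hω : IsRegular ω) {n : ℕ} {x : ℤ} (hn : HitsAt n x ω) :
    ∑' k, hitTerm w k x ω =
      ENNReal.ofReal (Real.exp (∫ s in (0 : ℝ)..hittingTime x 0 ω, w (position x ω s))) := by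
  simp only [hω.hitTerm_eq n _ x hn, hω.hittingTime_eq hn]
  exact tsum_ite_eq n _

lemma hitTerm_eq_zero {ω : Path} {n : ℕ} {x : ℤ} (hn : ¬ HitsAt n x ω) : hitTerm w n x ω = 0 := by
  induction n generalizing x ω with
  | zero => exact if_neg hn
  | succ n ih =>
    by_cases hx : x = 0
    · exact if_pos hx
    · rw [hitTerm, if_neg hx, ih (fun h => hn ⟨hx, h⟩), mul_zero]

/-- The walk with drift to the left hits `0` from `1`. -/
lemma hitTotal_const (hκ : 0 < κ) (h1 : 0 < h) (h2 : h ≤ 1) :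
    hitTotal (ENNReal.ofReal (κ * (1 + h) / 2)) (ENNReal.ofReal (κ * (1 - h) / 2))
      (fun _ => ENNReal.ofReal κ) 1 = 1 := by
  set q := κ * (1 + h) / 2 with hq
  set p := κ * (1 - h) / 2 with hp
  have hq0 : 0 < q := by positivity
  have hp0 : 0 ≤ p := by rw [hp]; have := sub_nonneg.2 h2; positivity
  have hqp : q + p = κ := by rw [hq, hp]; ring
  have hlt : p < q := by rw [hq, hp]; nlinarith
  set S := hitTotal (ENNReal.ofReal q) (ENNReal.ofReal p) (fun _ => ENNReal.ofReal κ) 1 with hS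
  have hκ0 : ENNReal.ofReal κ ≠ 0 := by simpa using hκ
  have hle : S ≤ 1 := by
    have := hitTotal_mul_le (q := ENNReal.ofReal q) (p := ENNReal.ofReal p)
      (a := fun _ => ENNReal.ofReal κ) (V := fun _ => 1) (c := 1) le_rfl (fun x _ => ?_)
      zero_le_one
    · simpa using this
    · rw [mul_one, mul_one, ← ENNReal.ofReal_add hq0.le hp0, hqp,
        ENNReal.inv_mul_cancel hκ0 ENNReal.ofReal_ne_top]
  have hfin : S ≠ ⊤ := ne_top_of_le_ne_top ENNReal.one_ne_top hle
  have heq := hitTotal_one_eq (q := ENNReal.ofReal q) (p := ENNReal.ofReal p)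
      (a := fun _ => ENNReal.ofReal κ)
  rw [← hS] at heq
  have heq2 : κ * S.toReal = q + p * (S.toReal * S.toReal) := by
    have h3 : ENNReal.ofReal κ * S =
        ENNReal.ofReal q + ENNReal.ofReal p * (S * S) := by
      conv_lhs => rw [heq]
      rw [← mul_assoc, ENNReal.mul_inv_cancel hκ0 ENNReal.ofReal_ne_top, one_mul]
    have h4 := congrArg ENNReal.toReal h3
    rw [ENNReal.toReal_mul, ENNReal.toReal_ofReal hκ.le, ENNReal.toReal_add (by simp)
      (by finiteness), ENNReal.toReal_mul, ENNReal.toReal_mul, ENNReal.toReal_ofReal hq0.le,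
      ENNReal.toReal_ofReal hp0] at h4
    exact h4
  have hle' : S.toReal ≤ 1 := by
    have := ENNReal.toReal_mono ENNReal.one_ne_top hle
    simpa using this
  -- The quadratic equation for the hitting probability factorizes; since `p < q` and `S ≤ 1`, the
  -- second factor cannot vanish.
  have hfac : (S.toReal - 1) * (p * S.toReal - q) = 0 := by
    rw [← hqp] at heq2; linarith
  have hone : S.toReal = 1 := by
    rcases mul_eq_zero.1 hfac with h | h
    · linarith
    · nlinarith
  rw [← ENNReal.ofReal_toReal hfin, hone, ENNReal.ofReal_one]

/-- For zero potential the hitting terms sum to the indicator of hitting `0`. It is at most `1` with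
mean `1` by `hitTotal_const`, hence equal to `1` almost surely. -/
lemma ae_exists_hitsAt (hκ : 0 < κ) (h1 : 0 < h) (h2 : h ≤ 1) :
    ∀ᵐ ω ∂(walkLaw κ (-h)), ∃ n, HitsAt n 1 ω := by
  have i4 := isProbabilityMeasure_walkLaw hκ (by linarith : -1 ≤ -h) (by linarith : -h ≤ 1)
  have hreg := ae_isRegular hκ (by linarith : -1 ≤ -h) (by linarith : -h ≤ 1)
  have hint : ∫⁻ ω, ∑' n, hitTerm 0 n 1 ω ∂(walkLaw κ (-h)) = 1 := by
    rw [lintegral_tsum fun n => (measurable_hitTerm n 1).aemeasurable]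
    simp only [lintegral_hitTerm hκ (by linarith : -1 ≤ -h) (by linarith : -h ≤ 1)]
    have := hitTotal_const hκ h1 h2
    simpa [hitTotal, ← sub_eq_add_neg] using this
  have hle : (fun ω => ∑' n, hitTerm 0 n 1 ω) ≤ᵐ[walkLaw κ (-h)] fun _ => 1 := by
    filter_upwards [hreg] with ω hω
    by_cases hex : ∃ n, HitsAt n 1 ω
    · obtain ⟨n, hn⟩ := hex
      simp [hω.tsum_hitTerm hn]
    · have : ∀ n, hitTerm 0 n 1 ω = 0 := fun n => hitTerm_eq_zero fun h => hex ⟨n, h⟩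
      simp [this]
  have := ae_eq_of_ae_le_of_lintegral_le hle (by rw [hint]; simp) aemeasurable_const
    (by rw [hint]; simp)
  filter_upwards [this] with ω hω
  by_contra hex
  have h0 : ∀ n, hitTerm 0 n 1 ω = 0 := fun n => hitTerm_eq_zero fun h => hex ⟨n, h⟩
  simp [h0] at hω

lemma ae_tsum_hitTerm (hκ : 0 < κ) (h1 : 0 < h) (h2 : h ≤ 1) (w : ℤ → ℝ) :
    ∀ᵐ ω ∂(walkLaw κ (-h)), ∑' k, hitTerm w k 1 ω =
      ENNReal.ofReal (Real.exp (∫ s in (0 : ℝ)..hittingTime 1 0 ω, w (position 1 ω s))) := by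
  filter_upwards [ae_exists_hitsAt hκ h1 h2,
    ae_isRegular hκ (by linarith : -1 ≤ -h) (by linarith : -h ≤ 1)] with ω ⟨n, hn⟩ hω
  exact hω.tsum_hitTerm hn

lemma hittingMGF_eq_hitTotal (hκ : 0 < κ) (h1 : 0 < h) (h2 : h ≤ 1) (ξ : ℤ → ℝ) (β : ℝ) :
    hittingMGF κ h ξ β = hitTotal (ENNReal.ofReal (κ * (1 + h) / 2))
      (ENNReal.ofReal (κ * (1 - h) / 2)) (fun x => ENNReal.ofReal (κ - ξ x - β)) 1 := by
  rw [hittingMGF, hitTotal]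
  have e1 : ∀ n, hitSum (ENNReal.ofReal (κ * (1 + h) / 2)) (ENNReal.ofReal (κ * (1 - h) / 2))
      (fun x => ENNReal.ofReal (κ - ξ x - β)) n 1 =
      ∫⁻ ω, hitTerm (fun x => ξ x + β) n 1 ω ∂(walkLaw κ (-h)) := fun n => by
    rw [lintegral_hitTerm hκ (by linarith) (by linarith)]
    simp only [← sub_eq_add_neg, sub_neg_eq_add, sub_add_eq_sub_sub]
  simp only [e1]
  rw [← lintegral_tsum fun n => (measurable_hitTerm n 1).aemeasurable]
  refine lintegral_congr_ae ?_
  filter_upwards [ae_tsum_hitTerm hκ h1 h2 fun x => ξ x + β] with ω hω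
  rw [hω, hittingWeight]

end PathTerm

end

end PAM

/-! ### The Cauchy problem: existence and uniqueness of bounded solutions. -/

namespace PAM

noncomputable section

/-! ### The parabolic Anderson equation -/

section Equation

variable {κ h : ℝ} {ξ : ℤ → ℝ}

/-- The weight of the trajectories of the walk with drift `h` to the right, started in `x`. -/
abbrev rightKernel (κ h : ℝ) (ξ : ℤ → ℝ) (f : ℤ → ℝ≥0∞) (x : ℤ) (t : ℝ) : ℝ≥0∞ :=
  kernel (ENNReal.ofReal (κ * (1 + h) / 2)) (ENNReal.ofReal (κ * (1 - h) / 2))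
    (fun x => ξ x - κ) f x t

lemma rightKernel_one_le (hκ : 0 < κ) (h1 : -1 ≤ h) (h2 : h ≤ 1) (hξ : ∀ x, ξ x ≤ 0) (x : ℤ)
    (t : ℝ) : rightKernel κ h ξ 1 x t ≤ 1 := by
  have h3 : 0 ≤ κ * (1 + h) / 2 := by nlinarith
  have h4 : 0 ≤ κ * (1 - h) / 2 := by nlinarith
  refine (kernel_le_exp_mul (ψ := fun _ => 1) (β := 0) (fun _ => le_rfl)
    (fun x => by linarith [hξ x]) (fun x => ?_) x t).trans ?_
  · rw [mul_one, mul_one, mul_one, ← ENNReal.ofReal_add h3 h4]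
    exact ENNReal.ofReal_le_ofReal (by linarith [hξ x])
  · rw [mul_one, expKernel]
    refine (Set.indicator_le_self _ _ _).trans ?_
    simp

/-- Duhamel's formula, with the exponential taken out of the integral so that the right-hand side
can be differentiated in `t`. -/
lemma toReal_rightKernel_eq (hκ : 0 < κ) (h1 : -1 ≤ h) (h2 : h ≤ 1) (hξ : ∀ x, ξ x ≤ 0)
    (x : ℤ) {t : ℝ} (ht : 0 ≤ t) : (rightKernel κ h ξ 1 x t).toReal =
      Real.exp ((ξ x - κ) * t) * (1 + ∫ s in (0 : ℝ)..t, Real.exp (-(ξ x - κ) * s) *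
        (κ * (1 + h) / 2 * (rightKernel κ h ξ 1 (x + 1) s).toReal +
          κ * (1 - h) / 2 * (rightKernel κ h ξ 1 (x - 1) s).toReal)) := by
  have h3 : 0 ≤ κ * (1 + h) / 2 := by nlinarith
  have h4 : 0 ≤ κ * (1 - h) / 2 := by nlinarith
  have hle := fun x t => rightKernel_one_le hκ h1 h2 hξ x t
  have hfin : ∀ x t, rightKernel κ h ξ 1 x t ≠ ⊤ := fun x t =>
    ne_top_of_le_ne_top ENNReal.one_ne_top (hle x t)
  have hmeas : ∀ x, Measurable fun t => rightKernel κ h ξ 1 x t := fun x => measurable_kernel _ _ _ _ x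
  have hmeasR : ∀ x, Measurable fun t => (rightKernel κ h ξ 1 x t).toReal := fun x =>
    (hmeas x).ennreal_toReal
  set v := ξ x - κ with hv
  set g : ℝ → ℝ := fun s => κ * (1 + h) / 2 * (rightKernel κ h ξ 1 (x + 1) s).toReal +
          κ * (1 - h) / 2 * (rightKernel κ h ξ 1 (x - 1) s).toReal with hg
  have hg0 : ∀ s, 0 ≤ g s := fun s => by positivity
  have hgm : Measurable g := by
    exact ((hmeasR _).const_mul _).add ((hmeasR _).const_mul _)
  have hgE : ∀ s, ENNReal.ofReal (κ * (1 + h) / 2) * rightKernel κ h ξ 1 (x + 1) s +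
      ENNReal.ofReal (κ * (1 - h) / 2) * rightKernel κ h ξ 1 (x - 1) s = ENNReal.ofReal (g s) :=
    fun s => by
      rw [hg, ENNReal.ofReal_add (by positivity) (by positivity), ENNReal.ofReal_mul h3,
        ENNReal.ofReal_mul h4, ENNReal.ofReal_toReal (hfin _ _), ENNReal.ofReal_toReal (hfin _ _)]
  have hneg : ∀ s < 0, g s = 0 := fun s hs => by
    simp [hg, rightKernel, kernel_of_neg hs]
  have key : rightKernel κ h ξ 1 x t = ENNReal.ofReal (Real.exp (v * t)) +
      ∫⁻ s in Set.Icc 0 t, ENNReal.ofReal (Real.exp (v * t) * (Real.exp (-v * s) * g s)) := by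
    rw [rightKernel, kernel_eq]
    simp only [hgE]
    rw [expKernel_of_nonneg _ ht, Pi.one_apply, one_mul, lconvolution_comm, lconvolution_def,
      ← lintegral_indicator measurableSet_Icc]
    congr 1
    refine lintegral_congr fun s => ?_
    by_cases hs : s ∈ Set.Icc 0 t
    · rw [Set.indicator_of_mem hs, expKernel_of_nonneg _ (by linarith [hs.2]), mul_comm,
        ← ENNReal.ofReal_mul (Real.exp_pos _).le, ← mul_assoc, ← Real.exp_add]
      congr 3; ring
    · rw [Set.indicator_of_notMem hs]
      rcases lt_or_ge s 0 with h | h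
      · simp [hneg s h]
      · have : t < s := by by_contra hh; exact hs ⟨h, not_lt.1 hh⟩
        rw [expKernel_of_neg _ (by linarith), mul_zero]
  have hfin2 : ∫⁻ s in Set.Icc 0 t,
      ENNReal.ofReal (Real.exp (v * t) * (Real.exp (-v * s) * g s)) ≠ ⊤ := fun h => by
    rw [h] at key; exact hfin x t (by rw [key]; simp)
  rw [key, ENNReal.toReal_add ENNReal.ofReal_ne_top hfin2, ENNReal.toReal_ofReal (Real.exp_pos _).le,
    mul_add, mul_one]
  congr 1
  rw [intervalIntegral.integral_of_le ht, ← integral_Icc_eq_integral_Ioc, ← integral_const_mul,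
    integral_eq_lintegral_of_nonneg_ae]
  · exact ae_of_all _ fun s => by have := hg0 s; positivity
  · exact (by fun_prop : Measurable fun s => Real.exp (v * t) *
      (Real.exp (-v * s) * g s)).aestronglyMeasurable

lemma isSolution_rightKernel (hκ : 0 < κ) (h1 : -1 ≤ h) (h2 : h ≤ 1) (hξ : ∀ x, ξ x ≤ 0) :
    IsSolution κ h ξ fun t x => (rightKernel κ h ξ 1 x t).toReal := by
  have h3 : 0 ≤ κ * (1 + h) / 2 := by nlinarith
  have h4 : 0 ≤ κ * (1 - h) / 2 := by nlinarith
  set K : ℤ → ℝ → ℝ := fun x t => (rightKernel κ h ξ 1 x t).toReal with hK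
  have hmeasR : ∀ x, Measurable (K x) := fun x => (measurable_kernel _ _ _ _ x).ennreal_toReal
  have hle : ∀ x t, K x t ≤ 1 := fun x t => by
    have := ENNReal.toReal_mono ENNReal.one_ne_top (rightKernel_one_le hκ h1 h2 hξ x t)
    simpa using this
  have hnn : ∀ x t, 0 ≤ K x t := fun x t => ENNReal.toReal_nonneg
  set g : ℤ → ℝ → ℝ := fun x s => κ * (1 + h) / 2 * K (x + 1) s + κ * (1 - h) / 2 * K (x - 1) s
    with hg
  have hint : ∀ x a b, IntervalIntegrable (fun s => Real.exp (-(ξ x - κ) * s) * g x s)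
      volume a b := fun x a b => by
    refine IntervalIntegrable.continuousOn_mul (f := g x) ?_
      (by fun_prop : Continuous fun s => Real.exp (-(ξ x - κ) * s)).continuousOn
    refine (intervalIntegrable_const (c := κ)).mono_fun ?_ ?_
    · exact (((hmeasR _).const_mul _).add ((hmeasR _).const_mul _)).aestronglyMeasurable
    · refine ae_of_all _ fun s => ?_
      have e1 := mul_le_mul_of_nonneg_left (hle (x + 1) s) h3
      have e2 := mul_le_mul_of_nonneg_left (hle (x - 1) s) h4
      have e3 := mul_nonneg h3 (hnn (x + 1) s)
      have e4 := mul_nonneg h4 (hnn (x - 1) s)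
      change |g x s| ≤ |κ|
      rw [abs_of_pos hκ, abs_of_nonneg (add_nonneg e3 e4)]
      linarith
  -- One pass through the integral equation makes the bounded measurable `K` continuous in time; a
  -- second pass makes it differentiable.
  set K' : ℤ → ℝ → ℝ := fun x t => Real.exp ((ξ x - κ) * t) *
    (1 + ∫ s in (0 : ℝ)..t, Real.exp (-(ξ x - κ) * s) * g x s) with hK'
  have hKK' : ∀ x t, 0 ≤ t → K x t = K' x t := fun x t ht =>
    toReal_rightKernel_eq hκ h1 h2 hξ x ht
  have hcont : ∀ x, Continuous (K' x) := fun x => by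
    have := intervalIntegral.continuous_primitive (hint x) 0
    simp only [hK']
    fun_prop
  set g' : ℤ → ℝ → ℝ := fun x s => κ * (1 + h) / 2 * K' (x + 1) s + κ * (1 - h) / 2 * K' (x - 1) s
    with hg'
  have hcontg : ∀ x, Continuous (g' x) := fun x => by
    have := hcont (x + 1); have := hcont (x - 1)
    simp only [hg']; fun_prop
  have heq : ∀ x t, 0 ≤ t → K x t = Real.exp ((ξ x - κ) * t) *
      (1 + ∫ s in (0 : ℝ)..t, Real.exp (-(ξ x - κ) * s) * g' x s) := fun x t ht => by
    rw [hKK' x t ht]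
    change Real.exp _ * (1 + _) = _
    congr 2
    refine intervalIntegral.integral_congr fun s hs => ?_
    rw [Set.uIcc_of_le ht] at hs
    simp only [hg, hg', hKK' _ s hs.1]
  refine ⟨fun x => ?_, fun t ht x => ?_, fun t _ x => hnn x t, 1, fun t _ x => hle x t⟩
  · change K x 0 = 1
    rw [heq x 0 le_rfl]; simp
  · have hd : HasDerivAt (fun t => Real.exp ((ξ x - κ) * t) *
        (1 + ∫ s in (0 : ℝ)..t, Real.exp (-(ξ x - κ) * s) * g' x s))
        (Real.exp ((ξ x - κ) * t) * ((ξ x - κ) * 1) *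
          (1 + ∫ s in (0 : ℝ)..t, Real.exp (-(ξ x - κ) * s) * g' x s) +
          Real.exp ((ξ x - κ) * t) * (Real.exp (-(ξ x - κ) * t) * g' x t)) t := by
      have hc : Continuous fun s => Real.exp (-(ξ x - κ) * s) * g' x s := by
        have := hcontg x; fun_prop
      refine (((hasDerivAt_id' t).const_mul (ξ x - κ)).exp).mul ?_
      exact (hc.integral_hasStrictDerivAt 0 t).hasDerivAt.const_add 1
    have hd2 : HasDerivWithinAt (fun s => K x s) _ (Set.Ici 0) t :=
      hd.hasDerivWithinAt.congr (fun s hs => heq x s hs) (heq x t ht)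
    refine hd2.congr_deriv ?_
    have e1 : Real.exp ((ξ x - κ) * t) * (Real.exp (-(ξ x - κ) * t) * g' x t) = g' x t := by
      rw [← mul_assoc, ← Real.exp_add, neg_mul, add_neg_cancel, Real.exp_zero, one_mul]
    rw [e1, mul_comm (Real.exp _) _, mul_assoc, ← heq x t ht]
    simp only [hg', driftLaplacian, ← hKK' _ t ht]
    change _ = κ * ((1 + h) / 2 * (K (x + 1) t - K x t) + (1 - h) / 2 * (K (x - 1) t - K x t)) +
      ξ x * K x t
    ring

/-- Picard iteration: the difference is at most `C(κt)^n / n!` for every `n`. Conjugation by `exp((ξ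
x - κ)t)` removes the diagonal term, so the potential may be unbounded below. -/
lemma IsSolution.eq {u w : ℝ → ℤ → ℝ} (hκ : 0 < κ) (h1 : -1 ≤ h) (h2 : h ≤ 1)
    (hξ : ∀ x, ξ x ≤ 0) (hu : IsSolution κ h ξ u) (hw : IsSolution κ h ξ w) {t : ℝ} (ht : 0 ≤ t)
    (x : ℤ) : u t x = w t x := by
  have h3 : 0 ≤ (1 + h) / 2 := by linarith
  have h4 : 0 ≤ (1 - h) / 2 := by linarith
  obtain ⟨C1, hC1⟩ := hu.bounded
  obtain ⟨C2, hC2⟩ := hw.bounded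
  set d : ℤ → ℝ → ℝ := fun x t => u t x - w t x with hd
  set C := max C1 C2 with hC
  have hC0 : 0 ≤ C := (hu.nonneg 0 le_rfl 0).trans ((hC1 0 le_rfl 0).trans (le_max_left _ _))
  have key : ∀ n : ℕ, ∀ t, 0 ≤ t → ∀ x, |d x t| ≤ C * (κ * t) ^ n / n.factorial := by
    intro n
    induction n with
    | zero =>
      intro t ht x
      have e1 := hu.nonneg t ht x
      have e2 := hw.nonneg t ht x
      have e3 := (hC1 t ht x).trans (le_max_left C1 C2)
      have e4 := (hC2 t ht x).trans (le_max_right C1 C2)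
      simp only [pow_zero, mul_one, Nat.factorial_zero, Nat.cast_one, div_one]
      rw [abs_le]; constructor <;> simp only [hd] <;> linarith
    | succ n ih =>
      intro t ht x
      set v := ξ x - κ with hv
      have hv0 : v ≤ 0 := by linarith [hξ x]
      have hder : ∀ s, 0 ≤ s → HasDerivWithinAt (fun s => Real.exp (-v * s) * d x s)
          (Real.exp (-v * s) * (κ * ((1 + h) / 2 * d (x + 1) s + (1 - h) / 2 * d (x - 1) s)))
          (Set.Ici 0) s := fun s hs => by
        have e1 := (hu.eqn s hs x).sub (hw.eqn s hs x)
        have e2 := ((((hasDerivAt_id' s).const_mul (-v)).exp).hasDerivWithinAt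
          (s := Set.Ici 0)).mul e1
        refine e2.congr_deriv ?_
        simp only [hd, driftLaplacian, Pi.sub_apply, hv]
        ring
      have hB : ∀ s, HasDerivAt
          (fun s => Real.exp (-v * s) * (C * (κ * s) ^ (n + 1) / (n + 1).factorial))
          (Real.exp (-v * s) * (-v) * (C * (κ * s) ^ (n + 1) / (n + 1).factorial) +
            Real.exp (-v * s) * (κ * (C * (κ * s) ^ n / n.factorial))) s := fun s => by
        have e1 := ((hasDerivAt_id' s).const_mul (-v)).exp
        have e2 := (((((hasDerivAt_id' s).const_mul κ).pow (n + 1)).const_mul C).div_const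
          ((n + 1).factorial : ℝ))
        refine (e1.mul e2).congr_deriv ?_
        have : ((n + 1).factorial : ℝ) = (n + 1) * n.factorial := by
          push_cast [Nat.factorial_succ]; ring
        have h5 : (n.factorial : ℝ) ≠ 0 := by positivity
        have h6 : (n : ℝ) + 1 ≠ 0 := by positivity
        simp only [Nat.add_sub_cancel, this, Pi.pow_apply]
        push_cast
        field_simp
      have := image_norm_le_of_norm_deriv_right_le_deriv_boundary (a := 0) (b := t)
        (f := fun s => Real.exp (-v * s) * d x s)
        (fun s hs => ((hder s hs.1).continuousWithinAt).mono Set.Icc_subset_Ici_self)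
        (fun s hs => (hder s hs.1).mono (Set.Ici_subset_Ici.2 hs.1))
        (by simp [hd, hu.init, hw.init]) hB (fun s hs => ?_) (Set.right_mem_Icc.2 ht)
      · rw [norm_mul, Real.norm_eq_abs, Real.norm_eq_abs, abs_of_pos (Real.exp_pos _)] at this
        exact le_of_mul_le_mul_left this (Real.exp_pos _)
      · have hs0 : 0 ≤ κ * s := mul_nonneg hκ.le hs.1
        have e3 : |(1 + h) / 2 * d (x + 1) s + (1 - h) / 2 * d (x - 1) s| ≤
            C * (κ * s) ^ n / n.factorial := by
          have a1 := abs_le.1 (ih s hs.1 (x + 1))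
          have a2 := abs_le.1 (ih s hs.1 (x - 1))
          rw [abs_le]; constructor <;> nlinarith
        rw [norm_mul, norm_mul, Real.norm_eq_abs, Real.norm_eq_abs, Real.norm_eq_abs,
          abs_of_pos (Real.exp_pos _), abs_of_pos hκ]
        refine le_add_of_nonneg_of_le ?_ (by gcongr)
        have : 0 ≤ -v := by linarith
        positivity
  have hlim : Tendsto (fun n : ℕ => C * ((κ * t) ^ n / n.factorial)) atTop (𝓝 (C * 0)) :=
    (FloorSemiring.tendsto_pow_div_factorial_atTop (κ * t)).const_mul C
  rw [mul_zero] at hlim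
  have h0 : |d x t| ≤ 0 := ge_of_tendsto' hlim fun n => by
    have := key n t ht x
    rwa [mul_div_assoc] at this
  have := abs_nonpos_iff.1 h0
  simp only [hd] at this
  linarith

lemma IsSolution.eq_speedMass {u : ℝ → ℤ → ℝ} (hκ : 0 < κ) (h1 : -1 ≤ h) (h2 : h ≤ 1)
    (hξ : ∀ x, ξ x ≤ 0) (hu : IsSolution κ h ξ u) {t : ℝ} (ht : 0 ≤ t) :
    u t 0 = (speedMass κ h ξ t Set.univ).toReal := by
  rw [hu.eq hκ h1 h2 hξ (isSolution_rightKernel hκ h1 h2 hξ) ht, speedMass_eq_kernel hκ h1 h2 ξ ht]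
  simp only [Set.mem_univ, if_true]
  rfl

end Equation

end

end PAM

/-! ### Ergodic theory: linear bounds for Birkhoff sums, and ergodicity of product measures. -/

namespace PAM

noncomputable section

/-! ### One-sided ergodic theorems -/

section Ergodic

variable {α : Type*} {T : α → α} {f : α → ℝ}

/-- `max_{k ≤ n} ∑_{i < k} f ∘ T^i`. -/
def maxBirkhoff (T : α → α) (f : α → ℝ) : ℕ → α → ℝ
  | 0, _ => 0
  | n + 1, x => max 0 (f x + maxBirkhoff T f n (T x))

lemma maxBirkhoff_nonneg (n : ℕ) (x : α) : 0 ≤ maxBirkhoff T f n x := by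
  cases n with
  | zero => exact le_rfl
  | succ n => exact le_max_left _ _

lemma birkhoffSum_le_maxBirkhoff (n : ℕ) (x : α) : birkhoffSum T f n x ≤ maxBirkhoff T f n x := by
  induction n generalizing x with
  | zero => simp [maxBirkhoff]
  | succ n ih =>
    rw [birkhoffSum_succ', maxBirkhoff]
    exact le_max_of_le_right (add_le_add le_rfl (ih _))

lemma maxBirkhoff_mono (x : α) : Monotone fun n => maxBirkhoff T f n x := by
  refine monotone_nat_of_le_succ fun n => ?_
  induction n generalizing x with
  | zero => exact maxBirkhoff_nonneg 1 x
  | succ n ih =>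
    simp only [maxBirkhoff] at ih ⊢
    exact max_le_max le_rfl (add_le_add le_rfl (ih _))

lemma birkhoffSum_sub_const (c : ℝ) (n : ℕ) (x : α) :
    birkhoffSum T (fun y => f y - c) n x = birkhoffSum T f n x - c * n := by
  simp [birkhoffSum, Finset.sum_sub_distrib, mul_comm]

variable [MeasurableSpace α] {μ : Measure α}

lemma measurable_maxBirkhoff (hT : Measurable T) (hf : Measurable f) (n : ℕ) :
    Measurable (maxBirkhoff T f n) := by
  induction n with
  | zero => exact measurable_const
  | succ n ih => exact measurable_const.max (hf.add (ih.comp hT))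

lemma integrable_maxBirkhoff [IsFiniteMeasure μ] (hT : MeasurePreserving T μ μ)
    (hf : Integrable f μ) (n : ℕ) : Integrable (maxBirkhoff T f n) μ := by
  induction n with
  | zero => exact integrable_zero _ _ _
  | succ n ih =>
    have h1 : Integrable (fun x => f x + maxBirkhoff T f n (T x)) μ :=
      hf.add (hT.integrable_comp_of_integrable ih)
    exact (integrable_const (0 : ℝ)).sup h1

/-- Garsia's maximal argument. The set where the running maxima `M_n` are unbounded is invariant; if
it had full measure, the integrals of `M_{n+1} - M_n ∘ T`, which are non-negative, would converge to
the integral of `f`. -/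
lemma ae_bddAbove_birkhoffSum [IsProbabilityMeasure μ] (hT : Ergodic T μ) (hfm : Measurable f)
    (hf : Integrable f μ) (hneg : ∫ x, f x ∂μ < 0) :
    ∀ᵐ x ∂μ, ∃ C : ℝ, ∀ n, birkhoffSum T f n x ≤ C := by
  set A : Set α := {x | ∀ K : ℕ, ∃ n, (K : ℝ) < maxBirkhoff T f n x} with hA
  have hMm := measurable_maxBirkhoff hT.measurable hfm
  have hAm : MeasurableSet A := by
    have : A = ⋂ K : ℕ, ⋃ n : ℕ, {x | (K : ℝ) < maxBirkhoff T f n x} := by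
      ext x; simp [hA]
    rw [this]
    exact MeasurableSet.iInter fun K => MeasurableSet.iUnion fun n =>
      measurableSet_lt measurable_const (hMm n)
  have hAinv : T ⁻¹' A = A := by
    ext x
    simp only [Set.mem_preimage, hA, Set.mem_ofPred_eq]
    constructor
    · intro h K
      obtain ⟨k, hk⟩ := exists_nat_ge (K - f x)
      obtain ⟨n, hn⟩ := h k
      exact ⟨n + 1, lt_max_of_lt_right (by linarith)⟩
    · intro h K
      obtain ⟨k, hk⟩ := exists_nat_ge (max 0 (K + f x))
      obtain ⟨n, hn⟩ := h k
      refine ⟨n, ?_⟩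
      have h0 := le_max_left 0 (K + f x)
      have h1 := le_max_right 0 (K + f x)
      have h2 := hn.trans_le (maxBirkhoff_mono (T := T) (f := f) x n.le_succ)
      simp only [maxBirkhoff] at h2
      rcases lt_max_iff.1 h2 with h3 | h3 <;> linarith
  rcases hT.ae_mem_or_ae_notMem hAm hAinv with h | h
  · exfalso
    have hint : ∀ n, 0 ≤ ∫ x, max (-maxBirkhoff T f n (T x)) (f x) ∂μ := fun n => by
      have i1 := integrable_maxBirkhoff hT.toMeasurePreserving hf n
      have i2 := integrable_maxBirkhoff hT.toMeasurePreserving hf (n + 1)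
      have i3 : Integrable (fun x => maxBirkhoff T f n (T x)) μ :=
        hT.toMeasurePreserving.integrable_comp_of_integrable i1
      -- Pointwise, `max (-M_n ∘ T) f = M_{n+1} - M_n ∘ T`; invariance of the measure removes `T`.
      have e1 : ∫ x, max (-maxBirkhoff T f n (T x)) (f x) ∂μ =
          ∫ x, maxBirkhoff T f (n + 1) x ∂μ - ∫ x, maxBirkhoff T f n x ∂μ := by
        rw [← hT.toMeasurePreserving.map_eq, integral_map hT.measurable.aemeasurable
          (hMm n).aestronglyMeasurable, hT.toMeasurePreserving.map_eq, ← integral_sub i2 i3]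
        refine integral_congr_ae (ae_of_all _ fun x => ?_)
        simp only [maxBirkhoff]
        rw [← max_sub_sub_right, zero_sub, add_sub_cancel_right]
      rw [e1, sub_nonneg]
      exact integral_mono i1 i2 fun x => maxBirkhoff_mono x n.le_succ
    have hlim : Tendsto (fun n => ∫ x, max (-maxBirkhoff T f n (T x)) (f x) ∂μ) atTop
        (𝓝 (∫ x, f x ∂μ)) := by
      refine tendsto_integral_of_dominated_convergence (fun x => |f x|) (fun n => ?_) hf.abs
        (fun n => ae_of_all _ fun x => ?_) ?_
      · exact (((hMm n).comp hT.measurable).neg.max hfm).aestronglyMeasurable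
      · have := maxBirkhoff_nonneg (T := T) (f := f) n (T x)
        rw [Real.norm_eq_abs, abs_le]
        refine ⟨le_max_of_le_right (neg_abs_le _), max_le ?_ (le_abs_self _)⟩
        linarith [abs_nonneg (f x)]
      · filter_upwards [h] with x hx
        rw [← hAinv] at hx
        obtain ⟨k, hk⟩ := exists_nat_ge (-f x)
        obtain ⟨n, hn⟩ := hx k
        refine tendsto_const_nhds.congr' ?_
        filter_upwards [eventually_ge_atTop n] with m hm
        have := maxBirkhoff_mono (T := T) (f := f) (T x) hm
        simp only at this
        rw [max_eq_right (by linarith)]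
    linarith [ge_of_tendsto' hlim hint]
  · filter_upwards [h] with x hx
    simp only [hA, Set.mem_ofPred_eq, not_forall, not_exists, not_lt] at hx
    obtain ⟨K, hK⟩ := hx
    exact ⟨K, fun n => (birkhoffSum_le_maxBirkhoff n x).trans (hK n)⟩

lemma ae_birkhoffSum_le_of_integrable [IsProbabilityMeasure μ] (hT : Ergodic T μ)
    (hfm : Measurable f) (hf : Integrable f μ) {c : ℝ} (hc : ∫ x, f x ∂μ < c) :
    ∀ᵐ x ∂μ, ∃ C : ℝ, ∀ n : ℕ, birkhoffSum T f n x ≤ C + c * n := by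
  have h1 := ae_bddAbove_birkhoffSum hT (hfm.sub_const c) (hf.sub (integrable_const c)) (by
    rw [integral_sub hf (integrable_const c)]; simpa using hc)
  filter_upwards [h1] with x ⟨C, hC⟩
  refine ⟨C, fun n => ?_⟩
  have := hC n
  rw [birkhoffSum_sub_const] at this
  linarith

lemma ae_le_birkhoffSum_of_integrable [IsProbabilityMeasure μ] (hT : Ergodic T μ)
    (hfm : Measurable f) (hf : Integrable f μ) {c : ℝ} (hc : c < ∫ x, f x ∂μ) :
    ∀ᵐ x ∂μ, ∃ C : ℝ, ∀ n : ℕ, c * n - C ≤ birkhoffSum T f n x := by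
  filter_upwards [ae_birkhoffSum_le_of_integrable hT hfm.neg hf.neg (c := -c) (by
    simp only [Pi.neg_apply]; rw [integral_neg]; linarith)] with x ⟨C, hC⟩
  refine ⟨C, fun n => ?_⟩
  have := hC n
  have e : birkhoffSum T (-f) n x = -birkhoffSum T f n x := by
    simp [birkhoffSum, Finset.sum_neg_distrib]
  rw [e] at this
  linarith

/-- The upper half of the ergodic theorem for functions whose negative part need not be
integrable. -/
lemma ae_birkhoffSum_le [IsProbabilityMeasure μ] (hT : Ergodic T μ) (hfm : Measurable f)
    (hpos : ∫⁻ x, ENNReal.ofReal (f x) ∂μ ≠ ⊤) {c : ℝ}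
    (hc : ((∫⁻ x, ENNReal.ofReal (f x) ∂μ : ℝ≥0∞) : EReal) -
      ((∫⁻ x, ENNReal.ofReal (-f x) ∂μ : ℝ≥0∞) : EReal) < c) :
    ∀ᵐ x ∂μ, ∃ C : ℝ, ∀ n : ℕ, birkhoffSum T f n x ≤ C + c * n := by
  -- Truncation from below can only increase the sums. By monotone convergence of the negative parts
  -- the truncated mean drops below `c` for some `K`, also when the mean of `f` is `-∞`.
  suffices hK : ∃ K : ℕ, Integrable (fun x => max (f x) (-K)) μ ∧
      ∫ x, max (f x) (-(K : ℝ)) ∂μ < c by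
    obtain ⟨K, hi, hK⟩ := hK
    filter_upwards [ae_birkhoffSum_le_of_integrable hT (hfm.max measurable_const) hi hK]
      with x ⟨C, hC⟩
    refine ⟨C, fun n => le_trans ?_ (hC n)⟩
    exact Finset.sum_le_sum fun i _ => le_max_left _ _
  set P := ∫⁻ x, ENNReal.ofReal (f x) ∂μ with hP
  set N : ℕ → ℝ≥0∞ := fun K => ∫⁻ x, min (ENNReal.ofReal (-f x)) K ∂μ with hN
  have hNfin : ∀ K, N K ≠ ⊤ := fun K => by
    refine ne_top_of_le_ne_top (ENNReal.natCast_ne_top K) ?_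
    calc N K ≤ ∫⁻ _, (K : ℝ≥0∞) ∂μ := lintegral_mono fun x => min_le_right _ _
      _ = K := by simp
  have hsup : ⨆ K, N K = ∫⁻ x, ENNReal.ofReal (-f x) ∂μ := by
    rw [← lintegral_iSup]
    · refine lintegral_congr fun x => ?_
      refine le_antisymm (iSup_le fun K => min_le_left _ _) ?_
      obtain ⟨K, hK⟩ := exists_nat_ge (-f x)
      refine le_iSup_of_le K (le_min le_rfl ?_)
      rw [← ENNReal.ofReal_natCast]
      exact ENNReal.ofReal_le_ofReal hK
    · exact fun K => by fun_prop
    · intro K L hKL x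
      exact min_le_min le_rfl (by exact_mod_cast hKL)
  have hpart : ∀ (K : ℕ) x, ENNReal.ofReal (-max (f x) (-K)) = min (ENNReal.ofReal (-f x)) K :=
    fun K x => by
      rw [← min_neg_neg, neg_neg, ENNReal.ofReal_min, ENNReal.ofReal_natCast]
  have hpart' : ∀ (K : ℕ) x, ENNReal.ofReal (max (f x) (-K)) = ENNReal.ofReal (f x) := fun K x => by
    rcases le_total (f x) 0 with h | h
    · rw [ENNReal.ofReal_of_nonpos h, ENNReal.ofReal_of_nonpos (max_le h (by simp))]
    · rw [max_eq_left]; exact le_trans (by simp) h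
  have hint : ∀ K : ℕ, Integrable (fun x => max (f x) (-K)) μ := fun K => by
    refine ⟨(hfm.max measurable_const).aestronglyMeasurable, ?_⟩
    rw [hasFiniteIntegral_iff_norm]
    have e1 : ∀ x, ENNReal.ofReal ‖max (f x) (-(K : ℝ))‖ ≤
        ENNReal.ofReal (f x) + K := fun x => by
      rw [Real.norm_eq_abs, ← ENNReal.ofReal_natCast]
      refine ((ENNReal.ofReal_le_ofReal (q := max (f x) 0 + K) ?_).trans
        ENNReal.ofReal_add_le).trans ?_
      · have : (0 : ℝ) ≤ K := by positivity
        rw [abs_le]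
        constructor
        · linarith [le_max_right (f x) (-(K : ℝ)), le_max_right (f x) 0]
        · exact max_le (by linarith [le_max_left (f x) 0]) (by linarith [le_max_right (f x) 0])
      · refine add_le_add ?_ le_rfl
        exact (ENNReal.ofReal_le_ofReal_iff' (q := f x) (p := max (f x) 0)).2
          ((le_total (f x) 0).elim (fun h => Or.inr (by simp [h])) fun h => Or.inl (by simp [h]))
    refine (lintegral_mono e1).trans_lt ?_
    rw [lintegral_add_right _ measurable_const]
    simp only [lintegral_const, measure_univ, mul_one]
    exact ENNReal.add_lt_top.2 ⟨lt_top_iff_ne_top.2 hpos, ENNReal.natCast_lt_top K⟩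
  have hval : ∀ K : ℕ, ∫ x, max (f x) (-(K : ℝ)) ∂μ = P.toReal - (N K).toReal := fun K => by
    rw [integral_eq_lintegral_pos_part_sub_lintegral_neg_part (hint K)]
    simp only [hpart, hpart', hP, hN]
  by_contra! hcon
  have hge : ∀ K, (N K) ≤ ENNReal.ofReal (P.toReal - c) := fun K => by
    have := hcon K (hint K)
    rw [hval] at this
    rw [← ENNReal.ofReal_toReal (hNfin K)]
    exact ENNReal.ofReal_le_ofReal (by linarith)
  have hge2 : ∫⁻ x, ENNReal.ofReal (-f x) ∂μ ≤ ENNReal.ofReal (P.toReal - c) := by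
    rw [← hsup]; exact iSup_le hge
  have hNc : 0 ≤ P.toReal - c := by
    have := hcon 0 (hint 0)
    rw [hval] at this
    have h0 : (0:ℝ) ≤ (N 0).toReal := ENNReal.toReal_nonneg
    linarith
  refine absurd hc (not_lt.2 ?_)
  have hNf : ∫⁻ x, ENNReal.ofReal (-f x) ∂μ ≠ ⊤ := ne_top_of_le_ne_top ENNReal.ofReal_ne_top hge2
  have h5 : (∫⁻ x, ENNReal.ofReal (-f x) ∂μ).toReal ≤ P.toReal - c := by
    have := ENNReal.toReal_mono ENNReal.ofReal_ne_top hge2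
    rwa [ENNReal.toReal_ofReal hNc] at this
  rw [← EReal.coe_ennreal_toReal hpos, ← EReal.coe_ennreal_toReal hNf, ← EReal.coe_sub]
  exact_mod_cast (by linarith : c ≤ P.toReal - (∫⁻ x, ENNReal.ofReal (-f x) ∂μ).toReal)

end Ergodic

/-! ### The shift -/

@[fun_prop]
lemma measurable_shift : Measurable shift :=
  measurable_pi_lambda _ fun x => measurable_pi_apply (x + 1)

/-- The shift as an equivalence. -/
def shiftEquiv : (ℤ → ℝ) ≃ᵐ (ℤ → ℝ) where
  toFun := shift
  invFun ζ x := ζ (x - 1)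
  left_inv ζ := by ext x; simp [shift]
  right_inv ζ := by ext x; simp [shift]
  measurable_toFun := measurable_shift
  measurable_invFun := measurable_pi_lambda _ fun x => measurable_pi_apply (x - 1)

lemma shift_iterate (n : ℕ) (ζ : ℤ → ℝ) : shift^[n] ζ = fun x => ζ (x + n) := by
  induction n with
  | zero => simp
  | succ n ih =>
    rw [Function.iterate_succ_apply', ih]
    ext x; simp only [shift]; congr 1; push_cast; ring

lemma shiftEquiv_symm_iterate (n : ℕ) (ζ : ℤ → ℝ) :
    shiftEquiv.symm^[n] ζ = fun x => ζ (x - n) := by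
  induction n with
  | zero => simp
  | succ n ih =>
    rw [Function.iterate_succ_apply', ih]
    ext x
    change ζ (x - 1 - n) = _
    congr 1; push_cast; ring

lemma ergodic_shift_symm {Q : Measure (ℤ → ℝ)} (hQ : Ergodic shift Q) :
    Ergodic shiftEquiv.symm Q := by
  have : Ergodic shiftEquiv Q := hQ
  exact this.symm

open scoped symmDiff in
lemma ergodic_shift_infinitePi (η : Measure ℝ) [IsProbabilityMeasure η] :
    Ergodic shift (Measure.infinitePi fun _ : ℤ => η) := by
  set Q := Measure.infinitePi fun _ : ℤ => η with hQ
  have hmp : MeasurePreserving shift Q Q := ⟨measurable_shift,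
    Measure.map_infinitePi_infinitePi_of_inj (P := fun _ : ℤ => η) (f := fun x : ℤ => x + 1)
      (add_left_injective 1)⟩
  refine ⟨hmp, ⟨fun s hs hinv => ?_⟩⟩
  -- An invariant set is independent of itself: a cylinder approximating it and a distant translate
  -- of this cylinder are independent, and both approximate the set.
  suffices h : Q.real s = Q.real s * Q.real s by
    have h2 : Q.real s = 0 ∨ Q.real s = 1 := by
      have : Q.real s * (Q.real s - 1) = 0 := by linarith
      rcases mul_eq_zero.1 this with h | h
      · exact Or.inl h
      · exact Or.inr (by linarith)
    rw [eventuallyConst_set']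
    rcases h2 with h | h
    · left
      rw [measureReal_eq_zero_iff] at h
      exact ae_eq_empty.2 h
    · right
      rw [eventuallyEq_univ]
      rw [mem_ae_iff, prob_compl_eq_zero_iff hs, ← ENNReal.ofReal_toReal (measure_ne_top Q s)]
      change ENNReal.ofReal (Q.real s) = 1
      rw [h, ENNReal.ofReal_one]
  have key : ∀ ε : ℝ, 0 < ε → |Q.real s - Q.real s * Q.real s| ≤ 4 * ε := fun ε hε => by
    obtain ⟨t, htC, ht⟩ := exists_measure_symmDiff_lt_of_generateFrom_isSetRing (μ := Q)
      (isSetRing_measurableCylinders (α := fun _ : ℤ => ℝ))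
      ⟨{Set.univ}, Set.countable_singleton _, by
        simpa using univ_mem_measurableCylinders (fun _ : ℤ => ℝ), by simp⟩
      generateFrom_measurableCylinders.symm hs (ENNReal.ofReal_pos.2 hε)
    have htm : MeasurableSet t := MeasurableSet.of_mem_measurableCylinders htC
    have ht' : Q.real (t ∆ s) < ε := by
      have := (ENNReal.toReal_lt_toReal (measure_ne_top _ _) ENNReal.ofReal_ne_top).2 ht
      rwa [ENNReal.toReal_ofReal hε.le] at this
    obtain ⟨I, S, hS, htdef⟩ := (mem_measurableCylinders _).1 htC
    -- A shift by more than the diameter of the index set makes the two cylinders depend on disjoint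
    -- coordinates.
    obtain ⟨n, hn⟩ : ∃ n : ℕ, Disjoint I (I.image fun x => x + (n : ℤ)) := by
      obtain ⟨B, hB⟩ := I.bddAbove
      obtain ⟨b, hb⟩ := I.bddBelow
      refine ⟨(B - b).toNat + 1, ?_⟩
      rw [Finset.disjoint_left]
      intro x hx hx'
      obtain ⟨y, hy, rfl⟩ := Finset.mem_image.1 hx'
      have h1 := hB hx
      have h2 := hb hy
      push_cast at h1
      have := Int.self_le_toNat (B - b)
      omega
    set t' := shift^[n] ⁻¹' t with ht'def
    have hind : Q (t ∩ t') = Q t * Q t' := by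
      have hi : iIndepFun (fun (i : ℤ) (ω : ℤ → ℝ) => ω i) Q :=
        iIndepFun_infinitePi (P := fun _ : ℤ => η) (X := fun _ x => x) (fun _ => measurable_id)
      have h1 := hi.indepFun_finset I (I.image fun x => x + (n : ℤ)) hn
        (fun i => measurable_pi_apply i)
      have hmem : ∀ i : I, (i : ℤ) + n ∈ I.image fun x => x + (n : ℤ) := fun i =>
        Finset.mem_image_of_mem _ i.2
      have h2 := h1.measure_inter_preimage_eq_mul S
        ((fun y (i : I) => y ⟨(i : ℤ) + n, hmem i⟩) ⁻¹' S) hS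
        (hS.preimage (by fun_prop))
      have e2 : (fun (a : ℤ → ℝ) (i : (I.image fun x => x + (n : ℤ))) => a i) ⁻¹'
          ((fun y (i : I) => y ⟨(i : ℤ) + n, hmem i⟩) ⁻¹' S) = t' := by
        ext ω
        simp only [ht'def, Set.mem_preimage, shift_iterate, htdef, mem_cylinder]
        rfl
      rw [e2] at h2
      rw [htdef]
      rw [htdef] at ht'def
      exact h2
    have hinvn : shift^[n] ⁻¹' s = s := by
      exact Function.IsFixedPt.preimage_iterate hinv n
    have hmpn := hmp.iterate n
    have hQt' : Q.real t' = Q.real t := by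
      simp only [measureReal_def]
      rw [ht'def, hmpn.measure_preimage htm.nullMeasurableSet]
    have hst' : Q.real (t' ∆ s) < ε := by
      have e3 : t' ∆ s = shift^[n] ⁻¹' (t ∆ s) := by
        rw [Set.preimage_symmDiff, hinvn]
      simp only [measureReal_def] at ht' ⊢
      rw [e3, hmpn.measure_preimage (htm.symmDiff hs).nullMeasurableSet]
      exact ht'
    have hind' : Q.real (t ∩ t') = Q.real t * Q.real t := by
      nth_rewrite 2 [← hQt']
      simp only [measureReal_def, hind, ENNReal.toReal_mul]
    have h3 : |Q.real t - Q.real s| ≤ ε := by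
      have a1 : Q.real t ≤ Q.real s + Q.real (t ∆ s) :=
        (measureReal_mono (fun x hx => by
          by_cases h : x ∈ s
          · exact Or.inl h
          · exact Or.inr (Or.inl ⟨hx, h⟩))).trans (measureReal_union_le _ _)
      have a2 : Q.real s ≤ Q.real t + Q.real (t ∆ s) :=
        (measureReal_mono (fun x hx => by
          by_cases h : x ∈ t
          · exact Or.inl h
          · exact Or.inr (Or.inr ⟨hx, h⟩))).trans (measureReal_union_le _ _)
      rw [abs_le]; constructor <;> linarith
    have h4 : |Q.real (t ∩ t') - Q.real s| ≤ 2 * ε := by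
      have a1 : Q.real (t ∩ t') ≤ Q.real s + Q.real (t ∆ s) :=
        (measureReal_mono (fun x hx => by
          by_cases h : x ∈ s
          · exact Or.inl h
          · exact Or.inr (Or.inl ⟨hx.1, h⟩))).trans (measureReal_union_le _ _)
      have a2 : Q.real s ≤ Q.real (t ∩ t') + (Q.real (t ∆ s) + Q.real (t' ∆ s)) :=
        (measureReal_mono (fun x hx => by
          by_cases h : x ∈ t
          · by_cases h' : x ∈ t'
            · exact Or.inl ⟨h, h'⟩
            · exact Or.inr (Or.inr (Or.inr ⟨hx, h'⟩))
          · exact Or.inr (Or.inl (Or.inr ⟨hx, h⟩)))).trans ((measureReal_union_le _ _).trans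
            (add_le_add le_rfl (measureReal_union_le _ _)))
      rw [abs_le]; constructor <;> linarith
    rw [hind'] at h4
    have b1 : 0 ≤ Q.real s := measureReal_nonneg
    have b2 : Q.real s ≤ 1 := measureReal_le_one
    have b3 : 0 ≤ Q.real t := measureReal_nonneg
    have b4 : Q.real t ≤ 1 := measureReal_le_one
    rw [abs_le] at h3 h4 ⊢
    constructor <;> nlinarith
  by_contra hne
  have hpos : 0 < |Q.real s - Q.real s * Q.real s| := abs_pos.2 (sub_ne_zero.2 hne)
  linarith [key (|Q.real s - Q.real s * Q.real s| / 8) (by positivity)]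

end

end PAM

/-! ### Fixed potential: the hitting functional as a moment generating function. -/

namespace PAM

noncomputable section

/-! ### The hitting time under the Feynman-Kac weight -/

section HittingLaw

variable {κ h β β' : ℝ} {ξ : ℤ → ℝ}

lemma aemeasurable_hittingWeight (hκ : 0 < κ) (h1 : 0 < h) (h2 : h ≤ 1) (ξ : ℤ → ℝ) (β : ℝ) :
    AEMeasurable (hittingWeight ξ β) (walkLaw κ (-h)) :=
  (Measurable.tsum fun n => measurable_hitTerm n 1).aemeasurable.congr
    (ae_tsum_hitTerm hκ h1 h2 fun x => ξ x + β)

lemma ae_hittingTime_pos (hκ : 0 < κ) (h1 : 0 < h) (h2 : h ≤ 1) :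
    ∀ᵐ ω ∂walkLaw κ (-h), 0 < hittingTime 1 0 ω := by
  filter_upwards [ae_exists_hitsAt hκ h1 h2,
    ae_isRegular hκ (by linarith : -1 ≤ -h) (by linarith : -h ≤ 1)] with ω ⟨n, hn⟩ hω
  rw [hω.hittingTime_eq hn, ← jumpTime_zero ω]
  refine hω.jumpTime_mono (Nat.pos_of_ne_zero ?_)
  rintro rfl
  exact one_ne_zero hn

/-- With zero potential and `β = 1` the hitting weight is `exp T₀`, so the hitting time inherits its
measurability. -/
lemma aemeasurable_hittingTime (hκ : 0 < κ) (h1 : 0 < h) (h2 : h ≤ 1) :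
    AEMeasurable (hittingTime 1 0) (walkLaw κ (-h)) := by
  have e : hittingTime 1 0 = fun ω => Real.log (hittingWeight 0 1 ω).toReal := by
    ext ω
    simp [hittingWeight, ENNReal.toReal_ofReal (Real.exp_pos _).le]
  rw [e]
  exact Real.measurable_log.comp_aemeasurable (aemeasurable_hittingWeight hκ h1 h2 0 1).ennreal_toReal

lemma ae_hittingWeight_eq (hκ : 0 < κ) (h1 : 0 < h) (h2 : h ≤ 1) (ξ : ℤ → ℝ) (β : ℝ) :
    ∀ᵐ ω ∂walkLaw κ (-h), hittingWeight ξ β ω =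
      hittingWeight ξ 0 ω * ENNReal.ofReal (Real.exp (β * hittingTime 1 0 ω)) := by
  filter_upwards [ae_hittingTime_pos hκ h1 h2,
    ae_isRegular hκ (by linarith : -1 ≤ -h) (by linarith : -h ≤ 1)] with ω h0 hω
  rw [hittingWeight, hittingWeight, ← ENNReal.ofReal_mul (Real.exp_pos _).le, ← Real.exp_add]
  have hi := hω.intervalIntegrable ξ 1 h0.le
  simp only [add_zero]
  rw [intervalIntegral.integral_add hi intervalIntegrable_const]
  simp [mul_comm]

/-- The law of the walk up to the hitting time, weighted by `exp (∫₀^{T₀} ξ)`. -/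
def hittingLaw (κ h : ℝ) (ξ : ℤ → ℝ) : Measure Path :=
  (walkLaw κ (-h)).withDensity (hittingWeight ξ 0)

lemma lintegral_hittingLaw (hκ : 0 < κ) (h1 : 0 < h) (h2 : h ≤ 1) {g : Path → ℝ≥0∞}
    (hg : AEMeasurable g (walkLaw κ (-h))) : ∫⁻ ω, g ω ∂hittingLaw κ h ξ =
      ∫⁻ ω, hittingWeight ξ 0 ω * g ω ∂walkLaw κ (-h) :=
  lintegral_withDensity_eq_lintegral_mul₀ (aemeasurable_hittingWeight hκ h1 h2 ξ 0) hg

lemma lintegral_exp_hittingLaw (hκ : 0 < κ) (h1 : 0 < h) (h2 : h ≤ 1) (β : ℝ) :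
    ∫⁻ ω, ENNReal.ofReal (Real.exp (β * hittingTime 1 0 ω)) ∂hittingLaw κ h ξ =
      hittingMGF κ h ξ β := by
  have := aemeasurable_hittingTime hκ h1 h2
  rw [lintegral_hittingLaw hκ h1 h2 (by fun_prop)]
  exact lintegral_congr_ae ((ae_hittingWeight_eq hκ h1 h2 ξ β).mono fun ω hω => hω.symm)

lemma lintegral_mul_exp_hittingLaw (hκ : 0 < κ) (h1 : 0 < h) (h2 : h ≤ 1) (β : ℝ) :
    ∫⁻ ω, ENNReal.ofReal (hittingTime 1 0 ω * Real.exp (β * hittingTime 1 0 ω)) ∂hittingLaw κ h ξ =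
      hittingMean κ h ξ β := by
  have := aemeasurable_hittingTime hκ h1 h2
  rw [lintegral_hittingLaw hκ h1 h2 (by fun_prop)]
  refine lintegral_congr_ae ?_
  filter_upwards [ae_hittingWeight_eq hκ h1 h2 ξ β, ae_hittingTime_pos hκ h1 h2] with ω hω h0
  rw [hω, ENNReal.ofReal_mul h0.le]
  ring

lemma aemeasurable_hittingTime_hittingLaw (hκ : 0 < κ) (h1 : 0 < h) (h2 : h ≤ 1) :
    AEMeasurable (hittingTime 1 0) (hittingLaw κ h ξ) :=
  (aemeasurable_hittingTime hκ h1 h2).mono_ac (withDensity_absolutelyContinuous _ _)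

lemma ae_hittingLaw_pos (hκ : 0 < κ) (h1 : 0 < h) (h2 : h ≤ 1) :
    ∀ᵐ ω ∂hittingLaw κ h ξ, 0 < hittingTime 1 0 ω :=
  (withDensity_absolutelyContinuous _ _).ae_le (ae_hittingTime_pos hκ h1 h2)

/-- Through this identity smoothness and log-convexity in `β` follow from the theory of moment
generating functions. -/
lemma mgf_hittingLaw (hκ : 0 < κ) (h1 : 0 < h) (h2 : h ≤ 1) :
    mgf (hittingTime 1 0) (hittingLaw κ h ξ) β = (hittingMGF κ h ξ β).toReal := by
  have := aemeasurable_hittingTime_hittingLaw (ξ := ξ) hκ h1 h2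
  rw [mgf, integral_eq_lintegral_of_nonneg_ae (ae_of_all _ fun ω => (Real.exp_pos _).le)
    (AEMeasurable.aestronglyMeasurable (by fun_prop)), lintegral_exp_hittingLaw hκ h1 h2]

/-- The logarithm of `hittingMGF` as a real number. -/
def logMGF (κ h : ℝ) (ξ : ℤ → ℝ) (β : ℝ) : ℝ := Real.log (hittingMGF κ h ξ β).toReal

lemma cgf_hittingLaw (hκ : 0 < κ) (h1 : 0 < h) (h2 : h ≤ 1) :
    cgf (hittingTime 1 0) (hittingLaw κ h ξ) = logMGF κ h ξ := by
  ext β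
  rw [cgf, mgf_hittingLaw hκ h1 h2, logMGF]

lemma hittingMGF_mono (hκ : 0 < κ) (h1 : 0 < h) (h2 : h ≤ 1) (ξ : ℤ → ℝ) :
    Monotone (hittingMGF κ h ξ) := fun β β' hβ => by
  rw [hittingMGF_eq_hitTotal hκ h1 h2, hittingMGF_eq_hitTotal hκ h1 h2]
  exact hitTotal_anti (fun x => ENNReal.ofReal_le_ofReal (by linarith)) 1

lemma hittingMGF_pos (hκ : 0 < κ) (h1 : 0 < h) (h2 : h ≤ 1) (ξ : ℤ → ℝ) (β : ℝ) :
    0 < hittingMGF κ h ξ β := by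
  rw [hittingMGF_eq_hitTotal hκ h1 h2]
  refine hitTotal_one_pos ?_ ENNReal.ofReal_ne_top
  simp only [ne_eq, ENNReal.ofReal_eq_zero, not_le]
  positivity

lemma toReal_hittingMGF_pos (hκ : 0 < κ) (h1 : 0 < h) (h2 : h ≤ 1)
    (hfin : hittingMGF κ h ξ β ≠ ⊤) : 0 < (hittingMGF κ h ξ β).toReal :=
  ENNReal.toReal_pos (hittingMGF_pos hκ h1 h2 ξ β).ne' hfin

lemma logMGF_mono (hκ : 0 < κ) (h1 : 0 < h) (h2 : h ≤ 1) (hfin : hittingMGF κ h ξ β' ≠ ⊤)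
    (hβ : β ≤ β') : logMGF κ h ξ β ≤ logMGF κ h ξ β' := by
  have hm := hittingMGF_mono hκ h1 h2 ξ hβ
  exact Real.log_le_log (toReal_hittingMGF_pos hκ h1 h2 (ne_top_of_le_ne_top hfin hm))
    (ENNReal.toReal_mono hfin hm)

lemma hittingMGF_le_one (hκ : 0 < κ) (h1 : 0 < h) (h2 : h ≤ 1) (hξ : ∀ x, ξ x ≤ 0)
    (hβ : β ≤ 0) : hittingMGF κ h ξ β ≤ 1 := by
  have i4 := isProbabilityMeasure_walkLaw hκ (by linarith : -1 ≤ -h) (by linarith : -h ≤ 1)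
  calc hittingMGF κ h ξ β ≤ ∫⁻ _, 1 ∂walkLaw κ (-h) := by
        refine lintegral_mono_ae ?_
        filter_upwards [ae_hittingTime_pos hκ h1 h2] with ω h0
        rw [hittingWeight, ENNReal.ofReal_le_one, Real.exp_le_one_iff]
        have : ∫ s in (0 : ℝ)..hittingTime 1 0 ω, (ξ (position 1 ω s) + β) ≤
            ∫ s in (0 : ℝ)..hittingTime 1 0 ω, (0 : ℝ) := by
          by_cases hi : IntervalIntegrable (fun s => ξ (position 1 ω s) + β) volume 0
              (hittingTime 1 0 ω)
          · exact intervalIntegral.integral_mono h0.le hi intervalIntegrable_const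
              fun s => by linarith [hξ (position 1 ω s)]
          · rw [intervalIntegral.integral_undef hi]; simp
        simpa using this
    _ = 1 := by simp

lemma measurable_hitSum (q p : ℝ≥0∞) (β κ : ℝ) (n : ℕ) (x : ℤ) :
    Measurable fun ξ : ℤ → ℝ => hitSum q p (fun x => ENNReal.ofReal (κ - ξ x - β)) n x := by
  induction n generalizing x with
  | zero => simp only [hitSum]; exact measurable_const
  | succ n ih =>
    simp only [hitSum]
    split_ifs
    · exact measurable_const
    · have := ih (x - 1)
      have := ih (x + 1)
      fun_prop

lemma measurable_hittingMGF (hκ : 0 < κ) (h1 : 0 < h) (h2 : h ≤ 1) (β : ℝ) :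
    Measurable fun ξ => hittingMGF κ h ξ β := by
  simp only [hittingMGF_eq_hitTotal hκ h1 h2]
  exact Measurable.tsum fun n => measurable_hitSum _ _ _ _ n 1

lemma measurable_logMGF (hκ : 0 < κ) (h1 : 0 < h) (h2 : h ≤ 1) (β : ℝ) :
    Measurable fun ξ => logMGF κ h ξ β :=
  Real.measurable_log.comp (measurable_hittingMGF hκ h1 h2 β).ennreal_toReal

lemma Iio_subset_interior_integrableExpSet (hκ : 0 < κ) (h1 : 0 < h) (h2 : h ≤ 1)
    (hfin : hittingMGF κ h ξ β ≠ ⊤) :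
    Set.Iio β ⊆ interior (integrableExpSet (hittingTime 1 0) (hittingLaw κ h ξ)) := by
  refine interior_maximal (fun b hb => ?_) isOpen_Iio
  have := aemeasurable_hittingTime_hittingLaw (ξ := ξ) hκ h1 h2
  refine ⟨AEMeasurable.aestronglyMeasurable (by fun_prop), ?_⟩
  rw [hasFiniteIntegral_iff_ofReal (ae_of_all _ fun ω => (Real.exp_pos _).le),
    lintegral_exp_hittingLaw hκ h1 h2]
  exact lt_top_iff_ne_top.2 (ne_top_of_le_ne_top hfin (hittingMGF_mono hκ h1 h2 ξ (Set.mem_Iio.1 hb).le))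

/-- The second derivative is the variance of the hitting time under the exponentially tilted law. -/
lemma convexOn_logMGF (hκ : 0 < κ) (h1 : 0 < h) (h2 : h ≤ 1) (hfin : hittingMGF κ h ξ β ≠ ⊤) :
    ConvexOn ℝ (Set.Iio β) (logMGF κ h ξ) := by
  have hsub := Iio_subset_interior_integrableExpSet hκ h1 h2 hfin
  rw [← cgf_hittingLaw hκ h1 h2]
  refine convexOn_of_deriv2_nonneg' (convex_Iio β) (fun b hb => ?_) (fun b hb => ?_)
    fun b hb => ?_
  · exact (analyticAt_cgf (hsub hb)).differentiableAt.differentiableWithinAt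
  · exact (analyticAt_cgf (hsub hb)).deriv.differentiableAt.differentiableWithinAt
  · rw [← iteratedDeriv_eq_iterate, iteratedDeriv_two_cgf_eq_integral (hsub hb)]
    exact div_nonneg (integral_nonneg fun ω => mul_nonneg (sq_nonneg _) (Real.exp_pos _).le)
      mgf_nonneg

lemma hittingMean_ne_zero (hκ : 0 < κ) (h1 : 0 < h) (h2 : h ≤ 1) : hittingMean κ h ξ β ≠ 0 := by
  have i4 := isProbabilityMeasure_walkLaw hκ (by linarith : -1 ≤ -h) (by linarith : -h ≤ 1)
  have hw := aemeasurable_hittingWeight hκ h1 h2 ξ β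
  have ht := aemeasurable_hittingTime hκ h1 h2
  rw [hittingMean, Ne, lintegral_eq_zero_iff' (by fun_prop)]
  intro hz
  obtain ⟨ω, hω1, hω2⟩ := (hz.and (ae_hittingTime_pos hκ h1 h2)).exists
  simp only [Pi.zero_apply, mul_eq_zero, ENNReal.ofReal_eq_zero, not_le.2 hω2, false_or] at hω1
  rw [hittingWeight, ENNReal.ofReal_eq_zero] at hω1
  exact absurd hω1 (not_le.2 (Real.exp_pos _))

lemma hittingMean_ne_top (hκ : 0 < κ) (h1 : 0 < h) (h2 : h ≤ 1) (hfin : hittingMGF κ h ξ β' ≠ ⊤)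
    (hβ : β < β') : hittingMean κ h ξ β ≠ ⊤ := by
  have hsub := Iio_subset_interior_integrableExpSet hκ h1 h2 hfin
  have hi := integrable_pow_mul_exp_of_mem_interior_integrableExpSet (hsub hβ) 1
  have h3 := hi.2
  rw [hasFiniteIntegral_iff_ofReal] at h3
  · simp only [pow_one] at h3
    rw [lintegral_mul_exp_hittingLaw hκ h1 h2] at h3
    exact h3.ne
  · filter_upwards [ae_hittingLaw_pos hκ h1 h2] with ω h0
    have := Real.exp_pos (β * hittingTime 1 0 ω)
    simp only [Pi.zero_apply]
    positivity

lemma hasDerivAt_logMGF (hκ : 0 < κ) (h1 : 0 < h) (h2 : h ≤ 1) (hfin : hittingMGF κ h ξ β' ≠ ⊤)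
    (hβ : β < β') :
    HasDerivAt (logMGF κ h ξ) (hittingMean κ h ξ β / hittingMGF κ h ξ β).toReal β := by
  have hsub := Iio_subset_interior_integrableExpSet hκ h1 h2 hfin
  have hd := (analyticAt_cgf (hsub hβ)).differentiableAt.hasDerivAt
  rw [deriv_cgf (hsub hβ), mgf_hittingLaw hκ h1 h2, cgf_hittingLaw hκ h1 h2] at hd
  have := aemeasurable_hittingTime_hittingLaw (ξ := ξ) hκ h1 h2
  rw [integral_eq_lintegral_of_nonneg_ae _ (AEMeasurable.aestronglyMeasurable (by fun_prop)),
    lintegral_mul_exp_hittingLaw hκ h1 h2] at hd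
  · rwa [ENNReal.toReal_div]
  · filter_upwards [ae_hittingLaw_pos hκ h1 h2] with ω h0
    have := Real.exp_pos (β * hittingTime 1 0 ω)
    simp only [Pi.zero_apply]
    positivity

/-- The hitting ratios solve the Riccati recursion. -/
lemma isRiccati_hittingMGF (hκ : 0 < κ) (h1 : 0 < h) (h2 : h ≤ 1)
    (hfin : ∀ k : ℤ, hittingMGF κ h (fun x => ξ (x + k)) β ≠ ⊤) :
    IsRiccati (κ * (1 + h) / 2) (κ * (1 - h) / 2) (fun x => -(ξ x - κ) - β)
      fun k => (hittingMGF κ h (fun x => ξ (x + k)) β).toReal := by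
  have hq : 0 < κ * (1 + h) / 2 := by positivity
  have hp : 0 ≤ κ * (1 - h) / 2 := by
    have : 0 ≤ 1 - h := by linarith
    positivity
  refine ⟨fun k => toReal_hittingMGF_pos hκ h1 h2 (hfin k), fun k => ?_⟩
  have e := hitTotal_one_eq (q := ENNReal.ofReal (κ * (1 + h) / 2))
    (p := ENNReal.ofReal (κ * (1 - h) / 2)) (a := fun x => ENNReal.ofReal (κ - ξ (x + k) - β))
  have e1 : hitTotal (ENNReal.ofReal (κ * (1 + h) / 2)) (ENNReal.ofReal (κ * (1 - h) / 2))
      (fun y => ENNReal.ofReal (κ - ξ (y + 1 + k) - β)) 1 =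
      hittingMGF κ h (fun x => ξ (x + (k + 1))) β := by
    rw [hittingMGF_eq_hitTotal hκ h1 h2]
    simp only [add_assoc, add_comm k 1]
  rw [e1, ← hittingMGF_eq_hitTotal hκ h1 h2 (fun x => ξ (x + k)) β] at e
  set H := hittingMGF κ h (fun x => ξ (x + k)) β with hH
  set H' := hittingMGF κ h (fun x => ξ (x + (k + 1))) β with hH'
  -- Otherwise the inverse coefficient is `⊤`, and the hitting functional would be infinite.
  have ha : 0 < κ - ξ (1 + k) - β := by
    by_contra hcon
    rw [ENNReal.ofReal_of_nonpos (not_lt.1 hcon), ENNReal.inv_zero, ENNReal.top_mul] at e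
    · exact hfin k e
    · simp [hq]
  have e2 := congrArg ENNReal.toReal e
  rw [ENNReal.toReal_mul, ENNReal.toReal_inv, ENNReal.toReal_ofReal ha.le,
    ENNReal.toReal_add ENNReal.ofReal_ne_top (ENNReal.mul_ne_top ENNReal.ofReal_ne_top
      (ENNReal.mul_ne_top (hfin (k + 1)) (hfin k))), ENNReal.toReal_mul, ENNReal.toReal_mul,
    ENNReal.toReal_ofReal hq.le, ENNReal.toReal_ofReal hp] at e2
  rw [add_comm k 1]
  nth_rewrite 1 [e2]
  rw [show -(ξ (1 + k) - κ) - β = κ - ξ (1 + k) - β by ring, mul_inv_cancel_left₀ ha.ne']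

end HittingLaw

end

end PAM

/-! ### Averaging over the potential: finiteness, convexity and smoothness of `L` below the critical
value. -/

namespace PAM

noncomputable section

/-! ### The function `L` -/

/-- The standing assumptions on the walk and the potential. -/
structure IsModel (Q : Measure (ℤ → ℝ)) (κ h : ℝ) : Prop where
  kappa_pos : 0 < κ
  drift_pos : 0 < h
  drift_le : h ≤ 1
  ergodic : Ergodic shift Q
  nonpos : ∀ᵐ ξ ∂Q, ∀ x, ξ x ≤ 0

section Model

variable {Q : Measure (ℤ → ℝ)} {κ h β β' : ℝ}

lemma ae_translate (hQ : Ergodic shift Q) {p : (ℤ → ℝ) → Prop} (hp : ∀ᵐ ξ ∂Q, p ξ) :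
    ∀ᵐ ξ ∂Q, ∀ k : ℤ, p fun x => ξ (x + k) := by
  refine ae_all_iff.2 fun k => ?_
  obtain ⟨n, rfl | rfl⟩ := k.eq_nat_or_neg
  · have := (hQ.toMeasurePreserving.iterate n).quasiMeasurePreserving.ae hp
    simpa only [shift_iterate] using this
  · have := ((ergodic_shift_symm hQ).toMeasurePreserving.iterate n).quasiMeasurePreserving.ae hp
    simpa only [shiftEquiv_symm_iterate, sub_eq_add_neg] using this

lemma IsModel.right_pos (S : IsModel Q κ h) : 0 < κ * (1 + h) / 2 := by
  have := S.kappa_pos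
  have := S.drift_pos
  positivity

lemma IsModel.left_nonneg (S : IsModel Q κ h) : 0 ≤ κ * (1 - h) / 2 := by
  have := S.kappa_pos
  have : 0 ≤ 1 - h := by linarith [S.drift_le]
  positivity

lemma IsModel.logMGF_mono (S : IsModel Q κ h) (hfin : ∀ᵐ ξ ∂Q, hittingMGF κ h ξ β' ≠ ⊤)
    (hβ : β ≤ β') : ∀ᵐ ξ ∂Q, logMGF κ h ξ β ≤ logMGF κ h ξ β' := by
  filter_upwards [hfin] with ξ hξ
  exact PAM.logMGF_mono S.kappa_pos S.drift_pos S.drift_le hξ hβ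

lemma IsModel.ae_ne_top_mono (S : IsModel Q κ h) (hfin : ∀ᵐ ξ ∂Q, hittingMGF κ h ξ β' ≠ ⊤)
    (hβ : β ≤ β') : ∀ᵐ ξ ∂Q, hittingMGF κ h ξ β ≠ ⊤ := by
  filter_upwards [hfin] with ξ hξ
  exact ne_top_of_le_ne_top hξ (hittingMGF_mono S.kappa_pos S.drift_pos S.drift_le ξ hβ)

lemma IsModel.ae_isRiccati (S : IsModel Q κ h) (hfin : ∀ᵐ ξ ∂Q, hittingMGF κ h ξ β ≠ ⊤) :
    ∀ᵐ ξ ∂Q, IsRiccati (κ * (1 + h) / 2) (κ * (1 - h) / 2) (fun x => -(ξ x - κ) - β)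
      fun k => (hittingMGF κ h (fun x => ξ (x + k)) β).toReal := by
  filter_upwards [ae_translate S.ergodic hfin] with ξ hξ
  exact isRiccati_hittingMGF S.kappa_pos S.drift_pos S.drift_le hξ

/-- Comparing the recursions at `β` and `β'` gives a bound not depending on the potential. It keeps
`L⁺` finite, and it tends to `0` as `β → -∞`. -/
lemma IsModel.ae_le_div (S : IsModel Q κ h) (hfin : ∀ᵐ ξ ∂Q, hittingMGF κ h ξ β' ≠ ⊤)
    (hβ : β < β') : ∀ᵐ ξ ∂Q, ∀ k : ℤ, (hittingMGF κ h (fun x => ξ (x + k)) β).toReal ≤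
      κ * (1 + h) / 2 / (β' - β) := by
  filter_upwards [S.ae_isRiccati hfin, S.ae_isRiccati (S.ae_ne_top_mono hfin hβ.le),
    ae_translate S.ergodic hfin] with ξ h1 h2 h3 k
  refine h1.le_div (δ := β' - β) (H' := fun k =>
    (hittingMGF κ h (fun x => ξ (x + k)) β).toReal) ?_ S.right_pos S.left_nonneg (by linarith) (fun k => ?_) k
  · convert h2 using 2; ring
  · exact ENNReal.toReal_mono (h3 k)
      (hittingMGF_mono S.kappa_pos S.drift_pos S.drift_le _ hβ.le)

lemma IsModel.ae_logMGF_le (S : IsModel Q κ h) (hfin : ∀ᵐ ξ ∂Q, hittingMGF κ h ξ β' ≠ ⊤)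
    (hβ : β < β') : ∀ᵐ ξ ∂Q, logMGF κ h ξ β ≤ Real.log (κ * (1 + h) / 2 / (β' - β)) := by
  filter_upwards [S.ae_le_div hfin hβ, S.ae_ne_top_mono hfin hβ.le] with ξ h1 h2
  have := h1 0
  simp only [add_zero] at this
  exact Real.log_le_log (toReal_hittingMGF_pos S.kappa_pos S.drift_pos S.drift_le h2) this

/-- The logarithm itself may be unbounded below as `ξ` varies, but its increments in `β` are bounded
uniformly in `ξ`. This carries finiteness of `L⁻` from one `β` to all others and dominates the
derivative. -/
lemma IsModel.exists_logMGF_sub_le (S : IsModel Q κ h) {b : ℝ}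
    (hfin : ∀ᵐ ξ ∂Q, hittingMGF κ h ξ b ≠ ⊤) (hb : β' < b) (hβ : β ≤ β') :
    ∃ K : ℝ, ∀ᵐ ξ ∂Q, logMGF κ h ξ β' - logMGF κ h ξ β ≤ K := by
  set q := κ * (1 + h) / 2 with hq
  set p := κ * (1 - h) / 2 with hp
  set C := q / (b - β') with hC
  have hfin' := S.ae_ne_top_mono hfin hb.le
  refine ⟨Real.log (1 + (p * C + (β' - β)) / q * C), ?_⟩
  filter_upwards [S.ae_isRiccati hfin', S.ae_isRiccati (S.ae_ne_top_mono hfin' hβ),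
    S.ae_le_div hfin hb] with ξ h1 h2 h3
  have h4 := h1.inv_le (δ := β' - β) (C := C) (H' := fun k =>
    (hittingMGF κ h (fun x => ξ (x + k)) β).toReal) (by convert h2 using 2; ring)
    S.right_pos S.left_nonneg h3 0
  have e1 := h1.pos 0
  have e2 := h2.pos 0
  have e3 := h3 0
  simp only [add_zero] at e1 e2 e3 h4
  rw [logMGF, logMGF, ← Real.log_div e1.ne' e2.ne']
  refine Real.log_le_log (div_pos e1 e2) ?_
  rw [div_eq_mul_inv]
  have hq0 : 0 < q := S.right_pos
  have hp0 : 0 ≤ p := S.left_nonneg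
  have hC0 : 0 ≤ C := div_nonneg hq0.le (by linarith)
  have h5 : 0 ≤ (p * C + (β' - β)) / q := div_nonneg (by nlinarith) hq0.le
  calc (hittingMGF κ h ξ β').toReal * (hittingMGF κ h ξ β).toReal⁻¹
      ≤ (hittingMGF κ h ξ β').toReal * ((hittingMGF κ h ξ β').toReal⁻¹ +
        (p * C + (β' - β)) / q) := mul_le_mul_of_nonneg_left h4 e1.le
    _ = 1 + (p * C + (β' - β)) / q * (hittingMGF κ h ξ β').toReal := by
        rw [mul_add, mul_inv_cancel₀ e1.ne']; ring
    _ ≤ _ := by gcongr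

/-! ### The critical value -/

lemma IsModel.log_hittingMGF (S : IsModel Q κ h) {ξ : ℤ → ℝ} (hξ : hittingMGF κ h ξ β ≠ ⊤) :
    ENNReal.log (hittingMGF κ h ξ β) = (logMGF κ h ξ β : EReal) :=
  ENNReal.log_pos_real (hittingMGF_pos S.kappa_pos S.drift_pos S.drift_le ξ β).ne' hξ

lemma IsModel.Lplus_eq (S : IsModel Q κ h) (hfin : ∀ᵐ ξ ∂Q, hittingMGF κ h ξ β ≠ ⊤) :
    Lplus Q κ h β = ∫⁻ ξ, ENNReal.ofReal (logMGF κ h ξ β) ∂Q :=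
  lintegral_congr_ae (hfin.mono fun ξ hξ => by
    simp only [S.log_hittingMGF hξ, EReal.real_coe_toENNReal])

lemma IsModel.Lminus_eq (S : IsModel Q κ h) (hfin : ∀ᵐ ξ ∂Q, hittingMGF κ h ξ β ≠ ⊤) :
    Lminus Q κ h β = ∫⁻ ξ, ENNReal.ofReal (-logMGF κ h ξ β) ∂Q :=
  lintegral_congr_ae (hfin.mono fun ξ hξ => by
    simp only [S.log_hittingMGF hξ, ← EReal.coe_neg, EReal.real_coe_toENNReal])

lemma IsModel.ae_ne_top_of_Lplus (S : IsModel Q κ h) (hL : Lplus Q κ h β < ⊤) :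
    ∀ᵐ ξ ∂Q, hittingMGF κ h ξ β ≠ ⊤ := by
  filter_upwards [ae_lt_top (measurable_ereal_toENNReal.comp (ENNReal.measurable_log.comp
    (measurable_hittingMGF S.kappa_pos S.drift_pos S.drift_le β))) hL.ne] with ξ hξ htop
  simp [htop] at hξ

/-- The bound of `ae_logMGF_le` is a constant. Consequently `β_cr` is also the threshold for almost
sure finiteness of the hitting functional. -/
lemma IsModel.Lplus_lt_top [IsProbabilityMeasure Q] (S : IsModel Q κ h)
    (hfin : ∀ᵐ ξ ∂Q, hittingMGF κ h ξ β' ≠ ⊤) (hβ : β < β') : Lplus Q κ h β < ⊤ := by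
  rw [S.Lplus_eq (S.ae_ne_top_mono hfin hβ.le)]
  refine (lintegral_mono_ae ((S.ae_logMGF_le hfin hβ).mono fun ξ hξ =>
    ENNReal.ofReal_le_ofReal hξ)).trans_lt ?_
  simp

/-- Almost sure finiteness forces `κ - ξ(1) - β > 0` almost surely, which cannot hold for
arbitrarily large `β` since `ξ(1)` is real. -/
lemma IsModel.bddAbove (S : IsModel Q κ h) [IsProbabilityMeasure Q] :
    BddAbove {β : ℝ | Lplus Q κ h β < ⊤} := by
  by_contra hcon
  rw [not_bddAbove_iff] at hcon
  have h1 : ∀ n : ℕ, ∀ᵐ ξ ∂Q, ξ 1 < κ - n := fun n => by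
    obtain ⟨b, hb, hn⟩ := hcon n
    filter_upwards [S.ae_isRiccati (S.ae_ne_top_of_Lplus hb)] with ξ hξ
    have := hξ.coeff_pos S.right_pos S.left_nonneg 1
    linarith
  obtain ⟨ξ, hξ⟩ := (ae_all_iff.2 h1).exists
  obtain ⟨n, hn⟩ := exists_nat_ge (κ - ξ 1)
  linarith [hξ n]

lemma IsModel.Lplus_zero (S : IsModel Q κ h) : Lplus Q κ h 0 = 0 := by
  refine lintegral_eq_zero_of_ae_eq_zero ?_
  filter_upwards [S.nonpos] with ξ hξ
  have h1 := ENNReal.log_monotone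
    (hittingMGF_le_one S.kappa_pos S.drift_pos S.drift_le hξ le_rfl)
  rw [ENNReal.log_one] at h1
  exact EReal.toENNReal_of_nonpos h1

lemma IsModel.betaCr_nonneg (S : IsModel Q κ h) [IsProbabilityMeasure Q] : 0 ≤ betaCr Q κ h :=
  le_csSup S.bddAbove (by simp [S.Lplus_zero])

lemma IsModel.exists_ae_ne_top (S : IsModel Q κ h) (hβ : β < betaCr Q κ h) :
    ∃ b, β < b ∧ ∀ᵐ ξ ∂Q, hittingMGF κ h ξ b ≠ ⊤ := by
  obtain ⟨b, hb, hlt⟩ := exists_lt_of_lt_csSup ⟨0, by simp [S.Lplus_zero]⟩ hβ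
  exact ⟨b, hlt, S.ae_ne_top_of_Lplus hb⟩

lemma IsModel.ae_ne_top (S : IsModel Q κ h) (hβ : β < betaCr Q κ h) :
    ∀ᵐ ξ ∂Q, hittingMGF κ h ξ β ≠ ⊤ := by
  obtain ⟨b, hb, hfin⟩ := S.exists_ae_ne_top hβ
  exact S.ae_ne_top_mono hfin hb.le

lemma IsModel.Lplus_ne_top (S : IsModel Q κ h) [IsProbabilityMeasure Q] (hβ : β < betaCr Q κ h) :
    Lplus Q κ h β ≠ ⊤ := by
  obtain ⟨b, hb, hfin⟩ := S.exists_ae_ne_top hβ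
  exact (S.Lplus_lt_top hfin hb).ne

lemma IsModel.not_ae_ne_top (S : IsModel Q κ h) [IsProbabilityMeasure Q]
    (hβ : betaCr Q κ h < β) : ¬ ∀ᵐ ξ ∂Q, hittingMGF κ h ξ β ≠ ⊤ := fun hfin => by
  obtain ⟨b, hb1, hb2⟩ := exists_between hβ
  exact absurd (le_csSup S.bddAbove (S.Lplus_lt_top hfin hb2)) (not_le.2 hb1)

/-! ### Monotonicity and the dichotomy -/

lemma IsModel.monotone_L (S : IsModel Q κ h) : Monotone (L Q κ h) := fun β β' hβ => by
  have hmono := fun ξ => ENNReal.log_monotone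
    (hittingMGF_mono S.kappa_pos S.drift_pos S.drift_le ξ hβ)
  refine EReal.sub_le_sub ?_ ?_
  · exact_mod_cast lintegral_mono fun ξ => EReal.toENNReal_le_toENNReal (hmono ξ)
  · exact_mod_cast lintegral_mono fun ξ => EReal.toENNReal_le_toENNReal
      (EReal.neg_le_neg_iff.2 (hmono ξ))

/-- One half of the dichotomy: towards larger `β` monotonicity suffices, towards smaller `β` the
uniform bound on increments does. Its contrapositive gives `L_eq_bot`. -/
lemma IsModel.Lminus_ne_top (S : IsModel Q κ h) [IsProbabilityMeasure Q]
    (hβ' : β' < betaCr Q κ h) (hL : Lminus Q κ h β' ≠ ⊤) (hβ : β < betaCr Q κ h) :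
    Lminus Q κ h β ≠ ⊤ := by
  have hfin := S.ae_ne_top hβ
  have hfin' := S.ae_ne_top hβ'
  rw [S.Lminus_eq hfin'] at hL
  rw [S.Lminus_eq hfin]
  obtain ⟨K, hK⟩ : ∃ K : ℝ, ∀ᵐ ξ ∂Q, logMGF κ h ξ β' - logMGF κ h ξ β ≤ K := by
    rcases le_total β β' with hle | hle
    · obtain ⟨b, hb, hbfin⟩ := S.exists_ae_ne_top hβ'
      exact S.exists_logMGF_sub_le hbfin hb hle
    · exact ⟨0, (S.logMGF_mono hfin hle).mono fun ξ hξ => by linarith⟩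
  refine ne_top_of_le_ne_top (b := ∫⁻ ξ, (ENNReal.ofReal (-logMGF κ h ξ β') + ENNReal.ofReal K) ∂Q)
    ?_ (lintegral_mono_ae (hK.mono fun ξ hξ => ?_))
  · rw [lintegral_add_right _ measurable_const]
    simp [hL]
  · exact (ENNReal.ofReal_le_ofReal (by linarith)).trans ENNReal.ofReal_add_le

lemma IsModel.L_eq_bot (S : IsModel Q κ h) [IsProbabilityMeasure Q]
    (hβ' : β' < betaCr Q κ h) (hL : Lminus Q κ h β' = ⊤) (hβ : β < betaCr Q κ h) :
    L Q κ h β = ⊥ := by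
  have : Lminus Q κ h β = ⊤ := by
    by_contra hcon
    exact S.Lminus_ne_top hβ hcon hβ' hL
  rw [L, this, EReal.coe_ennreal_top, EReal.sub_top]

lemma IsModel.integrable_logMGF (S : IsModel Q κ h) [IsProbabilityMeasure Q]
    (hβ : β < betaCr Q κ h) (hL : Lminus Q κ h β ≠ ⊤) :
    Integrable (fun ξ => logMGF κ h ξ β) Q := by
  have hfin := S.ae_ne_top hβ
  have h1 := S.Lplus_ne_top hβ
  rw [S.Lplus_eq hfin] at h1
  rw [S.Lminus_eq hfin] at hL
  have hm := measurable_logMGF S.kappa_pos S.drift_pos S.drift_le β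
  refine ⟨hm.aestronglyMeasurable, ?_⟩
  rw [hasFiniteIntegral_iff_norm]
  refine (lintegral_mono (g := fun ξ => ENNReal.ofReal (logMGF κ h ξ β) +
    ENNReal.ofReal (-logMGF κ h ξ β)) fun ξ => ?_).trans_lt ?_
  · rw [Real.norm_eq_abs]
    rcases le_total 0 (logMGF κ h ξ β) with h0 | h0
    · rw [abs_of_nonneg h0]; exact le_self_add
    · rw [abs_of_nonpos h0]; exact le_add_self
  · rw [lintegral_add_left hm.ennreal_ofReal]
    exact ENNReal.add_lt_top.2 ⟨lt_top_iff_ne_top.2 h1, lt_top_iff_ne_top.2 hL⟩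

/-- `L` as a real function, relevant when it is finite. -/
def realL (Q : Measure (ℤ → ℝ)) (κ h β : ℝ) : ℝ := ∫ ξ, logMGF κ h ξ β ∂Q

lemma IsModel.L_eq_coe (S : IsModel Q κ h) [IsProbabilityMeasure Q]
    (hβ : β < betaCr Q κ h) (hL : Lminus Q κ h β ≠ ⊤) : L Q κ h β = (realL Q κ h β : EReal) := by
  have hfin := S.ae_ne_top hβ
  have h1 := S.Lplus_ne_top hβ
  rw [realL, integral_eq_lintegral_pos_part_sub_lintegral_neg_part (S.integrable_logMGF hβ hL),
    L, ← S.Lplus_eq hfin, ← S.Lminus_eq hfin, EReal.coe_sub, EReal.coe_ennreal_toReal h1,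
    EReal.coe_ennreal_toReal hL]

/-! ### Convexity and differentiability -/

/-- The mean of the logarithmic derivative of `hittingMGF`. -/
def derivL (Q : Measure (ℤ → ℝ)) (κ h β : ℝ) : ℝ :=
  ∫ ξ, (hittingMean κ h ξ β / hittingMGF κ h ξ β).toReal ∂Q

/-- `L` is finite below the critical value. -/
def IsFiniteL (Q : Measure (ℤ → ℝ)) (κ h : ℝ) : Prop :=
  ∀ β < betaCr Q κ h, Lminus Q κ h β ≠ ⊤

lemma IsModel.convexOn_realL (S : IsModel Q κ h) [IsProbabilityMeasure Q]
    (F : IsFiniteL Q κ h) : ConvexOn ℝ (Set.Iio (betaCr Q κ h)) (realL Q κ h) := by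
  refine ⟨convex_Iio _, fun x hx y hy a b ha hb hab => ?_⟩
  have hxy := convex_Iio (betaCr Q κ h) hx hy ha hb hab
  rw [Set.mem_Iio] at hx hy hxy
  have ix := S.integrable_logMGF hx (F x hx)
  have iy := S.integrable_logMGF hy (F y hy)
  simp only [realL, smul_eq_mul]
  rw [← integral_const_mul, ← integral_const_mul, ← integral_add (ix.const_mul a) (iy.const_mul b)]
  refine integral_mono_ae (S.integrable_logMGF hxy (F _ hxy))
    ((ix.const_mul a).add (iy.const_mul b)) ?_
  obtain ⟨c, hc, hfin⟩ := S.exists_ae_ne_top (max_lt hx hy)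
  filter_upwards [hfin] with ξ hξ
  exact (convexOn_logMGF S.kappa_pos S.drift_pos S.drift_le hξ).2
    (Set.mem_Iio.2 ((le_max_left _ _).trans_lt hc)) (Set.mem_Iio.2 ((le_max_right _ _).trans_lt hc))
    ha hb hab

lemma IsModel.hasDerivAt_realL (S : IsModel Q κ h) [IsProbabilityMeasure Q]
    (F : IsFiniteL Q κ h) (hβ : β < betaCr Q κ h) :
    Integrable (fun ξ => (hittingMean κ h ξ β / hittingMGF κ h ξ β).toReal) Q ∧
      HasDerivAt (realL Q κ h) (derivL Q κ h β) β := by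
  obtain ⟨b, hb, hfin⟩ := S.exists_ae_ne_top hβ
  obtain ⟨b₁, hb₁, hb₁'⟩ := exists_between hb
  obtain ⟨b₂, hb₂, hb₂'⟩ := exists_between hb₁
  obtain ⟨K, hK⟩ := S.exists_logMGF_sub_le hfin hb₁' (show β - 1 ≤ b₁ by linarith)
  have hm := fun b => measurable_logMGF S.kappa_pos S.drift_pos S.drift_le b
  have hd : ∀ᵐ ξ ∂Q, ∀ x < b, HasDerivAt (logMGF κ h ξ)
      (hittingMean κ h ξ x / hittingMGF κ h ξ x).toReal x := by
    filter_upwards [hfin] with ξ hξ x hx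
    exact hasDerivAt_logMGF S.kappa_pos S.drift_pos S.drift_le hξ hx
  refine hasDerivAt_integral_of_dominated_loc_of_deriv_le (F := fun x ξ => logMGF κ h ξ x)
    (F' := fun x ξ => (hittingMean κ h ξ x / hittingMGF κ h ξ x).toReal)
    (s := Set.Ioo (β - 1) b₂) (bound := fun _ => K / (b₁ - b₂))
    (Ioo_mem_nhds (by linarith) hb₂) (Eventually.of_forall fun x => (hm x).aestronglyMeasurable)
    (S.integrable_logMGF hβ (F β hβ)) ?_ ?_ (integrable_const _) ?_
  · refine AEMeasurable.aestronglyMeasurable ?_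
    -- The derivative is measurable as an almost sure limit of difference quotients.
    refine aemeasurable_of_tendsto_metrizable_ae (u := 𝓝[>] (0 : ℝ))
      (f := fun t ξ => t⁻¹ • (logMGF κ h ξ (β + t) - logMGF κ h ξ β))
      (fun t => (((hm (β + t)).sub (hm β)).const_mul t⁻¹).aemeasurable) ?_
    filter_upwards [hd] with ξ hξ
    exact (hξ β hb).tendsto_slope_zero_right
  · filter_upwards [hd, hfin, hK, S.logMGF_mono (S.ae_ne_top_mono hfin hb₁'.le)
      (show β - 1 ≤ b₁ by linarith)] with ξ hξ1 hξ2 hξ3 hξ5 x hx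
    rw [Real.norm_of_nonneg ENNReal.toReal_nonneg]
    have hc := convexOn_logMGF S.kappa_pos S.drift_pos S.drift_le hξ2
    have hxb : x < b₁ := hx.2.trans hb₂'
    -- By convexity the derivative on `(β - 1, b₂)` is at most the secant slope up to `b₁`, hence at
    -- most `K / (b₁ - b₂)` uniformly in the potential.
    have h4 := hc.le_slope_of_hasDerivAt (Set.mem_Iio.2 (hxb.trans hb₁'))
      (Set.mem_Iio.2 hb₁') hxb (hξ1 x (hxb.trans hb₁'))
    refine h4.trans ?_
    rw [slope_def_field]
    have h5 : logMGF κ h ξ b₁ - logMGF κ h ξ x ≤ K := by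
      have := PAM.logMGF_mono S.kappa_pos S.drift_pos S.drift_le (ne_top_of_le_ne_top hξ2
        (hittingMGF_mono S.kappa_pos S.drift_pos S.drift_le ξ (hxb.trans hb₁').le)) hx.1.le
      linarith
    exact div_le_div₀ (by linarith) h5 (by linarith) (by linarith [hx.2])
  · filter_upwards [hd] with ξ hξ x hx
    exact hξ x (hx.2.trans (hb₂'.trans hb₁'))

lemma IsModel.hasDerivL (S : IsModel Q κ h) [IsProbabilityMeasure Q]
    (F : IsFiniteL Q κ h) (hβ : β < betaCr Q κ h) : HasDerivL Q κ h (derivL Q κ h β) β := by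
  have hev : ∀ᶠ b in 𝓝 β, L Q κ h b = (realL Q κ h b : EReal) := by
    filter_upwards [Iio_mem_nhds hβ] with b hb
    exact S.L_eq_coe hb (F b hb)
  refine ⟨hev.mono fun b hb => by simp [hb], ?_⟩
  refine (S.hasDerivAt_realL F hβ).2.congr_of_eventuallyEq (hev.mono fun b hb => ?_)
  simp [hb]

lemma IsModel.ofReal_derivL (S : IsModel Q κ h) [IsProbabilityMeasure Q]
    (F : IsFiniteL Q κ h) (hβ : β < betaCr Q κ h) : ENNReal.ofReal (derivL Q κ h β) =
      ∫⁻ ξ, hittingMean κ h ξ β / hittingMGF κ h ξ β ∂Q := by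
  obtain ⟨b, hb, hfin⟩ := S.exists_ae_ne_top hβ
  rw [derivL, ofReal_integral_eq_lintegral_ofReal (S.hasDerivAt_realL F hβ).1
    (ae_of_all _ fun ξ => ENNReal.toReal_nonneg)]
  refine lintegral_congr_ae (hfin.mono fun ξ hξ => ENNReal.ofReal_toReal ?_)
  exact ENNReal.div_ne_top (hittingMean_ne_top S.kappa_pos S.drift_pos S.drift_le hξ hb)
    (hittingMGF_pos S.kappa_pos S.drift_pos S.drift_le ξ β).ne'

lemma IsModel.derivL_pos (S : IsModel Q κ h) [IsProbabilityMeasure Q]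
    (F : IsFiniteL Q κ h) (hβ : β < betaCr Q κ h) : 0 < derivL Q κ h β := by
  obtain ⟨b, hb, hfin⟩ := S.exists_ae_ne_top hβ
  rw [derivL, integral_pos_iff_support_of_nonneg_ae (ae_of_all _ fun ξ => ENNReal.toReal_nonneg)
    (S.hasDerivAt_realL F hβ).1]
  have : ∀ᵐ ξ ∂Q, ξ ∈ Function.support fun ξ =>
      (hittingMean κ h ξ β / hittingMGF κ h ξ β).toReal := by
    filter_upwards [hfin] with ξ hξ
    refine (ENNReal.toReal_pos ?_ ?_).ne'
    · exact (ENNReal.div_pos (hittingMean_ne_zero S.kappa_pos S.drift_pos S.drift_le)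
        (ne_top_of_le_ne_top hξ (hittingMGF_mono S.kappa_pos S.drift_pos S.drift_le ξ hb.le))).ne'
    · exact ENNReal.div_ne_top (hittingMean_ne_top S.kappa_pos S.drift_pos S.drift_le hξ hb)
        (hittingMGF_pos S.kappa_pos S.drift_pos S.drift_le ξ β).ne'
  have h2 : Q (Function.support fun ξ =>
      (hittingMean κ h ξ β / hittingMGF κ h ξ β).toReal) = Q Set.univ := by
    refine measure_congr ?_
    filter_upwards [this] with ξ hξ
    exact propext ⟨fun _ => trivial, fun _ => hξ⟩
  rw [h2]
  simp

lemma IsModel.derivL_mono (S : IsModel Q κ h) [IsProbabilityMeasure Q]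
    (F : IsFiniteL Q κ h) : MonotoneOn (derivL Q κ h) (Set.Iio (betaCr Q κ h)) := by
  intro x hx y hy hxy
  have := (S.convexOn_realL F).monotoneOn_deriv
    (fun z hz => (S.hasDerivAt_realL F hz).2.differentiableAt) hx hy hxy
  rwa [(S.hasDerivAt_realL F hx).2.deriv, (S.hasDerivAt_realL F hy).2.deriv] at this

lemma IsModel.realL_add_le (S : IsModel Q κ h) [IsProbabilityMeasure Q]
    (F : IsFiniteL Q κ h) (hβ : β < betaCr Q κ h) (hβ' : β' < betaCr Q κ h) :
    realL Q κ h β + (β' - β) * derivL Q κ h β ≤ realL Q κ h β' := by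
  have hc := S.convexOn_realL F
  have hd := (S.hasDerivAt_realL F hβ).2
  rcases lt_trichotomy β β' with hlt | rfl | hlt
  · have := hc.le_slope_of_hasDerivAt hβ hβ' hlt hd
    rw [slope_def_field, le_div_iff₀ (by linarith)] at this
    linarith
  · simp
  · have := hc.slope_le_of_hasDerivAt hβ' hβ hlt hd
    rw [slope_def_field, div_le_iff₀ (by linarith)] at this
    linarith

lemma IsModel.strictMonoOn_realL (S : IsModel Q κ h) [IsProbabilityMeasure Q]
    (F : IsFiniteL Q κ h) : StrictMonoOn (realL Q κ h) (Set.Iio (betaCr Q κ h)) := by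
  intro x hx y hy hxy
  have := S.realL_add_le F hx hy
  nlinarith [S.derivL_pos F hx]

lemma IsModel.exists_realL_neg (S : IsModel Q κ h) [IsProbabilityMeasure Q]
    (F : IsFiniteL Q κ h) : ∃ β < betaCr Q κ h, realL Q κ h β < 0 := by
  have hq := S.right_pos
  have hlt : betaCr Q κ h - 1 < betaCr Q κ h := by linarith
  set b := betaCr Q κ h - 1
  -- Going `q + 1` below `b` makes the bound `q / (b - β)` less than `1`, so that its logarithm is
  -- negative.
  set β := b - (κ * (1 + h) / 2 + 1) with hβ
  have hβb : β < b := by linarith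
  refine ⟨β, hβb.trans hlt, ?_⟩
  have h1 : realL Q κ h β ≤ Real.log (κ * (1 + h) / 2 / (b - β)) := by
    have := integral_mono_ae (S.integrable_logMGF (hβb.trans hlt) (F _ (hβb.trans hlt)))
      (integrable_const _) (S.ae_logMGF_le (S.ae_ne_top hlt) hβb)
    simpa [realL] using this
  refine h1.trans_lt (Real.log_neg (div_pos hq (by linarith)) ?_)
  rw [div_lt_one (by linarith)]
  linarith

end Model

end

end PAM

/-! ### Quenched kernel bounds: exponential upper bounds, and lower bounds from exploding loops. -/

namespace PAM

noncomputable section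

/-! ### Upper bounds for the quenched kernel -/

/-- The spare exponent `d` produces a geometric series, so summing over infinitely many end points
costs only a constant. -/
lemma tsum_indicator_le_of_le_exp {f : ℕ → ℝ≥0∞} {C β c d t γ : ℝ} {s : Set ℕ} (hd : 0 < d)
    (hf : ∀ n, f n ≤ ENNReal.ofReal (Real.exp (-β * t)) *
      ENNReal.ofReal (Real.exp (C + (c - d) * n)))
    (hs : ∀ n ∈ s, -β * t + c * n ≤ -γ * t) :
    ∑' n, s.indicator f n ≤
      ENNReal.ofReal (Real.exp C * (1 - Real.exp (-d))⁻¹ * Real.exp (-γ * t)) := by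
  have hr : Real.exp (-d) < 1 := by rw [Real.exp_lt_one_iff]; linarith
  calc ∑' n, s.indicator f n
      ≤ ∑' n : ℕ, ENNReal.ofReal (Real.exp C * Real.exp (-γ * t)) *
        ENNReal.ofReal (Real.exp (-d)) ^ n := by
        refine ENNReal.tsum_le_tsum fun n => ?_
        by_cases hn : n ∈ s
        · rw [Set.indicator_of_mem hn]
          refine (hf n).trans ?_
          rw [← ENNReal.ofReal_mul (Real.exp_pos _).le, ← ENNReal.ofReal_pow (Real.exp_pos _).le,
            ← ENNReal.ofReal_mul (by positivity), ← Real.exp_add, ← Real.exp_add,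
            ← Real.exp_nat_mul, ← Real.exp_add]
          refine ENNReal.ofReal_le_ofReal (Real.exp_le_exp.2 ?_)
          linarith [hs n hn]
        · rw [Set.indicator_of_notMem hn]; exact zero_le
    _ = _ := by
        rw [ENNReal.tsum_mul_left, ENNReal.tsum_geometric, ← ENNReal.ofReal_one,
          ← ENNReal.ofReal_sub _ (Real.exp_pos _).le, ← ENNReal.ofReal_inv_of_pos (by linarith),
          ← ENNReal.ofReal_mul (by positivity)]
        congr 1; ring

section Quenched

variable {Q : Measure (ℤ → ℝ)} {κ h β β' c : ℝ}

lemma IsRiccati.prod_eq_exp {q p : ℝ} {A : ℤ → ℝ} {ξ : ℤ → ℝ}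
    (hR : IsRiccati q p A fun k => (hittingMGF κ h (fun x => ξ (x + k)) β).toReal) (n : ℕ) :
    ∏ k ∈ Finset.range n, (hittingMGF κ h (fun x => ξ (x + (k : ℤ))) β).toReal =
      Real.exp (birkhoffSum shift (fun ξ => logMGF κ h ξ β) n ξ) := by
  rw [birkhoffSum, Real.exp_sum]
  refine Finset.prod_congr rfl fun k _ => ?_
  rw [shift_iterate, logMGF, Real.exp_log (hR.pos k)]

lemma IsRiccati.prod_neg_eq_exp {q p : ℝ} {A : ℤ → ℝ} {ξ : ℤ → ℝ}
    (hR : IsRiccati q p A fun k => (hittingMGF κ h (fun x => ξ (x + k)) β).toReal) (n : ℕ) :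
    ∏ k ∈ Finset.range n, (hittingMGF κ h (fun x => ξ (x + -((k : ℤ) + 1))) β).toReal =
      Real.exp (birkhoffSum shiftEquiv.symm (fun ξ => logMGF κ h ξ β) n (shiftEquiv.symm ξ)) := by
  rw [birkhoffSum, Real.exp_sum]
  refine Finset.prod_congr rfl fun k _ => ?_
  have : shiftEquiv.symm^[k] (shiftEquiv.symm ξ) = fun x => ξ (x + -((k : ℤ) + 1)) := by
    rw [← Function.iterate_succ_apply, shiftEquiv_symm_iterate]
    ext x; congr 1
  rw [this, logMGF, Real.exp_log (hR.pos _)]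

/-- The harmonic bound is a product along the orbit of the shift, controlled for all `n` at once by
the ergodic upper bound; the constant depends on the potential only, not on `n` or `t`. -/
lemma IsModel.ae_kernel_right_le [IsProbabilityMeasure Q] (S : IsModel Q κ h) (hβ : β < betaCr Q κ h)
    (hc : L Q κ h β < c) : ∀ᵐ ξ ∂Q, ∃ C : ℝ, ∀ (n : ℕ) (t : ℝ),
      rightKernel κ h ξ (point n) 0 t ≤
        expKernel (-β) t * ENNReal.ofReal (Real.exp (C + c * n)) := by
  have hfin := S.ae_ne_top hβ
  have hb := ae_birkhoffSum_le S.ergodic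
    (measurable_logMGF S.kappa_pos S.drift_pos S.drift_le β)
    (by rw [← S.Lplus_eq hfin]; exact S.Lplus_ne_top hβ) (c := c)
    (by rw [← S.Lplus_eq hfin, ← S.Lminus_eq hfin]; exact hc)
  filter_upwards [hb, S.ae_isRiccati hfin] with ξ ⟨C, hC⟩ hR
  refine ⟨C, fun n t => (hR.kernel_right_le (v := fun x => ξ x - κ) S.right_pos
    S.left_nonneg n t).trans ?_⟩
  rw [hR.prod_eq_exp]
  gcongr
  exact hC n

lemma IsModel.ae_kernel_left_le [IsProbabilityMeasure Q] (S : IsModel Q κ h) (hβ : β < betaCr Q κ h)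
    (hc : L Q κ h β < c) : ∀ᵐ ξ ∂Q, ∃ C : ℝ, ∀ (n : ℕ) (t : ℝ),
      rightKernel κ h ξ (point (-n)) 0 t ≤
        expKernel (-β) t * ENNReal.ofReal (Real.exp (C + (c - h) * n)) := by
  have hfin := S.ae_ne_top hβ
  have hT := ergodic_shift_symm S.ergodic
  have hb := ae_birkhoffSum_le hT
    (measurable_logMGF S.kappa_pos S.drift_pos S.drift_le β)
    (by rw [← S.Lplus_eq hfin]; exact S.Lplus_ne_top hβ) (c := c)
    (by rw [← S.Lplus_eq hfin, ← S.Lminus_eq hfin]; exact hc)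
  filter_upwards [hT.toMeasurePreserving.quasiMeasurePreserving.ae hb, S.ae_isRiccati hfin]
    with ξ ⟨C, hC⟩ hR
  refine ⟨C, fun n t => (hR.kernel_left_le (v := fun x => ξ x - κ) S.right_pos
    S.left_nonneg n t).trans ?_⟩
  rw [hR.prod_neg_eq_exp]
  gcongr
  have h0 := S.drift_pos
  have h1 := S.drift_le
  have hκ := S.kappa_pos
  -- The cost per step to the left: `(1 - h)/(1 + h) ≤ 1 - h ≤ exp(-h)`.
  have hρ : κ * (1 - h) / 2 / (κ * (1 + h) / 2) ≤ Real.exp (-h) := by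
    rw [div_le_iff₀ S.right_pos]
    have : 1 - h ≤ Real.exp (-h) := by linarith [Real.add_one_le_exp (-h)]
    nlinarith [Real.exp_pos (-h), mul_pos hκ h0]
  have hρ0 : 0 ≤ κ * (1 - h) / 2 / (κ * (1 + h) / 2) := div_nonneg S.left_nonneg S.right_pos.le
  calc _ ≤ Real.exp (-h) ^ n * Real.exp (C + c * n) := by
        gcongr
        exact hC n
    _ = _ := by rw [← Real.exp_nat_mul, ← Real.exp_add]; congr 1; ring

lemma IsModel.ae_tsum_right_le [IsProbabilityMeasure Q] (S : IsModel Q κ h) (hβ : β < betaCr Q κ h)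
    (hc : L Q κ h β < c) : ∀ᵐ ξ ∂Q, ∃ C : ℝ, ∀ t : ℝ, 0 ≤ t → ∀ (s : Set ℕ) (γ : ℝ),
      (∀ n ∈ s, -β * t + c * n ≤ -γ * t) →
        ∑' n : ℕ, s.indicator (fun n : ℕ => rightKernel κ h ξ (point n) 0 t) n ≤
          ENNReal.ofReal (C * Real.exp (-γ * t)) := by
  obtain ⟨c', hc1, hc2⟩ := EReal.lt_iff_exists_real_btwn.1 hc
  have hc3 : c' < c := by exact_mod_cast hc2
  filter_upwards [S.ae_kernel_right_le hβ hc1] with ξ ⟨C, hC⟩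
  refine ⟨_, fun t ht s γ hs => tsum_indicator_le_of_le_exp (C := C) (β := β) (c := c)
    (d := c - c') (by linarith) (fun n => ?_) hs⟩
  have := hC n t
  rwa [expKernel_of_nonneg _ ht, ← sub_sub_cancel c c'] at this

lemma IsModel.ae_tsum_left_le [IsProbabilityMeasure Q] (S : IsModel Q κ h) (hβ : β < betaCr Q κ h)
    (hc : L Q κ h β < c) : ∀ᵐ ξ ∂Q, ∃ C : ℝ, ∀ t : ℝ, 0 ≤ t → ∀ (s : Set ℕ) (γ : ℝ),
      (∀ n ∈ s, -β * t + (c - h) * n ≤ -γ * t) →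
        ∑' n : ℕ, s.indicator (fun n : ℕ => rightKernel κ h ξ (point (-n)) 0 t) n ≤
          ENNReal.ofReal (C * Real.exp (-γ * t)) := by
  obtain ⟨c', hc1, hc2⟩ := EReal.lt_iff_exists_real_btwn.1 hc
  have hc3 : c' < c := by exact_mod_cast hc2
  filter_upwards [S.ae_kernel_left_le hβ hc1] with ξ ⟨C, hC⟩
  refine ⟨_, fun t ht s γ hs => tsum_indicator_le_of_le_exp (C := C) (β := β) (c := c - h)
    (d := c - c') (by linarith) (fun n => ?_) hs⟩
  have := hC n t
  rwa [expKernel_of_nonneg _ ht, show c' - h = c - h - (c - c') by ring] at this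

/-! ### Lower bounds near a point where the hitting functional explodes -/

/-- If the kernel vanished at all times, so would its Laplace transform at `0`, which dominates a
positive multiple of a product of positive hitting functionals. -/
lemma IsModel.exists_kernel_pos (S : IsModel Q κ h) (ξ : ℤ → ℝ) (n : ℕ) :
    ∃ t, 0 ≤ t ∧ 0 < rightKernel κ h ξ (point n) 0 t := by
  by_contra! hcon
  have hz : ∀ t, rightKernel κ h ξ (point n) 0 t = 0 := fun t => by
    rcases lt_or_ge t 0 with ht | ht
    · exact kernel_of_neg ht 0
    · exact le_antisymm (hcon t ht) zero_le
  have h1 := hitTotal_mul_inv_le (q := ENNReal.ofReal (κ * (1 + h) / 2))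
    (p := ENNReal.ofReal (κ * (1 - h) / 2)) (a := fun z => ENNReal.ofReal (-(ξ z - κ) - 0)) n
  rw [← laplace_kernel 0 (v := fun z => ξ z - κ)] at h1
  simp only [kernel_reverse (n : ℤ) 0] at h1
  simp only [hz, mul_zero, lintegral_zero, nonpos_iff_eq_zero, mul_eq_zero, ENNReal.inv_eq_zero,
    ENNReal.ofReal_ne_top, or_false] at h1
  rw [hitTotal_natCast, Finset.prod_eq_zero_iff] at h1
  obtain ⟨k, -, hk⟩ := h1
  refine (hitTotal_one_pos ?_ ?_).ne' hk
  · simpa using S.right_pos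
  · exact ENNReal.ofReal_ne_top

/-- If all loops had weight at most `exp(-β' t)`, the Laplace transform of the return kernel at `β <
β'` would converge, and it bounds the hitting functional from above. -/
lemma IsModel.exists_rightKernel_loop_gt (S : IsModel Q κ h) {ξ : ℤ → ℝ} {k : ℤ}
    (hk : hittingMGF κ h (fun x => ξ (x + k)) β = ⊤) (hβ : β < β') :
    ∃ T, 0 < T ∧ ENNReal.ofReal (Real.exp (-β' * T)) <
      rightKernel κ h ξ (point (1 + k)) (1 + k) T := by
  by_contra! hcon
  rw [hittingMGF_eq_hitTotal S.kappa_pos S.drift_pos S.drift_le] at hk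
  have h1 := hitTotal_one_le_greenSum (q := ENNReal.ofReal (κ * (1 + h) / 2))
    (p := ENNReal.ofReal (κ * (1 - h) / 2)) (a := fun x => ENNReal.ofReal (κ - ξ (x + k) - β))
  have e : (fun x => ENNReal.ofReal (κ - ξ (x + k) - β)) =
      fun x => ENNReal.ofReal (-(ξ (x + k) - κ) - β) := by
    ext x; congr 1; ring
  rw [hk, top_le_iff, e, ← laplace_kernel β (v := fun z => ξ (z + k) - κ)] at h1
  refine (ENNReal.mul_lt_top ENNReal.ofReal_lt_top ?_).ne h1
  have h2 : ∀ t, t ≠ 0 → ENNReal.ofReal (Real.exp (β * t)) *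
      kernel (ENNReal.ofReal (κ * (1 - h) / 2)) (ENNReal.ofReal (κ * (1 + h) / 2))
        (fun z => ξ (z + k) - κ) (point 1) 1 t ≤
      (Set.Ici 0).indicator (fun t => ENNReal.ofReal (Real.exp (-(β' - β) * t))) t := fun t ht => by
    rcases lt_or_ge t 0 with ht' | ht'
    · rw [kernel_of_neg ht', mul_zero]; exact zero_le
    · rw [Set.indicator_of_mem (Set.mem_Ici.2 ht'), kernel_reverse, kernel_point_translate (v := fun z => ξ z - κ) k]
      calc _ ≤ ENNReal.ofReal (Real.exp (β * t)) * ENNReal.ofReal (Real.exp (-β' * t)) :=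
            mul_le_mul' le_rfl (hcon t (lt_of_le_of_ne ht' ht.symm))
        _ = _ := by
            rw [← ENNReal.ofReal_mul (Real.exp_pos _).le, ← Real.exp_add]; congr 2; ring
  calc _ ≤ ∫⁻ t, (Set.Ici 0).indicator
          (fun t => ENNReal.ofReal (Real.exp (-(β' - β) * t))) t := by
        refine lintegral_mono_ae ?_
        filter_upwards [Measure.ae_ne volume 0] with t ht
        exact h2 t ht
    _ = (ENNReal.ofReal (β' - β))⁻¹ := by
        rw [lintegral_indicator measurableSet_Ici, lintegral_exp_neg_mul_Ici]
    _ < ⊤ := by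
        rw [ENNReal.inv_lt_top]
        exact ENNReal.ofReal_pos.2 (by linarith)

/-- Repeat the loop `⌊t / T⌋` times and rest at the site for the remaining time, which is at most
`T` and costs a constant factor. -/
lemma exists_le_kernel_loop {r l : ℝ≥0∞} {v : ℤ → ℝ} {z : ℤ} {T b : ℝ} (hT : 0 < T) (hb : 0 ≤ b)
    (hloop : ENNReal.ofReal (Real.exp (-b * T)) ≤ kernel r l v (point z) z T) :
    ∃ C : ℝ, 0 < C ∧ ∀ t, 0 ≤ t →
      ENNReal.ofReal (C * Real.exp (-b * t)) ≤ kernel r l v (point z) z t := by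
  have hn : ∀ n : ℕ, ENNReal.ofReal (Real.exp (-b * (n * T))) ≤
      kernel r l v (point z) z (n * T) := fun n => by
    induction n with
    | zero =>
      have := expKernel_le_kernel_point (r := r) (l := l) (v := v) z 0
      rw [expKernel_of_nonneg _ le_rfl] at this
      simpa using this
    | succ n ih =>
      refine le_trans ?_ ((mul_le_mul' ih hloop).trans
        ((kernel_mul_kernel_le hT.le (by positivity) z z).trans (le_of_eq ?_)))
      · rw [← ENNReal.ofReal_mul (Real.exp_pos _).le, ← Real.exp_add]
        refine ENNReal.ofReal_le_ofReal (Real.exp_le_exp.2 (le_of_eq ?_))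
        push_cast; ring
      · congr 1; push_cast; ring
  refine ⟨Real.exp (-|v z| * T), Real.exp_pos _, fun t ht => ?_⟩
  set n := ⌊t / T⌋₊ with hndef
  have h1 : n * T ≤ t := by
    rw [← le_div_iff₀ hT]; exact Nat.floor_le (by positivity)
  have h2 : t - n * T ≤ T := by
    have := (Nat.lt_floor_add_one (t / T)).le
    rw [div_le_iff₀ hT] at this
    linarith
  have h3 := expKernel_le_kernel_point (r := r) (l := l) (v := v) z (t - n * T)
  rw [expKernel_of_nonneg _ (by linarith)] at h3
  refine le_trans ?_ ((mul_le_mul' (hn n) h3).trans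
    ((kernel_mul_kernel_le (by linarith) (by positivity) z z).trans (le_of_eq ?_)))
  · rw [← ENNReal.ofReal_mul (Real.exp_pos _).le, ← Real.exp_add, ← Real.exp_add]
    refine ENNReal.ofReal_le_ofReal (Real.exp_le_exp.2 ?_)
    have h4 : -|v z| * T ≤ v z * (t - n * T) := by
      have := neg_abs_le (v z)
      nlinarith [abs_nonneg (v z)]
    have h5 : -b * t ≤ -b * (n * T) := by nlinarith
    linarith
  · congr 1; ring

/-- The event that some forward shift explodes contains its preimage under the shift, so by
ergodicity it is null or full; null would contradict `not_ae_ne_top`. -/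
lemma IsModel.ae_exists_eq_top [IsProbabilityMeasure Q] (S : IsModel Q κ h) (hβ : betaCr Q κ h < β) :
    ∀ᵐ ξ ∂Q, ∃ n : ℕ, hittingMGF κ h (fun x => ξ (x + (n : ℤ))) β = ⊤ := by
  have hm := measurable_hittingMGF S.kappa_pos S.drift_pos S.drift_le β
  set E := {ξ : ℤ → ℝ | ∃ n : ℕ, hittingMGF κ h (shift^[n] ξ) β = ⊤} with hE
  have hEm : MeasurableSet E := by
    have : E = ⋃ n : ℕ, shift^[n] ⁻¹' {ξ | hittingMGF κ h ξ β = ⊤} := by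
      ext ξ; simp [hE]
    rw [this]
    exact MeasurableSet.iUnion fun n =>
      (measurable_shift.iterate n) (hm (measurableSet_singleton ⊤))
  have hsub : shift ⁻¹' E ⊆ E := by
    rintro ξ ⟨n, hn⟩
    exact ⟨n + 1, by rwa [Function.iterate_succ_apply]⟩
  rcases S.ergodic.ae_empty_or_univ_of_preimage_ae_le hEm.nullMeasurableSet
    (LE.le.eventuallyLE hsub) with h0 | h0
  · refine absurd ?_ (S.not_ae_ne_top hβ)
    filter_upwards [ae_eq_empty.1 h0 |> measure_eq_zero_iff_ae_notMem.1] with ξ hξ htop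
    exact hξ ⟨0, htop⟩
  · filter_upwards [eventuallyEq_univ.1 h0] with ξ ⟨n, hn⟩
    exact ⟨n, by rwa [shift_iterate] at hn⟩

lemma IsModel.ae_exists_le_rightKernel [IsProbabilityMeasure Q] (S : IsModel Q κ h) {b : ℝ} (hb : betaCr Q κ h < b) :
    ∀ᵐ ξ ∂Q, ∃ (z : ℕ) (C t₀ : ℝ), 0 < C ∧ 0 ≤ t₀ ∧ ∀ t, t₀ ≤ t →
      ENNReal.ofReal (C * Real.exp (-b * t)) ≤ rightKernel κ h ξ (point z) 0 t := by
  have hb0 : 0 ≤ b := S.betaCr_nonneg.trans hb.le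
  obtain ⟨β, hβ1, hβ2⟩ := exists_between hb
  filter_upwards [S.ae_exists_eq_top hβ1] with ξ ⟨n, hn⟩
  obtain ⟨T, hT, hloop⟩ := S.exists_rightKernel_loop_gt hn hβ2
  obtain ⟨C, hC, hCt⟩ := exists_le_kernel_loop hT hb0 hloop.le
  obtain ⟨t₀, ht₀, hpos⟩ := S.exists_kernel_pos ξ (1 + n)
  rw [Nat.cast_add, Nat.cast_one] at hpos
  obtain ⟨c, hc, hc'⟩ := ENNReal.lt_iff_exists_nnreal_btwn.1 hpos
  refine ⟨1 + n, c * C, t₀, mul_pos (by exact_mod_cast hc) hC, ht₀, fun t ht => ?_⟩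
  rw [Nat.cast_add, Nat.cast_one]
  refine le_trans ?_ ((mul_le_mul' hc'.le (hCt (t - t₀) (by linarith))).trans
    ((kernel_mul_kernel_le (by linarith) ht₀ 0 (1 + (n : ℤ))).trans (le_of_eq ?_)))
  · rw [← ENNReal.ofReal_coe_nnreal, ← ENNReal.ofReal_mul c.coe_nonneg, mul_assoc]
    refine ENNReal.ofReal_le_ofReal (mul_le_mul_of_nonneg_left (mul_le_mul_of_nonneg_left
      (Real.exp_le_exp.2 ?_) hC.le) c.coe_nonneg)
    nlinarith
  · congr 1; ring

end Quenched

end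

end PAM

/-! ### Lower bound at the typical travelling time, by localizing a Laplace integral. -/

namespace PAM

noncomputable section

/-! ### Lower bounds at the typical speed -/

lemma setLIntegral_exp_mul_Ioi {a : ℝ} (ha : 0 < a) (T : ℝ) :
    ∫⁻ t in Set.Ioi T, ENNReal.ofReal (Real.exp (-a * t)) =
      ENNReal.ofReal (Real.exp (-a * T) / a) := by
  rw [← ofReal_integral_eq_lintegral_ofReal (integrableOn_exp_mul_Ioi (by linarith) T)
    (ae_of_all _ fun t => (Real.exp_pos _).le), integral_exp_mul_Ioi (by linarith)]
  rw [neg_div_neg_eq]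

lemma setLIntegral_exp_mul_Iio {a : ℝ} (ha : 0 < a) (T : ℝ) :
    ∫⁻ t in Set.Iio T, ENNReal.ofReal (Real.exp (a * t)) =
      ENNReal.ofReal (Real.exp (a * T) / a) := by
  rw [setLIntegral_congr Iio_ae_eq_Iic,
    ← ofReal_integral_eq_lintegral_ofReal (integrableOn_exp_mul_Iic ha T)
    (ae_of_all _ fun t => (Real.exp_pos _).le), integral_exp_mul_Iic ha]

/-- If a function has a large exponential moment and is exponentially small to the left of `T₁`
and to the right of `T₂`, then it cannot be small on `[T₁, T₂]`. -/
lemma lintegral_exp_mul_le {f : ℝ → ℝ≥0∞} {β θ c C₁ C₂ T₁ T₂ : ℝ} (hθ : 0 < θ) (hT : T₁ ≤ T₂)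
    (h1 : ∀ t, f t ≤ ENNReal.ofReal (Real.exp (-(β + θ) * t)) * ENNReal.ofReal (Real.exp C₁))
    (h2 : ∀ t, f t ≤ ENNReal.ofReal (Real.exp (-(β - θ) * t)) * ENNReal.ofReal (Real.exp C₂))
    (h3 : ∀ t ∈ Set.Icc T₁ T₂, f t ≤ ENNReal.ofReal (Real.exp (-β * t + c))) :
    ∫⁻ t, ENNReal.ofReal (Real.exp (β * t)) * f t ≤
      ENNReal.ofReal (Real.exp c * (T₂ - T₁) + Real.exp (C₁ - θ * T₂) / θ +
        Real.exp (C₂ + θ * T₁) / θ) := by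
  have hpt : ∀ t, ENNReal.ofReal (Real.exp (β * t)) * f t ≤
      (Set.Icc T₁ T₂).indicator (fun _ => ENNReal.ofReal (Real.exp c)) t +
      (Set.Ioi T₂).indicator (fun t => ENNReal.ofReal (Real.exp C₁) *
        ENNReal.ofReal (Real.exp (-θ * t))) t +
      (Set.Iio T₁).indicator (fun t => ENNReal.ofReal (Real.exp C₂) *
        ENNReal.ofReal (Real.exp (θ * t))) t := fun t => by
    rcases lt_or_ge t T₁ with ht | ht
    · refine le_trans ?_ le_add_self
      rw [Set.indicator_of_mem (Set.mem_Iio.2 ht)]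
      refine (mul_le_mul' le_rfl (h2 t)).trans (le_of_eq ?_)
      rw [← mul_assoc, ← ENNReal.ofReal_mul (Real.exp_pos _).le, ← Real.exp_add, mul_comm]
      congr 4; ring
    · rcases le_or_gt t T₂ with ht' | ht'
      · refine le_trans ?_ (le_self_add.trans le_self_add)
        rw [Set.indicator_of_mem (Set.mem_Icc.2 ⟨ht, ht'⟩)]
        refine (mul_le_mul' le_rfl (h3 t ⟨ht, ht'⟩)).trans (le_of_eq ?_)
        rw [← ENNReal.ofReal_mul (Real.exp_pos _).le, ← Real.exp_add]
        congr 2; ring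
      · refine le_trans ?_ (le_add_self.trans le_self_add)
        rw [Set.indicator_of_mem (Set.mem_Ioi.2 ht')]
        refine (mul_le_mul' le_rfl (h1 t)).trans (le_of_eq ?_)
        rw [← mul_assoc, ← ENNReal.ofReal_mul (Real.exp_pos _).le, ← Real.exp_add, mul_comm]
        congr 4; ring
  refine (lintegral_mono hpt).trans (le_of_eq ?_)
  have m1 : Measurable fun t => ENNReal.ofReal (Real.exp C₁) *
      ENNReal.ofReal (Real.exp (-θ * t)) := by fun_prop
  have m2 : Measurable fun t => ENNReal.ofReal (Real.exp C₂) *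
      ENNReal.ofReal (Real.exp (θ * t)) := by fun_prop
  rw [lintegral_add_right _ (m2.indicator measurableSet_Iio),
    lintegral_add_right _ (m1.indicator measurableSet_Ioi),
    lintegral_indicator measurableSet_Icc, lintegral_indicator measurableSet_Ioi,
    lintegral_indicator measurableSet_Iio, setLIntegral_const, Real.volume_Icc,
    lintegral_const_mul _ (by fun_prop), lintegral_const_mul _ (by fun_prop),
    setLIntegral_exp_mul_Ioi hθ, setLIntegral_exp_mul_Iio hθ,
    ← ENNReal.ofReal_mul (Real.exp_pos _).le, ← ENNReal.ofReal_mul (Real.exp_pos _).le,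
    ← ENNReal.ofReal_mul (Real.exp_pos _).le, ← ENNReal.ofReal_add
      (mul_nonneg (Real.exp_pos _).le (by linarith)) (by positivity),
    ← ENNReal.ofReal_add (add_nonneg (mul_nonneg (Real.exp_pos _).le (by linarith))
      (by positivity)) (by positivity)]
  congr 1
  rw [sub_eq_add_neg C₁, Real.exp_add, Real.exp_add, ← neg_mul]
  ring

lemma eventually_linear_lt_exp {η : ℝ} (hη : 0 < η) (A B : ℝ) :
    ∀ᶠ n : ℕ in atTop, A * n + B < Real.exp (η * n) := by
  have h1 : Tendsto (fun x : ℝ => A * (x / Real.exp (η * x)) + B * Real.exp (-(η * x))) atTop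
      (𝓝 0) := by
    have e1 : Tendsto (fun x : ℝ => x / Real.exp (η * x)) atTop (𝓝 0) := by
      have := Real.tendsto_pow_mul_exp_neg_atTop_nhds_zero 1
      have h2 := (this.comp (tendsto_id.const_mul_atTop hη)).const_mul η⁻¹
      rw [mul_zero] at h2
      refine h2.congr fun x => ?_
      simp only [Function.comp, id, pow_one, Real.exp_neg]
      field_simp
    have e2 : Tendsto (fun x : ℝ => Real.exp (-(η * x))) atTop (𝓝 0) :=
      Real.tendsto_exp_neg_atTop_nhds_zero.comp (tendsto_id.const_mul_atTop hη)
    simpa using (e1.const_mul A).add (e2.const_mul B)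
  have h2 := (h1.comp tendsto_natCast_atTop_atTop).eventually_lt_const one_pos
  filter_upwards [h2] with n hn
  have h3 := Real.exp_pos (η * n)
  simp only [Function.comp, Real.exp_neg] at hn
  have h4 : A * (n / Real.exp (η * n)) + B * (Real.exp (η * n))⁻¹ =
      (A * n + B) / Real.exp (η * n) := by field_simp
  rw [h4, div_lt_one h3] at hn
  exact hn

section Speed

variable {Q : Measure (ℤ → ℝ)} {κ h β c : ℝ} [IsProbabilityMeasure Q]

/-- After time reversal the Laplace transform is a Green function at `0`, at least the product of
the hitting functionals times the resting weight at `0`; the ergodic lower bound applies to the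
product. -/
lemma IsModel.ae_le_laplace (S : IsModel Q κ h) (F : IsFiniteL Q κ h) (hβ : β < betaCr Q κ h)
    (hc : c < realL Q κ h β) : ∀ᵐ ξ ∂Q, ∃ C : ℝ, ∀ n : ℕ, ENNReal.ofReal (Real.exp (c * n - C)) ≤
      ∫⁻ t, ENNReal.ofReal (Real.exp (β * t)) * rightKernel κ h ξ (point n) 0 t := by
  have hb := ae_le_birkhoffSum_of_integrable S.ergodic
    (measurable_logMGF S.kappa_pos S.drift_pos S.drift_le β) (S.integrable_logMGF hβ (F β hβ)) hc
  have hfin := S.ae_ne_top hβ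
  filter_upwards [hb, S.ae_isRiccati hfin, ae_translate S.ergodic hfin] with ξ ⟨C, hC⟩ hR hξ
  have ha := hR.coeff_pos S.right_pos S.left_nonneg 0
  refine ⟨C + Real.log (-(ξ 0 - κ) - β), fun n => ?_⟩
  simp only [kernel_reverse 0 (n : ℤ)]
  rw [laplace_kernel β (v := fun z => ξ z - κ)]
  refine le_trans ?_ (hitTotal_mul_inv_le (n : ℤ))
  have e : hitTotal (ENNReal.ofReal (κ * (1 + h) / 2)) (ENNReal.ofReal (κ * (1 - h) / 2))
      (fun z => ENNReal.ofReal (-(ξ z - κ) - β)) n =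
      ENNReal.ofReal (Real.exp (birkhoffSum shift (fun ξ => logMGF κ h ξ β) n ξ)) := by
    rw [hitTotal_natCast, ← hR.prod_eq_exp,
      ENNReal.ofReal_prod_of_nonneg fun _ _ => ENNReal.toReal_nonneg]
    refine Finset.prod_congr rfl fun k _ => ?_
    rw [ENNReal.ofReal_toReal (hξ k), hittingMGF_eq_hitTotal S.kappa_pos S.drift_pos S.drift_le]
    congr 1
    ext y; congr 1; ring
  rw [e, ← ENNReal.ofReal_inv_of_pos ha, ← ENNReal.ofReal_mul (Real.exp_pos _).le]
  refine ENNReal.ofReal_le_ofReal ?_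
  rw [← sub_sub, sub_eq_add_neg _ (Real.log _), Real.exp_add, Real.exp_neg, Real.exp_log ha]
  exact mul_le_mul_of_nonneg_right (Real.exp_le_exp.2 (hC n)) (inv_nonneg.2 ha.le)

lemma IsModel.exists_realL_lt (S : IsModel Q κ h) (F : IsFiniteL Q κ h) (hβ : β < betaCr Q κ h)
    {δ : ℝ} (hδ : 0 < δ) : ∃ θ₀ : ℝ, 0 < θ₀ ∧ ∀ θ, 0 < θ → θ < θ₀ → β + θ < betaCr Q κ h ∧
      realL Q κ h (β + θ) < realL Q κ h β + θ * (derivL Q κ h β + δ) ∧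
      realL Q κ h (β - θ) < realL Q κ h β - θ * (derivL Q κ h β - δ) := by
  have hd := hasDerivAt_iff_isLittleO.1 (S.hasDerivAt_realL F hβ).2
  have h1 := hd.def (half_pos hδ)
  obtain ⟨ε, hε, hball⟩ := Metric.eventually_nhds_iff.1 h1
  refine ⟨min ε (betaCr Q κ h - β), lt_min hε (by linarith), fun θ h0 h1 => ?_⟩
  have hθε := h1.trans_le (min_le_left _ _)
  have hθb := h1.trans_le (min_le_right _ _)
  have a1 := hball (y := β + θ) (by rw [Real.dist_eq, add_sub_cancel_left, abs_of_pos h0]; exact hθε)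
  have a2 := hball (y := β - θ) (by
    rw [Real.dist_eq, sub_sub_cancel_left, abs_neg, abs_of_pos h0]; exact hθε)
  rw [add_sub_cancel_left, Real.norm_eq_abs, Real.norm_eq_abs, abs_of_pos h0, smul_eq_mul] at a1
  rw [sub_sub_cancel_left, Real.norm_eq_abs, Real.norm_eq_abs, abs_neg, abs_of_pos h0,
    smul_eq_mul] at a2
  have b1 := (abs_le.1 a1).2
  have b2 := (abs_le.1 a2).2
  have h5 := mul_pos hδ h0
  refine ⟨by linarith, by linarith, by linarith⟩

/-- If the kernel were small throughout the window, then by the bounds at `β ± θ` the whole Laplace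
integral would be exponentially smaller than `ae_le_laplace` allows. -/
lemma IsModel.ae_exists_le_rightKernel_speed (S : IsModel Q κ h) (F : IsFiniteL Q κ h)
    (hβ : β < betaCr Q κ h) {δ : ℝ} (hδ : 0 < δ) :
    ∀ᵐ ξ ∂Q, ∀ᶠ n : ℕ in atTop, ∃ t, 0 ≤ t ∧ n * (derivL Q κ h β - δ) ≤ t ∧
      t ≤ n * (derivL Q κ h β + δ) ∧
      ENNReal.ofReal (Real.exp (-β * t + n * (realL Q κ h β - δ))) ≤
        rightKernel κ h ξ (point n) 0 t := by
  set D := derivL Q κ h β with hD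
  set Λ := realL Q κ h β with hΛ
  obtain ⟨θ₀, hθ₀, hθ⟩ := S.exists_realL_lt F hβ (half_pos hδ)
  obtain ⟨θ, h0, h1⟩ := exists_between hθ₀
  obtain ⟨hb, hU, hL⟩ := hθ θ h0 h1
  -- The window loses at least `δ ≥ 2η` and the tails at least `θδ/2 ≥ 2η` per step, while the lower
  -- bound loses only `η`; the remaining factor `exp(ηn)` beats the linear length of the window.
  set η := min δ (θ * (δ / 2)) / 2 with hη
  have hη0 : 0 < η := half_pos (lt_min hδ (by positivity))
  have hη1 : 2 * η ≤ δ := by rw [hη]; linarith [min_le_left δ (θ * (δ / 2))]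
  have hη2 : 2 * η ≤ θ * (δ / 2) := by rw [hη]; linarith [min_le_right δ (θ * (δ / 2))]
  have hb' : β - θ < betaCr Q κ h := by linarith
  filter_upwards [S.ae_le_laplace F hβ (c := Λ - η) (by linarith),
    S.ae_kernel_right_le hb (c := Λ + θ * (D + δ / 2)) (by
      rw [S.L_eq_coe hb (F _ hb)]; exact_mod_cast hU),
    S.ae_kernel_right_le hb' (c := Λ - θ * (D - δ / 2)) (by
      rw [S.L_eq_coe hb' (F _ hb')]; exact_mod_cast hL)] with ξ ⟨C₀, hC₀⟩ ⟨C₁, hC₁⟩ ⟨C₂, hC₂⟩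
  filter_upwards [eventually_linear_lt_exp hη0 (Real.exp C₀ * (2 * δ))
    (Real.exp C₀ * ((Real.exp C₁ + Real.exp C₂) / θ))] with n hn
  have hexp : ∀ w t, expKernel w t ≤ ENNReal.ofReal (Real.exp (w * t)) := fun w t =>
    Set.indicator_le_self _ _ _
  by_contra! hcon
  have hsmall : ∀ t ∈ Set.Icc (n * (D - δ)) (n * (D + δ)), rightKernel κ h ξ (point n) 0 t ≤
      ENNReal.ofReal (Real.exp (-β * t + n * (Λ - δ))) := fun t ht => by
    rcases lt_or_ge t 0 with ht' | ht'
    · rw [rightKernel, kernel_of_neg ht']; exact zero_le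
    · exact (hcon t ht' ht.1 ht.2).le
  have hn0 : (0 : ℝ) ≤ n := n.cast_nonneg
  have key := (hC₀ n).trans (lintegral_exp_mul_le h0 (by nlinarith)
    (fun t => (hC₁ n t).trans (mul_le_mul' (hexp _ t) le_rfl))
    (fun t => (hC₂ n t).trans (mul_le_mul' (hexp _ t) le_rfl)) hsmall)
  rw [ENNReal.ofReal_le_ofReal_iff (by
    have : 0 ≤ n * (D + δ) - n * (D - δ) := by nlinarith
    positivity)] at key
  have g1 : Real.exp (n * (Λ - δ)) ≤ Real.exp (n * (Λ - 2 * η)) :=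
    Real.exp_le_exp.2 (by nlinarith)
  have g2 : Real.exp (C₁ + (Λ + θ * (D + δ / 2)) * n - θ * (n * (D + δ))) ≤
      Real.exp C₁ * Real.exp (n * (Λ - 2 * η)) := by
    rw [← Real.exp_add]; exact Real.exp_le_exp.2 (by nlinarith)
  have g3 : Real.exp (C₂ + (Λ - θ * (D - δ / 2)) * n + θ * (n * (D - δ))) ≤
      Real.exp C₂ * Real.exp (n * (Λ - 2 * η)) := by
    rw [← Real.exp_add]; exact Real.exp_le_exp.2 (by nlinarith)
  have g4 : Real.exp ((Λ - η) * n - C₀) =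
      Real.exp (n * (Λ - 2 * η)) * (Real.exp (η * n) * (Real.exp C₀)⁻¹) := by
    rw [← Real.exp_neg, ← Real.exp_add, ← Real.exp_add]; congr 1; ring
  have g5 : Real.exp ((Λ - η) * n - C₀) ≤ Real.exp (n * (Λ - 2 * η)) *
      (2 * δ * n + (Real.exp C₁ + Real.exp C₂) / θ) := by
    refine key.trans ?_
    calc _ ≤ Real.exp (n * (Λ - 2 * η)) * (2 * δ * n) +
          Real.exp C₁ * Real.exp (n * (Λ - 2 * η)) / θ +
          Real.exp C₂ * Real.exp (n * (Λ - 2 * η)) / θ := by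
          rw [show n * (D + δ) - n * (D - δ) = 2 * δ * n by ring]
          gcongr
      _ = _ := by ring
  rw [g4] at g5
  have g6 := le_of_mul_le_mul_left g5 (Real.exp_pos _)
  rw [← div_eq_mul_inv, div_le_iff₀ (Real.exp_pos _)] at g6
  linarith

end Speed

end

end PAM

/-! ### Logarithmic rates, and the decomposition of speed sets into end points. -/

namespace PAM

noncomputable section

/-! ### Exponential rates -/

/-- `F` decays (or grows) with an exponential rate less than `l`. -/
def IsSmall (l : ℝ) (F : ℝ → ℝ≥0∞) : Prop :=
  ∃ C γ : ℝ, -γ < l ∧ ∀ᶠ t in atTop, F t ≤ ENNReal.ofReal (C * Real.exp (-γ * t))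

/-- `F` has exponential rate at least `b`. -/
def IsLarge (b : ℝ) (F : ℝ → ℝ≥0∞) : Prop :=
  ∃ C : ℝ, 0 < C ∧ ∀ᶠ t in atTop, ENNReal.ofReal (C * Real.exp (b * t)) ≤ F t

section Rates

variable {F G : ℝ → ℝ≥0∞} {l b : ℝ}

lemma IsSmall.mono (hF : IsSmall l F) (hGF : ∀ᶠ t in atTop, G t ≤ F t) : IsSmall l G := by
  obtain ⟨C, γ, hγ, h⟩ := hF
  exact ⟨C, γ, hγ, by filter_upwards [h, hGF] with t h1 h2 using h2.trans h1⟩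

lemma IsSmall.add (hF : IsSmall l F) (hG : IsSmall l G) : IsSmall l (F + G) := by
  obtain ⟨C, γ, hγ, h⟩ := hF
  obtain ⟨C', γ', hγ', h'⟩ := hG
  refine ⟨|C| + |C'|, min γ γ', by rw [← max_neg_neg]; exact max_lt hγ hγ', ?_⟩
  filter_upwards [h, h', eventually_ge_atTop 0] with t h1 h2 ht
  have a1 : ∀ {K g : ℝ}, min γ γ' ≤ g →
      K * Real.exp (-g * t) ≤ |K| * Real.exp (-min γ γ' * t) := fun {K g} hg =>
    mul_le_mul (le_abs_self K) (Real.exp_le_exp.2 (by nlinarith)) (Real.exp_pos _).le (abs_nonneg K)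
  rw [Pi.add_apply, add_mul, ENNReal.ofReal_add (by positivity) (by positivity)]
  exact add_le_add (h1.trans (ENNReal.ofReal_le_ofReal (a1 (min_le_left _ _))))
    (h2.trans (ENNReal.ofReal_le_ofReal (a1 (min_le_right _ _))))

lemma inv_mul_log_ofReal {C g t : ℝ} (hC : 0 < C) (ht : 0 < t) :
    ((t⁻¹ : ℝ) : EReal) * ENNReal.log (ENNReal.ofReal (C * Real.exp (g * t))) =
      ((Real.log C * t⁻¹ + g : ℝ) : EReal) := by
  rw [ENNReal.log_ofReal_of_pos (mul_pos hC (Real.exp_pos _)), ← EReal.coe_mul,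
    Real.log_mul hC.ne' (Real.exp_pos _).ne', Real.log_exp]
  congr 1
  field_simp

lemma tendsto_mul_inv_add (K g : ℝ) : Tendsto (fun t : ℝ => K * t⁻¹ + g) atTop (𝓝 g) := by
  simpa using (tendsto_inv_atTop_zero.const_mul K).add_const g

lemma IsSmall.eventually_rate_le (hF : IsSmall l F) : ∃ c : ℝ, c < l ∧
    ∀ᶠ t : ℝ in atTop, ((t⁻¹ : ℝ) : EReal) * ENNReal.log (F t) ≤ c := by
  obtain ⟨C, γ, hγ, h⟩ := hF
  obtain ⟨c, hc1, hc2⟩ := exists_between hγ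
  refine ⟨c, hc2, ?_⟩
  filter_upwards [h, eventually_gt_atTop 0,
    (tendsto_mul_inv_add (Real.log (max C 1)) (-γ)).eventually_le_const hc1] with t h1 ht h2
  have h3 : F t ≤ ENNReal.ofReal (max C 1 * Real.exp (-γ * t)) :=
    h1.trans (ENNReal.ofReal_le_ofReal (mul_le_mul_of_nonneg_right (le_max_left _ _)
      (Real.exp_pos _).le))
  refine (mul_le_mul_of_nonneg_left (ENNReal.log_monotone h3) ?_).trans ?_
  · exact_mod_cast (inv_pos.2 ht).le
  · rw [inv_mul_log_ofReal (lt_max_of_lt_right one_pos) ht]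
    exact_mod_cast h2

lemma IsLarge.eventually_le_rate (hF : IsLarge b F) (hl : l < b) :
    ∀ᶠ t : ℝ in atTop, (l : EReal) ≤ ((t⁻¹ : ℝ) : EReal) * ENNReal.log (F t) := by
  obtain ⟨C, hC, h⟩ := hF
  filter_upwards [h, eventually_gt_atTop 0,
    (tendsto_mul_inv_add (Real.log C) b).eventually_const_le hl] with t h1 ht h2
  refine le_trans ?_ (mul_le_mul_of_nonneg_left (ENNReal.log_monotone h1) ?_)
  · rw [inv_mul_log_ofReal hC ht]
    exact_mod_cast h2
  · exact_mod_cast (inv_pos.2 ht).le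

lemma IsSmall.limsup_lt (hF : IsSmall l F) :
    limsup (fun t : ℝ => ((t⁻¹ : ℝ) : EReal) * ENNReal.log (F t)) atTop < l := by
  obtain ⟨c, hc, h⟩ := hF.eventually_rate_le
  exact (limsup_le_of_le (by isBoundedDefault) h).trans_lt (by exact_mod_cast hc)

lemma le_liminf_of_isLarge (hF : ∀ k : ℕ, IsLarge (l - 1 / (k + 1)) F) :
    (l : EReal) ≤ liminf (fun t : ℝ => ((t⁻¹ : ℝ) : EReal) * ENNReal.log (F t)) atTop := by
  refine EReal.ge_of_forall_gt_iff_ge.1 fun z hz => ?_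
  have hz' : z < l := by exact_mod_cast hz
  obtain ⟨k, hk⟩ := exists_nat_one_div_lt (sub_pos.2 hz')
  exact le_liminf_of_le (by isBoundedDefault) ((hF k).eventually_le_rate (by linarith))

lemma limsup_le_of_isSmall (hF : ∀ k : ℕ, IsSmall (l + 1 / (k + 1)) F) :
    limsup (fun t : ℝ => ((t⁻¹ : ℝ) : EReal) * ENNReal.log (F t)) atTop ≤ l := by
  refine EReal.le_of_forall_lt_iff_le.1 fun z hz => ?_
  have hz' : l < z := by exact_mod_cast hz
  obtain ⟨k, hk⟩ := exists_nat_one_div_lt (sub_pos.2 hz')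
  exact (hF k).limsup_lt.le.trans (by exact_mod_cast (by linarith : l + 1 / ((k : ℝ) + 1) ≤ z))

lemma tendsto_rate (h1 : ∀ k : ℕ, IsSmall (l + 1 / (k + 1)) F)
    (h2 : ∀ k : ℕ, IsLarge (l - 1 / (k + 1)) F) :
    Tendsto (fun t : ℝ => t⁻¹ * Real.log (F t).toReal) atTop (𝓝 l) := by
  have ht : Tendsto (fun t : ℝ => ((t⁻¹ : ℝ) : EReal) * ENNReal.log (F t)) atTop (𝓝 (l : EReal)) :=
    tendsto_of_le_liminf_of_limsup_le (le_liminf_of_isLarge h2) (limsup_le_of_isSmall h1)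
  rw [← EReal.tendsto_coe]
  refine ht.congr' ?_
  obtain ⟨C, γ, -, hs⟩ := h1 0
  obtain ⟨C', hC', hl⟩ := h2 0
  filter_upwards [hs, hl] with t h3 h4
  rw [ENNReal.log_pos_real, EReal.coe_mul]
  · exact ((ENNReal.ofReal_pos.2 (mul_pos hC' (Real.exp_pos _))).trans_le h4).ne'
  · exact ne_top_of_le_ne_top ENNReal.ofReal_ne_top h3

end Rates

/-! ### Speed sets -/

section Mass

variable {Q : Measure (ℤ → ℝ)} {κ h β c l γ : ℝ}

/-- The weight of the trajectories ending in `n` with `n ∈ s`. -/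
def rightMass (κ h : ℝ) (ξ : ℤ → ℝ) (s : Set ℕ) (t : ℝ) : ℝ≥0∞ :=
  ∑' n : ℕ, s.indicator (fun n : ℕ => rightKernel κ h ξ (point n) 0 t) n

/-- The weight of the trajectories ending in `-n` with `n ∈ s`. -/
def leftMass (κ h : ℝ) (ξ : ℤ → ℝ) (s : Set ℕ) (t : ℝ) : ℝ≥0∞ :=
  ∑' n : ℕ, s.indicator (fun n : ℕ => rightKernel κ h ξ (point (-n)) 0 t) n

lemma rightMass_le_add {ξ : ℤ → ℝ} {s s₁ s₂ : Set ℕ} {t : ℝ} (hs : s ⊆ s₁ ∪ s₂) :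
    rightMass κ h ξ s t ≤ rightMass κ h ξ s₁ t + rightMass κ h ξ s₂ t := by
  rw [rightMass, rightMass, rightMass, ← ENNReal.tsum_add]
  refine ENNReal.tsum_le_tsum fun n => ?_
  by_cases hn : n ∈ s
  · rcases hs hn with h1 | h1
    · rw [Set.indicator_of_mem hn, Set.indicator_of_mem h1]; exact le_self_add
    · rw [Set.indicator_of_mem hn, Set.indicator_of_mem h1]; exact le_add_self
  · rw [Set.indicator_of_notMem hn]; exact zero_le

lemma IsModel.speedMass_le (S : IsModel Q κ h) (ξ : ℤ → ℝ) {t : ℝ} (ht : 0 ≤ t) {A : Set ℝ}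
    {s s' : Set ℕ} (hs : ∀ n : ℕ, (n : ℝ) / t ∈ A → n ∈ s)
    (hs' : ∀ n : ℕ, -(n : ℝ) / t ∈ A → n ∈ s') :
    speedMass κ h ξ t A ≤ rightMass κ h ξ s t + leftMass κ h ξ s' t := by
  rw [speedMass_eq_kernel S.kappa_pos (by linarith [S.drift_pos]) S.drift_le ξ ht,
    kernel_eq_tsum_point, tsum_of_nat_of_neg_add_one ENNReal.summable ENNReal.summable]
  refine add_le_add (ENNReal.tsum_le_tsum fun n => ?_) ?_
  · by_cases hn : (n : ℝ) / t ∈ A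
    · rw [Set.indicator_of_mem (hs n hn)]
      simp [hn]
    · simp [hn]
  · rw [show leftMass κ h ξ s' t = _ from tsum_eq_zero_add' ENNReal.summable]
    refine le_trans (ENNReal.tsum_le_tsum fun n => ?_) le_add_self
    have e : -((n + 1 : ℕ) : ℝ) / t = ((-((n : ℤ) + 1) : ℤ) : ℝ) / t := by push_cast; ring
    by_cases hn : ((-((n : ℤ) + 1) : ℤ) : ℝ) / t ∈ A
    · rw [Set.indicator_of_mem (hs' _ (by rwa [e]))]
      simp only [hn, if_true, one_mul, Nat.cast_succ, le_refl]
    · simp only [hn, if_false, zero_mul, zero_le]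

lemma IsModel.rightKernel_le_speedMass (S : IsModel Q κ h) (ξ : ℤ → ℝ) {t : ℝ} (ht : 0 ≤ t)
    {A : Set ℝ} {y : ℤ} (hy : (y : ℝ) / t ∈ A) :
    rightKernel κ h ξ (point y) 0 t ≤ speedMass κ h ξ t A := by
  rw [speedMass_eq_kernel S.kappa_pos (by linarith [S.drift_pos]) S.drift_le ξ ht]
  refine kernel_mono (fun z => ?_) 0 t
  by_cases hz : z = y
  · subst hz; simp [point, hy]
  · simp [point, hz]

lemma IsModel.speedMass_mono (S : IsModel Q κ h) (ξ : ℤ → ℝ) {t : ℝ} (ht : 0 ≤ t)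
    {A B : Set ℝ} (hAB : A ⊆ B) : speedMass κ h ξ t A ≤ speedMass κ h ξ t B := by
  rw [speedMass_eq_kernel S.kappa_pos (by linarith [S.drift_pos]) S.drift_le ξ ht,
    speedMass_eq_kernel S.kappa_pos (by linarith [S.drift_pos]) S.drift_le ξ ht]
  refine kernel_mono (fun z => ?_) 0 t
  by_cases hz : (z : ℝ) / t ∈ A
  · simp [hz, hAB hz]
  · simp [hz]

lemma IsModel.ae_isSmall_rightMass [IsProbabilityMeasure Q] (S : IsModel Q κ h) (hβ : β < betaCr Q κ h)
    (hc : L Q κ h β < c) (hγ : -γ < l) (s : ℝ → Set ℕ)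
    (hs : ∀ t, 0 < t → ∀ n ∈ s t, -β * t + c * n ≤ -γ * t) :
    ∀ᵐ ξ ∂Q, IsSmall l fun t => rightMass κ h ξ (s t) t := by
  filter_upwards [S.ae_tsum_right_le hβ hc] with ξ ⟨C, hC⟩
  refine ⟨C, γ, hγ, ?_⟩
  filter_upwards [eventually_gt_atTop 0] with t ht
  exact hC t ht.le _ γ (hs t ht)

lemma IsModel.ae_isSmall_leftMass [IsProbabilityMeasure Q] (S : IsModel Q κ h) (hβ : β < betaCr Q κ h)
    (hc : L Q κ h β < c) (hγ : -γ < l) (s : ℝ → Set ℕ)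
    (hs : ∀ t, 0 < t → ∀ n ∈ s t, -β * t + (c - h) * n ≤ -γ * t) :
    ∀ᵐ ξ ∂Q, IsSmall l fun t => leftMass κ h ξ (s t) t := by
  filter_upwards [S.ae_tsum_left_le hβ hc] with ξ ⟨C, hC⟩
  refine ⟨C, γ, hγ, ?_⟩
  filter_upwards [eventually_gt_atTop 0] with t ht
  exact hC t ht.le _ γ (hs t ht)

lemma IsModel.isSmall_speedMass (S : IsModel Q κ h) {ξ : ℤ → ℝ} {A : Set ℝ} {s s' : ℝ → Set ℕ}
    (hs : ∀ t, 0 < t → ∀ n : ℕ, (n : ℝ) / t ∈ A → n ∈ s t)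
    (hs' : ∀ t, 0 < t → ∀ n : ℕ, -(n : ℝ) / t ∈ A → n ∈ s' t)
    (h1 : IsSmall l fun t => rightMass κ h ξ (s t) t)
    (h2 : IsSmall l fun t => leftMass κ h ξ (s' t) t) :
    IsSmall l fun t => speedMass κ h ξ t A :=
  (h1.add h2).mono (by
    filter_upwards [eventually_gt_atTop 0] with t ht
    exact S.speedMass_le ξ ht.le (hs t ht) (hs' t ht))

lemma IsModel.ae_isSmall_univ [IsProbabilityMeasure Q] (S : IsModel Q κ h) (hβ : β < betaCr Q κ h)
    (hL : L Q κ h β < 0) (hl : -β < l) :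
    ∀ᵐ ξ ∂Q, IsSmall l fun t => speedMass κ h ξ t Set.univ := by
  have h0 := S.drift_pos
  filter_upwards [S.ae_isSmall_rightMass (c := 0) hβ hL hl (fun _ => Set.univ)
      (fun t _ n _ => by simp),
    S.ae_isSmall_leftMass (c := 0) hβ hL hl (fun _ => Set.univ) (fun t _ n _ => by
      have : 0 ≤ h * n := by positivity
      linarith)] with ξ h1 h2
  exact S.isSmall_speedMass (fun t _ n _ => Set.mem_univ n) (fun t _ n _ => Set.mem_univ n) h1 h2

lemma IsModel.isQuenchedLyapunovExponent (S : IsModel Q κ h)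
    (h1 : ∀ b, l < b → ∀ᵐ ξ ∂Q, IsSmall b fun t => speedMass κ h ξ t Set.univ)
    (h2 : ∀ b, b < l → ∀ᵐ ξ ∂Q, IsLarge b fun t => speedMass κ h ξ t Set.univ) :
    IsQuenchedLyapunovExponent Q κ h l := by
  have h3 := ae_all_iff.2 fun k : ℕ => h1 (l + 1 / (k + 1)) (by
    have : 0 < 1 / ((k : ℝ) + 1) := by positivity
    linarith)
  have h4 := ae_all_iff.2 fun k : ℕ => h2 (l - 1 / (k + 1)) (by
    have : 0 < 1 / ((k : ℝ) + 1) := by positivity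
    linarith)
  filter_upwards [h3, h4, S.nonpos] with ξ h5 h6 hξ
  refine ⟨⟨_, isSolution_rightKernel S.kappa_pos (by linarith [S.drift_pos]) S.drift_le hξ⟩,
    fun u hu => (tendsto_rate h5 h6).congr' ?_⟩
  filter_upwards [eventually_ge_atTop 0] with t ht
  rw [hu.eq_speedMass S.kappa_pos (by linarith [S.drift_pos]) S.drift_le hξ ht]

end Mass

end

end PAM

/-! ### Cost of each speed: exponential upper and lower estimates. -/

namespace PAM

noncomputable section

section Cases

variable {Q : Measure (ℤ → ℝ)} {κ h β c l b ε : ℝ}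

/-! ### Upper bounds for untypical speeds -/

/-- By monotonicity in `ε` it suffices to treat `ε = 1/(k+1)`, so a single null set serves all `ε`.
-/
lemma IsModel.ae_limsup_lt (S : IsModel Q κ h) {A : ℝ → Set ℝ} (hA : Antitone A)
    (hs : ∀ ε, 0 < ε → ∀ᵐ ξ ∂Q, IsSmall l fun t => speedMass κ h ξ t (A ε)) :
    ∀ᵐ ξ ∂Q, ∀ ε, 0 < ε → limsup (speedRate κ h ξ (A ε)) atTop < l := by
  filter_upwards [ae_all_iff.2 fun k : ℕ => hs (1 / (k + 1)) (by positivity)] with ξ hξ ε hε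
  obtain ⟨k, hk⟩ := exists_nat_one_div_lt hε
  refine ((hξ k).mono ?_).limsup_lt
  filter_upwards [eventually_ge_atTop 0] with t ht
  exact S.speedMass_mono ξ ht (hA hk.le)

variable [IsProbabilityMeasure Q]

/-- Displacement by `εt` to the left gains `hεt` in the exponent, of which only half is lost by
taking `β` below `β_cr`. -/
lemma IsModel.ae_isSmall_leftMass_far (S : IsModel Q κ h)
    (hneg : ∀ β < betaCr Q κ h, L Q κ h β < 0) (hε : 0 < ε) :
    ∀ᵐ ξ ∂Q, IsSmall (-betaCr Q κ h) fun t => leftMass κ h ξ {n | ε * t ≤ n} t := by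
  have h0 := S.drift_pos
  have h1 := mul_pos h0 hε
  have hβ : betaCr Q κ h - h * ε / 2 < betaCr Q κ h := by linarith
  refine S.ae_isSmall_leftMass (c := 0) hβ (hneg _ hβ) (γ := betaCr Q κ h + h * ε / 2)
    (by linarith) _ fun t ht n hn => ?_
  have := mul_le_mul_of_nonneg_left (show ε * t ≤ n from hn) h0.le
  nlinarith

/-- With `L < c < 0` up to `β_cr`, moving right by `εt` gains `|c|εt`; placing `β` at distance
`|c|ε/2` below `β_cr` keeps half of it. -/
lemma IsModel.ae_isSmall_of_neg (S : IsModel Q κ h) (hc : c < 0)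
    (hneg : ∀ β < betaCr Q κ h, L Q κ h β < c) (hε : 0 < ε) :
    ∀ᵐ ξ ∂Q, IsSmall (-betaCr Q κ h) fun t => speedMass κ h ξ t (Set.Ioo (-ε) ε)ᶜ := by
  have h1 := mul_pos (neg_pos.2 hc) hε
  have hβ : betaCr Q κ h + c * ε / 2 < betaCr Q κ h := by linarith
  filter_upwards [S.ae_isSmall_leftMass_far (fun β hβ => (hneg β hβ).trans (by exact_mod_cast hc)) hε,
    S.ae_isSmall_rightMass hβ (hneg _ hβ) (γ := betaCr Q κ h - c * ε / 2)
      (l := -betaCr Q κ h) (by linarith) (fun t => {n | ε * t ≤ n}) fun t ht n hn => by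
        have := mul_le_mul_of_nonneg_left (show ε * t ≤ n from hn) (neg_pos.2 hc).le
        nlinarith] with ξ h2 h3
  refine S.isSmall_speedMass (fun t ht n hn => ?_) (fun t ht n hn => ?_) h3 h2
  · by_contra hcon
    rw [Set.mem_ofPred_eq, not_le] at hcon
    have : (0 : ℝ) ≤ n / t := by positivity
    exact hn ⟨by linarith, by rwa [div_lt_iff₀ ht]⟩
  · by_contra hcon
    rw [Set.mem_ofPred_eq, not_le] at hcon
    have : (0 : ℝ) ≤ n / t := by positivity
    refine hn ⟨?_, ?_⟩
    · rw [neg_div, neg_lt_neg_iff, div_lt_iff₀ ht]; exact hcon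
    · rw [neg_div]; linarith

lemma IsModel.ae_isSmall_of_derivL (S : IsModel Q κ h) (F : IsFiniteL Q κ h)
    (hneg : ∀ β < betaCr Q κ h, L Q κ h β < 0) {M : ℝ} (hM : 0 ≤ M) (hε : 0 < ε)
    (hβ : β < betaCr Q κ h) (hD : 1 < derivL Q κ h β * (M + ε)) :
    ∀ᵐ ξ ∂Q, IsSmall (-betaCr Q κ h) fun t => speedMass κ h ξ t (Set.Icc (-ε) (M + ε))ᶜ := by
  have hMε : 0 < M + ε := by linarith
  -- A slope between `1/(M + ε)` and `L'(β)`: the upper inequality gives strict room in the bound on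
  -- `L(β)`, the lower one the gain beyond speed `M + ε`.
  obtain ⟨a, ha1, ha2⟩ := exists_between ((div_lt_iff₀ hMε).2 hD)
  have ha0 : 0 < a := lt_trans (by positivity) ha1
  have ha3 : 1 < a * (M + ε) := (div_lt_iff₀ hMε).1 ha1
  -- The tangent at `β` stays below `L < 0` on `(-∞, β_cr)`; letting the argument increase to `β_cr`
  -- gives the bound.
  have htan : realL Q κ h β ≤ -((betaCr Q κ h - β) * derivL Q κ h β) := by
    have hDpos := S.derivL_pos F hβ
    have : betaCr Q κ h ≤ β + -realL Q κ h β / derivL Q κ h β := by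
      refine le_of_forall_lt fun x hx => ?_
      have h1 := S.realL_add_le F hβ hx
      have h2 := hneg x hx
      rw [S.L_eq_coe hx (F x hx)] at h2
      have h3 : realL Q κ h x < 0 := by exact_mod_cast h2
      rw [← sub_lt_iff_lt_add', lt_div_iff₀ hDpos]
      linarith
    rw [← sub_le_iff_le_add', le_div_iff₀ hDpos] at this
    linarith
  have hL : L Q κ h β < ((-((betaCr Q κ h - β) * a) : ℝ) : EReal) := by
    rw [S.L_eq_coe hβ (F β hβ)]
    have : (betaCr Q κ h - β) * a < (betaCr Q κ h - β) * derivL Q κ h β :=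
      mul_lt_mul_of_pos_left ha2 (by linarith)
    exact_mod_cast (by linarith : realL Q κ h β < -((betaCr Q κ h - β) * a))
  have hd : 0 < betaCr Q κ h - β := by linarith
  filter_upwards [S.ae_isSmall_leftMass_far hneg hε,
    S.ae_isSmall_rightMass hβ hL (γ := β + (betaCr Q κ h - β) * (a * (M + ε)))
      (l := -betaCr Q κ h) (by nlinarith) (fun t => {n | (M + ε) * t ≤ n}) fun t ht n hn => by
        have := mul_le_mul_of_nonneg_left (show (M + ε) * t ≤ n from hn) (mul_pos hd ha0).le
        nlinarith] with ξ h2 h3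
  refine S.isSmall_speedMass (fun t ht n hn => ?_) (fun t ht n hn => ?_) h3 h2
  · by_contra hcon
    rw [Set.mem_ofPred_eq, not_le] at hcon
    have : (0 : ℝ) ≤ n / t := by positivity
    exact hn ⟨by linarith, by rw [div_le_iff₀ ht]; exact hcon.le⟩
  · by_contra hcon
    rw [Set.mem_ofPred_eq, not_le] at hcon
    have : (0 : ℝ) ≤ n / t := by positivity
    refine hn ⟨?_, ?_⟩
    · rw [neg_div, neg_le_neg_iff, div_le_iff₀ ht]; exact hcon.le
    · rw [neg_div]; linarith

/-- A Chernoff bound around the root: too fast endpoints are estimated with parameter `β - θ`, too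
slow and leftward ones with `β + θ`. Since `L(β ± θ)` is close to `±θ L'(β)`, the optimal speed is
`1 / L'(β)`. -/
lemma IsModel.ae_isSmall_of_root (S : IsModel Q κ h) (F : IsFiniteL Q κ h)
    (hβ : β < betaCr Q κ h) (h0 : realL Q κ h β = 0) (hε : 0 < ε) :
    ∀ᵐ ξ ∂Q, IsSmall (-β) fun t => speedMass κ h ξ t
      (Set.Ioo ((derivL Q κ h β)⁻¹ - ε) ((derivL Q κ h β)⁻¹ + ε))ᶜ := by
  have hD := S.derivL_pos F hβ
  obtain ⟨D, hDdef⟩ : ∃ D, derivL Q κ h β = D := ⟨_, rfl⟩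
  rw [hDdef] at hD ⊢
  have hα : 0 < D⁻¹ := inv_pos.2 hD
  have hDα : D * D⁻¹ = 1 := mul_inv_cancel₀ hD.ne'
  set α := D⁻¹ with hαdef
  -- Chosen so that the derivative error at speed `α + ε` uses exactly half of the gain `Dε`.
  set δ := D * ε / (2 * (α + ε)) with hδ
  have hδ0 : 0 < δ := by positivity
  have hδ1 : δ * (α + ε) = D * ε / 2 := by rw [hδ]; field_simp
  have hδ2 : δ < D := by
    rw [hδ, div_lt_iff₀ (by positivity)]
    nlinarith
  have hdrift := S.drift_pos
  obtain ⟨θ₀, hθ₀, hθ⟩ := S.exists_realL_lt F hβ hδ0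
  -- The second constraint keeps `L(β + θ) < h`, so that leftward steps are not favoured at `β + θ`.
  obtain ⟨θ, hθ1, hθ2⟩ := exists_between (lt_min hθ₀ (div_pos hdrift (by linarith : 0 < D + δ)))
  obtain ⟨hb, hU, hL⟩ := hθ θ hθ1 (hθ2.trans_le (min_le_left _ _))
  have hθ3 : θ * (D + δ) < h := by
    have := hθ2.trans_le (min_le_right _ _)
    rwa [lt_div_iff₀ (by linarith)] at this
  rw [h0, zero_add, hDdef] at hU
  rw [h0, zero_sub, hDdef] at hL
  have hb' : β - θ < betaCr Q κ h := by linarith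
  have hp : 0 < θ * (D * ε) := by positivity
  filter_upwards [
    S.ae_isSmall_rightMass hb' (c := -(θ * (D - δ)))
      (by rw [S.L_eq_coe hb' (F _ hb')]; exact_mod_cast hL) (γ := β + θ * (D * ε) / 2) (l := -β)
      (by linarith) (fun t => {n | (α + ε) * t ≤ n}) fun t ht n hn => by
        have h1 := mul_le_mul_of_nonneg_left (show (α + ε) * t ≤ n from hn)
          (mul_pos hθ1 (sub_pos.2 hδ2)).le
        have h2 : (D - δ) * (α + ε) = 1 + D * ε / 2 := by linear_combination hDα - hδ1
        have h3 : θ * (D - δ) * ((α + ε) * t) = θ * (1 + D * ε / 2) * t := by rw [← h2]; ring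
        rw [h3] at h1
        linarith,
    S.ae_isSmall_rightMass hb (c := θ * (D + δ))
      (by rw [S.L_eq_coe hb (F _ hb)]; exact_mod_cast hU) (γ := β + θ * (D * ε) / 2) (l := -β)
      (by linarith) (fun t => {n | n ≤ (α - ε) * t}) fun t ht n hn => by
        have h1 := mul_le_mul_of_nonneg_left (show n ≤ (α - ε) * t from hn)
          (mul_pos hθ1 (by linarith : 0 < D + δ)).le
        have h2 : (D + δ) * (α - ε) ≤ 1 - D * ε / 2 := by nlinarith [mul_pos hδ0 hε]
        have h3 : θ * (D + δ) * ((α - ε) * t) ≤ θ * (1 - D * ε / 2) * t := by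
          rw [← mul_assoc, mul_assoc θ]
          exact mul_le_mul_of_nonneg_right (mul_le_mul_of_nonneg_left h2 hθ1.le) ht.le
        linarith,
    S.ae_isSmall_leftMass hb (c := h)
      (by rw [S.L_eq_coe hb (F _ hb)]; exact_mod_cast hU.trans hθ3) (γ := β + θ) (l := -β)
      (by linarith) (fun _ => Set.univ) fun t ht n _ => by simp] with ξ h1 h2 h3
  refine S.isSmall_speedMass (s := fun t => {n | (α + ε) * t ≤ n} ∪ {n | n ≤ (α - ε) * t})
    (fun t ht n hn => ?_) (fun t ht n _ => Set.mem_univ n)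
    ((h1.add h2).mono (Eventually.of_forall fun t => rightMass_le_add subset_rfl)) h3
  by_contra hcon
  rw [Set.mem_union, not_or, Set.mem_ofPred_eq, Set.mem_ofPred_eq, not_le, not_le] at hcon
  exact hn ⟨by rw [lt_div_iff₀ ht]; exact hcon.2, by rw [div_lt_iff₀ ht]; exact hcon.1⟩

/-! ### Lower bounds -/

lemma IsModel.ae_isLarge_zero (S : IsModel Q κ h) (hb : b < -betaCr Q κ h) :
    ∀ᵐ ξ ∂Q, ∀ A ∈ 𝓝 (0 : ℝ), IsLarge b fun t => speedMass κ h ξ t A := by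
  filter_upwards [S.ae_exists_le_rightKernel (b := -b) (by linarith)]
    with ξ ⟨z, C, t₀, hC, ht₀, hz⟩ A hA
  have hlim : Tendsto (fun t : ℝ => (z : ℝ) / t) atTop (𝓝 0) := tendsto_const_nhds.div_atTop tendsto_id
  refine ⟨C, hC, ?_⟩
  filter_upwards [hlim hA, eventually_ge_atTop t₀] with t h1 h2
  have h3 := hz t h2
  rw [neg_neg] at h3
  exact h3.trans (S.rightKernel_le_speedMass ξ (ht₀.trans h2) (by exact_mod_cast h1))

/-- Loop at a good site `z` for the spare time, then travel `⌊mt⌋` steps. As `m L'(β) < 1`, the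
travel takes less than `t`, and for `β` close to `β_cr` it costs almost nothing beyond the rate
`-β_cr`. -/
lemma IsModel.ae_isLarge_speed (S : IsModel Q κ h) (F : IsFiniteL Q κ h)
    (hlim : ∀ η, 0 < η → ∃ β < betaCr Q κ h, -η < realL Q κ h β) {m : ℝ} (hm : 0 < m)
    (hmD : ∀ β < betaCr Q κ h, m * derivL Q κ h β < 1) (hb : b < -betaCr Q κ h) :
    ∀ᵐ ξ ∂Q, ∀ A ∈ 𝓝 m, IsLarge b fun t => speedMass κ h ξ t A := by
  set B := betaCr Q κ h with hB
  -- Error budget: `ηt` for the loops and `2η` for each of the at most `mt` travelled steps.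
  set η := (-B - b) / (1 + 2 * m) with hηdef
  have hη : 0 < η := div_pos (by linarith) (by linarith)
  have hη' : η * (1 + 2 * m) = -B - b := by rw [hηdef, div_mul_cancel₀ _ (by linarith)]
  obtain ⟨β, hβ, hΛ⟩ := hlim η hη
  have hD := S.derivL_pos F hβ
  have h1 := hmD β hβ
  set D := derivL Q κ h β with hDdef
  set δ := min η ((1 - m * D) / (2 * m)) with hδdef
  have hδ : 0 < δ := lt_min hη (div_pos (by linarith) (by linarith))
  have hδ1 : δ ≤ η := min_le_left _ _
  have hδ2 : m * (D + δ) < 1 := by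
    have : δ ≤ (1 - m * D) / (2 * m) := min_le_right _ _
    rw [le_div_iff₀ (by linarith)] at this
    nlinarith
  filter_upwards [S.ae_exists_le_rightKernel (b := B + η) (by linarith),
    -- The site `z` depends on the potential, so the travel estimate is needed from all starting
    -- points simultaneously.
    ae_translate S.ergodic (S.ae_exists_le_rightKernel_speed F hβ hδ)]
    with ξ ⟨z, C, t₀, hC, ht₀, hz⟩ hmove A hA
  have hfl : Tendsto (fun t : ℝ => ⌊m * t⌋₊) atTop atTop :=
    tendsto_nat_floor_atTop.comp (tendsto_id.const_mul_atTop hm)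
  have hpos : Tendsto (fun t : ℝ => (((⌊m * t⌋₊ : ℤ) + z : ℤ) : ℝ) / t) atTop (𝓝 m) := by
    have e1 := tendsto_nat_floor_mul_div_atTop hm.le
    have e2 : Tendsto (fun t : ℝ => (z : ℝ) / t) atTop (𝓝 0) :=
      tendsto_const_nhds.div_atTop tendsto_id
    have e3 := e1.add e2
    rw [add_zero] at e3
    refine e3.congr fun t => ?_
    push_cast
    ring
  refine ⟨C, hC, ?_⟩
  filter_upwards [hfl.eventually (hmove z), hpos hA, eventually_ge_atTop (t₀ / (1 - m * (D + δ))),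
    eventually_ge_atTop 0] with t ⟨s, hs0, _, hs1, hs⟩ htA ht1 ht0
  rw [div_le_iff₀ (by linarith)] at ht1
  have hfloor : (⌊m * t⌋₊ : ℝ) ≤ m * t := Nat.floor_le (by positivity)
  have hn0 : (0 : ℝ) ≤ ⌊m * t⌋₊ := Nat.cast_nonneg _
  set n := ⌊m * t⌋₊ with hn
  have hst : s ≤ m * t * (D + δ) := hs1.trans (mul_le_mul_of_nonneg_right hfloor (by linarith))
  have hts : t₀ ≤ t - s := by nlinarith
  rw [rightKernel, kernel_point_translate (v := fun x => ξ x - κ) z, zero_add] at hs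
  refine le_trans ?_ (S.rightKernel_le_speedMass ξ ht0 (y := (n : ℤ) + z) htA)
  refine le_trans ?_ ((mul_le_mul' (hz (t - s) hts) hs).trans
    ((kernel_mul_kernel_le hs0 (by linarith) 0 (z : ℤ)).trans (le_of_eq (by congr 1; ring))))
  rw [← ENNReal.ofReal_mul (by positivity), mul_assoc, ← Real.exp_add]
  refine ENNReal.ofReal_le_ofReal (mul_le_mul_of_nonneg_left (Real.exp_le_exp.2 ?_) hC.le)
  have g1 : -(2 * η) * (m * t) ≤ n * (realL Q κ h β - δ) := by
    have a1 : -(2 * η) ≤ realL Q κ h β - δ := by linarith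
    have a2 := mul_le_mul_of_nonneg_left a1 hn0
    nlinarith
  have g2 : b = -B - η - 2 * η * m := by linarith
  have g3 : 0 ≤ (B + η - β) * s := mul_nonneg (by linarith) hs0
  rw [g2]
  nlinarith

/-- Wait at the origin and then travel at the typical speed, where `L(β) = 0` makes the travel cost
about `β` per unit of time. The waiting time is only of order `δt`, so the crude waiting bound is
harmless. -/
lemma IsModel.ae_isLarge_of_root (S : IsModel Q κ h) (F : IsFiniteL Q κ h)
    (hβ : β < betaCr Q κ h) (h0 : realL Q κ h β = 0) (hb : b < -β) :
    ∀ᵐ ξ ∂Q, IsLarge b fun t => speedMass κ h ξ t Set.univ := by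
  have hD := S.derivL_pos F hβ
  set D := derivL Q κ h β with hDdef
  filter_upwards [ae_all_iff.2 fun k : ℕ => S.ae_exists_le_rightKernel_speed F hβ
    (δ := 1 / (k + 1)) (by positivity)] with ξ hξ
  set K := |ξ 0 - κ| + |β| with hK
  have hK0 : 0 ≤ K := by positivity
  -- Waiting for at most `2δn + 2D` costs at most `K` per unit of time, and the travel loses `δn`;
  -- this choice keeps the growing part below `(-β - b)nD`. As `K` depends on `ξ`, the travel
  -- estimate was taken for all `δ = 1/(k+1)` at once.
  obtain ⟨k, hk⟩ := exists_nat_one_div_lt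
    (lt_min hD (div_pos (mul_pos (by linarith : 0 < -β - b) hD) (by linarith : 0 < 2 * K + 1)))
  obtain ⟨δ, hδdef⟩ : ∃ δ : ℝ, 1 / ((k : ℝ) + 1) = δ := ⟨_, rfl⟩
  have hδ : 0 < δ := by rw [← hδdef]; positivity
  have hmove := hξ k
  rw [hδdef] at hk hmove
  have hδ1 : δ < D := hk.trans_le (min_le_left _ _)
  have hδ2 : δ * (2 * K + 1) < (-β - b) * D := by
    have := hk.trans_le (min_le_right _ _)
    rwa [lt_div_iff₀ (by linarith)] at this
  have hfl : Tendsto (fun t : ℝ => ⌊t / (D + δ)⌋₊) atTop atTop :=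
    tendsto_nat_floor_atTop.comp (tendsto_id.atTop_div_const (by linarith))
  refine ⟨Real.exp (-(K * (2 * D))), Real.exp_pos _, ?_⟩
  filter_upwards [hfl.eventually hmove, eventually_ge_atTop 0] with t ⟨s, hs0, hs2, hs1, hs⟩ ht0
  have hfloor : (⌊t / (D + δ)⌋₊ : ℝ) * (D + δ) ≤ t := by
    rw [← le_div_iff₀ (by linarith)]
    exact Nat.floor_le (div_nonneg ht0 (by linarith))
  have hfloor2 : t ≤ (⌊t / (D + δ)⌋₊ + 1 : ℝ) * (D + δ) := by
    rw [← div_le_iff₀ (by linarith)]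
    exact (Nat.lt_floor_add_one _).le
  have hn0 : (0 : ℝ) ≤ ⌊t / (D + δ)⌋₊ := Nat.cast_nonneg _
  set n := ⌊t / (D + δ)⌋₊ with hn
  have hts : 0 ≤ t - s := by linarith
  have hwait := expKernel_le_kernel_point (r := ENNReal.ofReal (κ * (1 + h) / 2))
    (l := ENNReal.ofReal (κ * (1 - h) / 2)) (v := fun x => ξ x - κ) 0 (t - s)
  rw [expKernel_of_nonneg _ hts] at hwait
  refine le_trans ?_ (S.rightKernel_le_speedMass ξ ht0 (y := n) (Set.mem_univ _))
  refine le_trans ?_ ((mul_le_mul' hwait hs).trans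
    ((kernel_mul_kernel_le hs0 hts 0 0).trans (le_of_eq (by congr 1; ring))))
  rw [← ENNReal.ofReal_mul (Real.exp_pos _).le, ← Real.exp_add, ← Real.exp_add, h0]
  refine ENNReal.ofReal_le_ofReal (Real.exp_le_exp.2 ?_)
  have hnD : n * D ≤ t := by nlinarith
  have g1 : t - s ≤ 2 * δ * n + (D + δ) := by nlinarith
  have g2 : -(K * (t - s)) - β * t ≤ (ξ 0 - κ) * (t - s) + -β * s := by
    have a1 := mul_le_mul_of_nonneg_right (neg_abs_le (ξ 0 - κ)) hts
    have a2 := mul_le_mul_of_nonneg_right (neg_abs_le β) hts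
    rw [hK]
    linarith
  have g3 : K * (t - s) ≤ K * (2 * δ * n + 2 * D) := mul_le_mul_of_nonneg_left (by linarith) hK0
  have g4 : n * (δ * (2 * K + 1)) ≤ n * ((-β - b) * D) := mul_le_mul_of_nonneg_left hδ2.le hn0
  have g5 : (-β - b) * (n * D) ≤ (-β - b) * t := mul_le_mul_of_nonneg_left hnD (by linarith)
  linarith

end Cases

end

end PAM

/-! ### The three regimes, distinguished by the sign of the left limit of `L`. -/

namespace PAM

noncomputable section

/-! ### The three regimes -/

section Regimes

variable {Q : Measure (ℤ → ℝ)} {κ h β : ℝ}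

/-- The left limit of `L` at the critical value. -/
def leftLimL (Q : Measure (ℤ → ℝ)) (κ h : ℝ) : EReal := sSup (L Q κ h '' Set.Iio (betaCr Q κ h))

lemma L_le_leftLimL (hβ : β < betaCr Q κ h) : L Q κ h β ≤ leftLimL Q κ h :=
  le_sSup (Set.mem_image_of_mem _ hβ)

lemma IsModel.isFiniteL_of_ne_bot [IsProbabilityMeasure Q] (S : IsModel Q κ h) (hL : leftLimL Q κ h ≠ ⊥) :
    IsFiniteL Q κ h := by
  obtain ⟨_, ⟨β', hβ', rfl⟩, hlt⟩ := lt_sSup_iff.1 (bot_lt_iff_ne_bot.2 hL)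
  intro β hβ
  refine S.Lminus_ne_top hβ' (fun htop => hlt.ne' ?_) hβ
  exact S.L_eq_bot hβ' htop hβ'

/-- Strictness comes from strict monotonicity when `L` is finite; otherwise `L` is `-∞` throughout.
-/
lemma IsModel.L_neg [IsProbabilityMeasure Q] (S : IsModel Q κ h) (hL : leftLimL Q κ h ≤ 0) (hβ : β < betaCr Q κ h) :
    L Q κ h β < 0 := by
  by_cases hbot : leftLimL Q κ h = ⊥
  · have := L_le_leftLimL hβ
    rw [hbot, le_bot_iff] at this
    rw [this]; exact EReal.bot_lt_zero
  · have F := S.isFiniteL_of_ne_bot hbot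
    obtain ⟨b, hb, hb'⟩ := exists_between hβ
    have h1 := (L_le_leftLimL hb').trans hL
    rw [S.L_eq_coe hb' (F b hb')] at h1
    rw [S.L_eq_coe hβ (F β hβ)]
    have h2 : realL Q κ h b ≤ 0 := by exact_mod_cast h1
    exact_mod_cast (S.strictMonoOn_realL F hβ hb' hb).trans_le h2

lemma IsModel.exists_root [IsProbabilityMeasure Q] (S : IsModel Q κ h) (hL : 0 < leftLimL Q κ h) :
    IsFiniteL Q κ h ∧ ∃ β < betaCr Q κ h, realL Q κ h β = 0 := by
  have F := S.isFiniteL_of_ne_bot (EReal.bot_lt_zero.trans hL).ne'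
  refine ⟨F, ?_⟩
  obtain ⟨_, ⟨β₁, hβ₁, rfl⟩, hlt⟩ := lt_sSup_iff.1 hL
  rw [Set.mem_Iio] at hβ₁
  rw [S.L_eq_coe hβ₁ (F β₁ hβ₁)] at hlt
  have h1 : 0 < realL Q κ h β₁ := by exact_mod_cast hlt
  obtain ⟨β₂, hβ₂, h2⟩ := S.exists_realL_neg F
  have hle : β₂ ≤ β₁ := by
    by_contra hcon
    linarith [S.strictMonoOn_realL F hβ₁ hβ₂ (not_le.1 hcon)]
  have hcont : ContinuousOn (realL Q κ h) (Set.Icc β₂ β₁) := fun x hx =>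
    (S.hasDerivAt_realL F (hx.2.trans_lt hβ₁)).2.continuousAt.continuousWithinAt
  obtain ⟨β, hβ, h0⟩ := intermediate_value_Icc hle hcont ⟨h2.le, h1.le⟩
  exact ⟨β, hβ.2.trans_lt hβ₁, h0⟩

lemma IsModel.ae_isSmall_univ_of_neg [IsProbabilityMeasure Q] (S : IsModel Q κ h)
    (hneg : ∀ β < betaCr Q κ h, L Q κ h β < 0) {b : ℝ} (hb : -betaCr Q κ h < b) :
    ∀ᵐ ξ ∂Q, IsSmall b fun t => speedMass κ h ξ t Set.univ := by
  obtain ⟨β, hβ1, hβ2⟩ := exists_between (neg_lt.1 hb)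
  exact S.ae_isSmall_univ hβ2 (hneg β hβ2) (by linarith)

lemma IsModel.isQuenchedLyapunovExponent_of_neg [IsProbabilityMeasure Q] (S : IsModel Q κ h)
    (hneg : ∀ β < betaCr Q κ h, L Q κ h β < 0) :
    IsQuenchedLyapunovExponent Q κ h (-betaCr Q κ h) :=
  S.isQuenchedLyapunovExponent (fun _ hb => S.ae_isSmall_univ_of_neg hneg hb) fun _ hb =>
    (S.ae_isLarge_zero hb).mono fun _ hξ => hξ _ univ_mem

lemma IsModel.isQuenchedLyapunovExponent_of_root [IsProbabilityMeasure Q] (S : IsModel Q κ h) (F : IsFiniteL Q κ h)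
    (hβ : β < betaCr Q κ h) (h0 : realL Q κ h β = 0) :
    IsQuenchedLyapunovExponent Q κ h (-β) := by
  refine S.isQuenchedLyapunovExponent (fun b hb => ?_) fun b hb => S.ae_isLarge_of_root F hβ h0 hb
  obtain ⟨x, hx1, hx2⟩ := exists_between (neg_lt.1 hb)
  have hx := hx2.trans hβ
  refine S.ae_isSmall_univ hx ?_ (by linarith)
  rw [S.L_eq_coe hx (F x hx)]
  exact_mod_cast (S.strictMonoOn_realL F hx hβ hx2).trans_eq h0

/-- The left limit of the derivative of `L` at the critical value. -/
def leftLimDerivL (Q : Measure (ℤ → ℝ)) (κ h : ℝ) : EReal :=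
  sSup ((fun β => (derivL Q κ h β : EReal)) '' Set.Iio (betaCr Q κ h))

lemma IsModel.tendsto_derivL [IsProbabilityMeasure Q] (S : IsModel Q κ h) (F : IsFiniteL Q κ h) :
    Tendsto (fun β => (derivL Q κ h β : EReal)) (𝓝[<] betaCr Q κ h) (𝓝 (leftLimDerivL Q κ h)) :=
  MonotoneOn.tendsto_nhdsLT (fun _ hx _ hy hxy =>
    EReal.coe_le_coe_iff.2 (S.derivL_mono F hx hy hxy)) (OrderTop.bddAbove _)

lemma derivL_le_leftLimDerivL (hβ : β < betaCr Q κ h) :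
    (derivL Q κ h β : EReal) ≤ leftLimDerivL Q κ h :=
  le_sSup (Set.mem_image_of_mem (fun β => (derivL Q κ h β : EReal)) hβ)

lemma IsModel.leftLimDerivL_pos [IsProbabilityMeasure Q] (S : IsModel Q κ h) (F : IsFiniteL Q κ h) :
    0 < leftLimDerivL Q κ h := by
  obtain ⟨β, hβ⟩ := exists_lt (betaCr Q κ h)
  exact lt_of_lt_of_le (by exact_mod_cast S.derivL_pos F hβ) (derivL_le_leftLimDerivL hβ)

lemma IsModel.leftLimDerivL_cases [IsProbabilityMeasure Q] (S : IsModel Q κ h) (F : IsFiniteL Q κ h) :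
    (leftLimDerivL Q κ h = ⊤ ∧ (leftLimDerivL Q κ h)⁻¹.toReal = 0) ∨
      ∃ d : ℝ, 0 < d ∧ leftLimDerivL Q κ h = d ∧ (leftLimDerivL Q κ h)⁻¹.toReal = d⁻¹ := by
  have hpos := S.leftLimDerivL_pos F
  generalize leftLimDerivL Q κ h = D at hpos
  induction D with
  | bot => simp at hpos
  | top => left; simp
  | coe d =>
    refine Or.inr ⟨d, by exact_mod_cast hpos, rfl, ?_⟩
    rw [← EReal.coe_inv, EReal.toReal_coe]

lemma IsModel.ae_limsup_of_eq_zero [IsProbabilityMeasure Q] (S : IsModel Q κ h) (hL : leftLimL Q κ h = 0) :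
    ∀ᵐ ξ ∂Q, ∀ ε, 0 < ε → limsup (speedRate κ h ξ
      (Set.Icc (-ε) ((leftLimDerivL Q κ h)⁻¹.toReal + ε))ᶜ) atTop <
        ((-betaCr Q κ h : ℝ) : EReal) := by
  have F := S.isFiniteL_of_ne_bot (by simp [hL])
  set M := (leftLimDerivL Q κ h)⁻¹.toReal with hM
  refine S.ae_limsup_lt (A := fun ε => (Set.Icc (-ε) (M + ε))ᶜ) (fun ε ε' hε =>
    Set.compl_subset_compl.2 (Set.Icc_subset_Icc (by linarith) (by linarith))) fun ε hε => ?_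
  have hcase := S.leftLimDerivL_cases F
  rw [← hM] at hcase
  have hM0 : 0 ≤ M := by
    rcases hcase with ⟨-, h1⟩ | ⟨d, hd, -, h1⟩ <;> rw [h1]
    positivity
  -- The derivatives increase to `1/M`, or to `∞` if `M = 0`, hence eventually exceed `1/(M + ε)`.
  obtain ⟨β, hβ, hD⟩ : ∃ β < betaCr Q κ h, 1 < derivL Q κ h β * (M + ε) := by
    have hlt : (((M + ε)⁻¹ : ℝ) : EReal) < leftLimDerivL Q κ h := by
      rcases hcase with ⟨h1, -⟩ | ⟨d, hd, h1, h2⟩ <;> rw [h1]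
      · exact EReal.coe_lt_top _
      · rw [h2]
        exact_mod_cast inv_lt_of_inv_lt₀ hd (by linarith)
    obtain ⟨_, ⟨β, hβ, rfl⟩, h1⟩ := lt_sSup_iff.1 hlt
    refine ⟨β, hβ, ?_⟩
    have h2 : (M + ε)⁻¹ < derivL Q κ h β := EReal.coe_lt_coe_iff.1 h1
    rwa [inv_lt_iff_one_lt_mul₀ (by linarith)] at h2
  exact S.ae_isSmall_of_derivL F (fun β hβ => S.L_neg hL.le hβ) hM0 hε hβ hD

lemma IsModel.ae_eq_liminf_of_eq_zero [IsProbabilityMeasure Q] (S : IsModel Q κ h) (hL : leftLimL Q κ h = 0) :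
    ∀ᵐ ξ ∂Q, ∀ ε, 0 < ε → ∀ m ∈ Set.Icc 0 (leftLimDerivL Q κ h)⁻¹.toReal,
      ((-betaCr Q κ h : ℝ) : EReal) =
        liminf (speedRate κ h ξ (Set.Ioo (m - ε) (m + ε))) atTop := by
  have F := S.isFiniteL_of_ne_bot (by simp [hL])
  have hneg : ∀ β < betaCr Q κ h, L Q κ h β < 0 := fun β hβ => S.L_neg hL.le hβ
  have hlim : ∀ η, 0 < η → ∃ β < betaCr Q κ h, -η < realL Q κ h β := fun η hη => by
    have hlt : ((-η : ℝ) : EReal) < leftLimL Q κ h := by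
      rw [hL]; exact_mod_cast neg_lt_zero.2 hη
    obtain ⟨_, ⟨β, hβ, rfl⟩, h1⟩ := lt_sSup_iff.1 hlt
    rw [Set.mem_Iio] at hβ
    rw [S.L_eq_coe hβ (F β hβ)] at h1
    exact ⟨β, hβ, by exact_mod_cast h1⟩
  have hcase := S.leftLimDerivL_cases F
  set M := (leftLimDerivL Q κ h)⁻¹.toReal with hM
  have hmD : ∀ m, 0 < m → m < M → ∀ β < betaCr Q κ h, m * derivL Q κ h β < 1 :=
    fun m hm hmM β hβ => by
      rcases hcase with ⟨-, h1⟩ | ⟨d, hd, h1, h2⟩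
      · linarith
      · have h3 := derivL_le_leftLimDerivL hβ
        rw [h1] at h3
        have h4 : derivL Q κ h β ≤ d := by exact_mod_cast h3
        calc m * derivL Q κ h β ≤ m * d := mul_le_mul_of_nonneg_left h4 hm.le
          _ < d⁻¹ * d := mul_lt_mul_of_pos_right (by rwa [← h2]) hd
          _ = 1 := inv_mul_cancel₀ hd.ne'
  have hk : ∀ k : ℕ, 0 < 1 / ((k : ℝ) + 1) := fun k => by positivity
  have h1 := ae_all_iff.2 fun k : ℕ => S.ae_isSmall_univ_of_neg hneg
    (b := -betaCr Q κ h + 1 / (k + 1)) (by linarith [hk k])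
  have h2 := ae_all_iff.2 fun k : ℕ => S.ae_isLarge_zero
    (b := -betaCr Q κ h - 1 / (k + 1)) (by linarith [hk k])
  -- Rational speeds inside `(0, M)` keep the null set fixed and suffice: when `M > 0`, every
  -- neighbourhood of a point of `[0, M]` contains one of them.
  have h3 : ∀ᵐ ξ ∂Q, ∀ (m : ℚ) (k : ℕ), 0 < (m : ℝ) → (m : ℝ) < M → ∀ A ∈ 𝓝 (m : ℝ),
      IsLarge (-betaCr Q κ h - 1 / (k + 1)) fun t => speedMass κ h ξ t A := by
    refine ae_all_iff.2 fun m => ae_all_iff.2 fun k => ?_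
    by_cases hm : 0 < (m : ℝ) ∧ (m : ℝ) < M
    · filter_upwards [S.ae_isLarge_speed F hlim hm.1 (hmD m hm.1 hm.2)
        (b := -betaCr Q κ h - 1 / (k + 1)) (by linarith [hk k])] with ξ hξ _ _
      exact hξ
    · exact ae_of_all _ fun ξ h4 h5 => absurd ⟨h4, h5⟩ hm
  filter_upwards [h1, h2, h3] with ξ g1 g2 g3 ε hε m hm
  refine le_antisymm (le_liminf_of_isLarge fun k => ?_) ?_
  · by_cases hM0 : M = 0
    · have hm0 : m = 0 := le_antisymm (hm.2.trans hM0.le) hm.1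
      subst hm0
      exact g2 k _ (Ioo_mem_nhds (by linarith) (by linarith))
    · have hMpos : 0 < M := lt_of_le_of_ne (hm.1.trans hm.2) (Ne.symm hM0)
      obtain ⟨r, hr1, hr2⟩ := exists_rat_btwn (show max (m - ε) 0 < min (m + ε) M from
        max_lt (lt_min (by linarith) (by linarith [hm.2])) (lt_min (by linarith [hm.1]) hMpos))
      exact g3 r k ((le_max_right _ _).trans_lt hr1) (hr2.trans_le (min_le_right _ _)) _
        (Ioo_mem_nhds ((le_max_left _ _).trans_lt hr1) (hr2.trans_le (min_le_left _ _)))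
  · refine (liminf_le_limsup).trans (limsup_le_of_isSmall fun k => (g1 k).mono ?_)
    filter_upwards [eventually_ge_atTop 0] with t ht
    exact S.speedMass_mono ξ ht (Set.subset_univ _)

end Regimes

end

end PAM

/-! ### Assembly of the theorem from the three regimes. -/

theorem mainTheorem5 (κ h : ℝ) (hκ : 0 < κ) (h_pos : 0 < h) (h_le : h ≤ 1)
    (Q : Measure (ℤ → ℝ)) [IsProbabilityMeasure Q]
    (h_nonpos : ∀ᵐ ξ ∂Q, ∀ x, ξ x ≤ 0)
    (h_essSup : essSup (fun ξ : ℤ → ℝ => ξ 0) Q = 0)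
    (h_nonconst : ¬ ∀ᵐ ξ ∂Q, ∀ x y, ξ x = ξ y)
    (hQ : (Ergodic PAM.shift Q ∧ ∃ b : ℝ, b < 0 ∧ ∀ᵐ ξ ∂Q, ∀ x, b ≤ ξ x) ∨
      ∃ η : Measure ℝ, IsProbabilityMeasure η ∧ Q = Measure.infinitePi fun _ : ℤ => η) :
    ∃ (l : ℝ) (Lcr : EReal),
      PAM.IsQuenchedLyapunovExponent Q κ h l ∧
      Tendsto (PAM.L Q κ h) (𝓝[<] PAM.betaCr Q κ h) (𝓝 Lcr) ∧
      (0 < Lcr → ∃ D : ℝ, 0 < D ∧ PAM.HasDerivL Q κ h D (-l) ∧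
        ENNReal.ofReal D = ∫⁻ ξ, PAM.hittingMean κ h ξ (-l) / PAM.hittingMGF κ h ξ (-l) ∂Q ∧
        ∀ᵐ ξ ∂Q, ∀ ε : ℝ, 0 < ε →
          limsup (PAM.speedRate κ h ξ (Set.Ioo (D⁻¹ - ε) (D⁻¹ + ε))ᶜ) atTop < (l : EReal)) ∧
      (Lcr = 0 → ∃ (L' : ℝ → ℝ) (D : EReal),
        (∀ β < PAM.betaCr Q κ h, PAM.HasDerivL Q κ h (L' β) β) ∧
        0 < D ∧
        Tendsto (fun β => (L' β : EReal)) (𝓝[<] PAM.betaCr Q κ h) (𝓝 D) ∧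
        ∀ᵐ ξ ∂Q, ∀ ε : ℝ, 0 < ε →
          (∀ m ∈ Set.Icc 0 (D⁻¹).toReal,
            (l : EReal) = liminf (PAM.speedRate κ h ξ (Set.Ioo (m - ε) (m + ε))) atTop) ∧
          limsup (PAM.speedRate κ h ξ (Set.Icc (-ε) ((D⁻¹).toReal + ε))ᶜ) atTop < (l : EReal)) ∧
      (Lcr < 0 → ∀ᵐ ξ ∂Q, ∀ ε : ℝ, 0 < ε →
        limsup (PAM.speedRate κ h ξ (Set.Ioo (-ε) ε)ᶜ) atTop < (l : EReal)) := by
  have hErg : Ergodic PAM.shift Q := by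
    rcases hQ with ⟨hE, -⟩ | ⟨η, hη, rfl⟩
    · exact hE
    · exact PAM.ergodic_shift_infinitePi η
  have S : PAM.IsModel Q κ h := ⟨hκ, h_pos, h_le, hErg, h_nonpos⟩
  have hlim : Tendsto (PAM.L Q κ h) (𝓝[<] PAM.betaCr Q κ h) (𝓝 (PAM.leftLimL Q κ h)) :=
    S.monotone_L.tendsto_nhdsLT _
  rcases lt_trichotomy (PAM.leftLimL Q κ h) 0 with hL | hL | hL
  · have hneg : ∀ β < PAM.betaCr Q κ h, PAM.L Q κ h β < 0 := fun β hβ => S.L_neg hL.le hβ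
    refine ⟨-PAM.betaCr Q κ h, _, S.isQuenchedLyapunovExponent_of_neg hneg, hlim,
      fun h => absurd h hL.not_gt, fun h => absurd h hL.ne, fun _ => ?_⟩
    obtain ⟨c, hc1, hc2⟩ := EReal.lt_iff_exists_real_btwn.1 hL
    refine S.ae_limsup_lt (A := fun ε => (Set.Ioo (-ε) ε)ᶜ) (fun ε ε' hε =>
      Set.compl_subset_compl.2 (Set.Ioo_subset_Ioo (by linarith) hε)) fun ε hε =>
        S.ae_isSmall_of_neg (c := c) (by exact_mod_cast hc2)
          (fun β hβ => (PAM.L_le_leftLimL hβ).trans_lt hc1) hε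
  · have F := S.isFiniteL_of_ne_bot (by simp [hL])
    refine ⟨-PAM.betaCr Q κ h, _,
      S.isQuenchedLyapunovExponent_of_neg fun β hβ => S.L_neg hL.le hβ, hlim,
      fun h => absurd h hL.not_gt, fun _ => ⟨PAM.derivL Q κ h, PAM.leftLimDerivL Q κ h,
        fun β hβ => S.hasDerivL F hβ, S.leftLimDerivL_pos F, S.tendsto_derivL F, ?_⟩,
      fun h => absurd h hL.not_lt⟩
    filter_upwards [S.ae_eq_liminf_of_eq_zero hL, S.ae_limsup_of_eq_zero hL] with ξ h1 h2 ε hε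
    exact ⟨h1 ε hε, h2 ε hε⟩
  · obtain ⟨F, β, hβ, h0⟩ := S.exists_root hL
    refine ⟨-β, _, S.isQuenchedLyapunovExponent_of_root F hβ h0, hlim, fun _ =>
      ⟨PAM.derivL Q κ h β, S.derivL_pos F hβ, ?_, ?_, ?_⟩, fun h => absurd h hL.ne',
      fun h => absurd h hL.not_gt⟩
    · rw [neg_neg]; exact S.hasDerivL F hβ
    · rw [neg_neg]; exact S.ofReal_derivL F hβ
    · exact S.ae_limsup_lt
        (A := fun ε => (Set.Ioo ((PAM.derivL Q κ h β)⁻¹ - ε) ((PAM.derivL Q κ h β)⁻¹ + ε))ᶜ)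
        (fun ε ε' hε => Set.compl_subset_compl.2 (Set.Ioo_subset_Ioo (by linarith) (by linarith)))
        fun ε hε => S.ae_isSmall_of_root F hβ h0 hε
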